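/- Let $\Omega\subset\mathbb{R}^2\simeq\mathbb{C}$ be a bounded domain (open and connected, not necessarily simply connected) with smooth boundary, let $g:\partial\Omega\to\mathbb{S}^1$ be smooth, let $d_1,\dots,d_n\in\mathbb{Z}$, and let $\Omega^n_*=\{x\in\Omega^n: x_j\neq x_k \text{ for } j\neq k\}$. Write $h^\perp=(-h_2,h_1)$, $\nabla^\perp f=(\nabla f)^\perp$ and, for a map $u$ into $\mathbb{S}^1\subset\mathbb{C}$, $\mathrm{j}u=\det(u,\nabla u)$, that is $(\mathrm{j}u)_k=\det(u,\partial_k u)$. Let $U\subseteq\Omega^n_*$ be open and let $(u_x)_{x\in U}$ be a family such that, for each $x\in U$, $$u_x(z)=\Bigl(\frac{z-x_1}{|z-x_1|}\Bigr)^{d_1}\cdots\Bigl(\frac{z-x_n}{|z-x_n|}\Bigr)^{d_n}v_x(z)\quad\text{for } z\in\Omega\setminus\{x_1,\dots,x_n\},$$ where $v_x\in C^2(\Omega,\mathbb{S}^1)$ is a harmonic map ($-\Delta v_x=|\nabla v_x|^2v_x$), $u_x$ is continuous on $\overline\Omega\setminus\{x_1,\dots,x_n\}$ with $u_x=g$ on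 $\partial\Omega$, and such that $x\mapsto u_x$ is continuous from $U$ to $W^{1,p}(\Omega)$ for some $p\in[1,2)$. Then for every $x\in U$ and $\rho>0$ the function $|\nabla u_x|^2$ is integrable on $\Omega\setminus\bigcup_jB_\rho(x_j)$, and the limit defining the renormalised energy $$W(x)=\lim_{\rho\to0}\Bigl(\int_{\Omega\setminus\bigcup_{j}B_\rho(x_j)}|\nabla u_x|^2-2\pi\sum_{j=1}^nd_j^2\ln\frac1\rho\Bigr)$$ exists in $\mathbb{R}$. Let $x\in U$ and let $\Phi\in C^2(\Omega\setminus\{x_1,\dots,x_n\},\mathbb{R})$, of class $C^1$ up to $\partial\Omega$, and $\Theta\in C^2(\Omega,\mathbb{R})\cap C(\overline\Omega)$ solve the singular linear problem $$\begin{cases}\Delta\Phi=\sum_{j=1}^n2\pi d_j\delta_{x_j}&\text{in }\Omega\text{ (in the sense of distributions, }\Phi\in L^1_{\mathrm{loc}}(\Omega)),\\ \Delta\Theta=0&\text{in }\Omega,\\ \Theta\text{ is constant}&\text{on each connected component of }\partial\Omega,\\ \partial_\nu\Phi=-ig^{-1}\partial_\tau g&\text{on }\partial\Omega,\\ g(\gamma(1))=e^{i\mathfrak{F}_\gamma(\Phi,\Theta)}g(\gamma(0))&\text{for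 every }\gamma\in\Sigma,\end{cases}$$ where $\nu$ is the outward unit normal, $\tau=\nu^\perp$, $\mathfrak{F}_\gamma(\Phi,\Theta)=\int_0^1\det(\nabla\Phi(\gamma(t)),\gamma'(t))\,dt+\Theta(\gamma(1))-\Theta(\gamma(0))$ and $\Sigma$ is the set of curves $\gamma\in C^1([0,1],\overline\Omega\setminus\{x_1,\dots,x_n\})$ with $\gamma(0),\gamma(1)\in\partial\Omega$. Assume that $(\Phi,\Theta)$ is the solution corresponding to $u_x$, that is, $\mathrm{j}u_x=\nabla^\perp\Phi+\nabla\Theta$ in $\Omega\setminus\{x_1,\dots,x_n\}$. Then for each $j$ the function $\Phi(z)-d_j\ln|z-x_j|$ extends to a continuous function $H_j$ on $\Omega\setminus\{x_k:k\neq j\}$ that is differentiable at $x_j$, the function $W$ is differentiable at $x$, and $$\nabla W(x)=-4\pi\Bigl(d_1\bigl(\nabla H_1(x_1)-\nabla^\perp\Theta(x_1)\bigr),\dots,d_n\bigl(\nabla H_n(x_n)-\nabla^\perp\Theta(x_n)\bigr)\Bigr).$$ -/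

import Mathlib

open scoped ContDiff Topology
open MeasureTheory Set

noncomputable section

/-- The plane `ℝ²` is identified with `ℂ`. An `n`-tuple of points of the plane, the space of such
tuples being the Euclidean space `ℝ²ⁿ`. -/
abbrev Config (n : ℕ) : Type := PiLp 2 (fun _ : Fin n => ℂ)

/-- The configuration space of `n` distinct points of `Ω`. -/
def configSpace (Ω : Set ℂ) (n : ℕ) : Set (Config n) :=
  {x | (∀ j, x j ∈ Ω) ∧ Function.Injective fun j => x j}

/-- The singular points of a configuration, as a subset of the plane. -/
def singularPoints {n : ℕ} (x : Config n) : Set ℂ := range fun j => x j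

/-- Rotation by a right angle, `(h₁, h₂) ↦ (-h₂, h₁)`. -/
def perp (h : ℂ) : ℂ := Complex.I * h

/-- The determinant of two vectors of the plane. -/
def planeDet (a b : ℂ) : ℝ := a.re * b.im - a.im * b.re

/-- `ν` is the outward unit normal at the boundary point `p` of `Ω`, near which `Ω` is the
sublevel set `{r < 0}` of a smooth function `r` whose gradient at `p` does not vanish. -/
def IsOuterNormal (Ω : Set ℂ) (p ν : ℂ) : Prop :=
  ∃ r : ℂ → ℝ, ContDiff ℝ ∞ r ∧ gradient r p ≠ 0 ∧ (∀ᶠ z in 𝓝 p, z ∈ Ω ↔ r z < 0) ∧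
    ν = ‖gradient r p‖⁻¹ • gradient r p

/-- A bounded planar domain with smooth boundary. -/
structure IsSmoothBoundedDomain (Ω : Set ℂ) : Prop where
  isOpen : IsOpen Ω
  isConnected : IsConnected Ω
  isBounded : Bornology.IsBounded Ω
  smooth_boundary : ∀ p ∈ frontier Ω, ∃ ν, IsOuterNormal Ω p ν

/-- A smooth map `∂Ω → 𝕊¹`, given as the restriction to `∂Ω` of a smooth function on the plane. -/
structure IsSmoothBoundaryDatum (Ω : Set ℂ) (g : ℂ → ℂ) : Prop where
  smooth : ContDiff ℝ ∞ g
  norm_eq_one : ∀ p ∈ frontier Ω, ‖g p‖ = 1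

/-- The density `|∇u|² = |∂₁u|² + |∂₂u|²` of the Dirichlet energy. -/
def dirichletDensity (u : ℂ → ℂ) (z : ℂ) : ℝ :=
  ‖fderiv ℝ u z 1‖ ^ 2 + ‖fderiv ℝ u z Complex.I‖ ^ 2

/-- The vector field `j u = det (u, ∇u) = (det (u, ∂₁u), det (u, ∂₂u))`. -/
def current (u : ℂ → ℂ) (z : ℂ) : ℂ :=
  ⟨planeDet (u z) (fderiv ℝ u z 1), planeDet (u z) (fderiv ℝ u z Complex.I)⟩

/-- `v` is a harmonic map of class `C²` from `Ω` to the unit circle: `-Δv = |∇v|² v`. -/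
structure IsHarmonicCircleMap (Ω : Set ℂ) (v : ℂ → ℂ) : Prop where
  contDiffOn : ContDiffOn ℝ 2 v Ω
  norm_eq_one : ∀ z ∈ Ω, ‖v z‖ = 1
  harmonic : ∀ z ∈ Ω, -Laplacian.laplacian v z = dirichletDensity v z • v z

/-- `u` is a singular harmonic map with singularities `x` of degrees `d`. -/
def IsSingularHarmonicMap (Ω : Set ℂ) {n : ℕ} (x : Config n) (d : Fin n → ℤ) (u : ℂ → ℂ) : Prop :=
  ∃ v : ℂ → ℂ, IsHarmonicCircleMap Ω v ∧
    ∀ z ∈ Ω \ singularPoints x,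
      u z = (∏ j, ((z - x j) / (‖z - x j‖ : ℂ)) ^ d j) * v z

/-- `u` attains the boundary values `g` on `∂Ω`, continuously. -/
def HasBoundaryValues (Ω : Set ℂ) {n : ℕ} (x : Config n) (g u : ℂ → ℂ) : Prop :=
  ContinuousOn u (closure Ω \ singularPoints x) ∧ EqOn u g (frontier Ω)

/-- The map `x ↦ u x` is continuous on `U` with values in `W^{1,p}(Ω)`. -/
def IsSobolevContinuousFamily (Ω : Set ℂ) (p : ENNReal) {n : ℕ} (U : Set (Config n))
    (u : Config n → ℂ → ℂ) : Prop :=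
  ∀ x ∈ U,
    Filter.Tendsto (fun y => eLpNorm (fun z => u y z - u x z) p (volume.restrict Ω))
      (𝓝[U] x) (𝓝 0) ∧
    Filter.Tendsto
      (fun y => eLpNorm (fun z => fderiv ℝ (u y) z - fderiv ℝ (u x) z) p (volume.restrict Ω))
      (𝓝[U] x) (𝓝 0)

/-- A continuous family, parametrised by `x ∈ U`, of singular harmonic maps `u x` with
singularities `x`, degrees `d` and boundary datum `g`. -/
structure IsSingularHarmonicFamily (Ω : Set ℂ) (g : ℂ → ℂ) {n : ℕ} (d : Fin n → ℤ)
    (p : ENNReal) (U : Set (Config n)) (u : Config n → ℂ → ℂ) : Prop where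
  singularHarmonic : ∀ x ∈ U, IsSingularHarmonicMap Ω x d (u x)
  boundaryValues : ∀ x ∈ U, HasBoundaryValues Ω x g (u x)
  continuous : IsSobolevContinuousFamily Ω p U u

/-- `Ω` without the discs of radius `ρ` around the singularities. -/
def perforated (Ω : Set ℂ) {n : ℕ} (x : Config n) (ρ : ℝ) : Set ℂ :=
  Ω \ ⋃ j, Metric.ball (x j) ρ

/-- `∫_{Ω \ ⋃ⱼ B_ρ(xⱼ)} |∇u|² - 2π ∑ⱼ dⱼ² ln (1/ρ)`. -/
def truncatedEnergy (Ω : Set ℂ) {n : ℕ} (d : Fin n → ℤ) (u : ℂ → ℂ) (x : Config n) (ρ : ℝ) : ℝ :=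
  (∫ z in perforated Ω x ρ, dirichletDensity u z) -
    2 * Real.pi * ∑ j, (d j : ℝ) ^ 2 * Real.log (1 / ρ)

/-- The renormalised energy `W(x)` of the family `u`. -/
def renormalisedEnergy (Ω : Set ℂ) {n : ℕ} (d : Fin n → ℤ) (u : Config n → ℂ → ℂ)
    (x : Config n) : ℝ :=
  Filter.limUnder (𝓝[>] (0 : ℝ)) (truncatedEnergy Ω d (u x) x)

/-- The quantity `∫₀¹ det (∇Φ(γ(t)), γ'(t)) dt + Θ(γ(1)) - Θ(γ(0))`. -/
def phaseIncrement (Ω : Set ℂ) (Φ Θ : ℂ → ℝ) (γ : ℝ → ℂ) : ℝ :=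
  (∫ t in (0 : ℝ)..1,
      planeDet (gradientWithin Φ (closure Ω) (γ t)) (derivWithin γ (Icc 0 1) t)) +
    Θ (γ 1) - Θ (γ 0)

/-- `(Φ, Θ)` solves the singular linear elliptic problem with singularities `x` of degrees `d` and
boundary datum `g`. The tangent vector at a boundary point with outward normal `ν` is `perp ν`. -/
structure SolvesSingularLinearProblem (Ω : Set ℂ) (g : ℂ → ℂ) {n : ℕ} (d : Fin n → ℤ)
    (x : Config n) (Φ Θ : ℂ → ℝ) : Prop where
  contDiffOn_Phi : ContDiffOn ℝ 2 Φ (Ω \ singularPoints x)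
  contDiffOn_Phi_closure : ContDiffOn ℝ 1 Φ (closure Ω \ singularPoints x)
  contDiffOn_Theta : ContDiffOn ℝ 2 Θ Ω
  continuousOn_Theta : ContinuousOn Θ (closure Ω)
  locallyIntegrable_Phi : LocallyIntegrableOn Φ Ω
  /-- `ΔΦ = ∑ⱼ 2π dⱼ δ_{xⱼ}` in the sense of distributions on `Ω`. -/
  laplacian_Phi : ∀ φ : ℂ → ℝ, ContDiff ℝ ∞ φ → HasCompactSupport φ → tsupport φ ⊆ Ω →
    ∫ z in Ω, Φ z * Laplacian.laplacian φ z = ∑ j, 2 * Real.pi * (d j : ℝ) * φ (x j)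
  laplacian_Theta : ∀ z ∈ Ω, Laplacian.laplacian Θ z = 0
  /-- `Θ` is constant on each connected component of `∂Ω`. -/
  const_Theta : ∀ p ∈ frontier Ω, ∀ q ∈ connectedComponentIn (frontier Ω) p, Θ q = Θ p
  normal_Phi : ∀ p ∈ frontier Ω, ∀ ν, IsOuterNormal Ω p ν →
    ((inner ℝ (gradientWithin Φ (closure Ω) p) ν : ℝ) : ℂ) =
      -Complex.I * (g p)⁻¹ * fderiv ℝ g p (perp ν)
  phase : ∀ γ : ℝ → ℂ, ContDiffOn ℝ 1 γ (Icc 0 1) →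
    MapsTo γ (Icc 0 1) (closure Ω \ singularPoints x) →
    γ 0 ∈ frontier Ω → γ 1 ∈ frontier Ω →
    g (γ 1) = Complex.exp (Complex.I * (phaseIncrement Ω Φ Θ γ : ℂ)) * g (γ 0)

/-- The pair `(Φ, Θ)` represents `u` off the singularities: `j u = ∇^⊥Φ + ∇Θ`. -/
def RepresentsCurrent (Ω : Set ℂ) {n : ℕ} (x : Config n) (Φ Θ : ℂ → ℝ) (u : ℂ → ℂ) : Prop :=
  ∀ z ∈ Ω \ singularPoints x, current u z = perp (gradient Φ z) + gradient Θ z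

/-- `H` is the regular part `H_j` of `Φ` at `x j`: the continuous function on `Ω` without the
other singularities that equals `Φ(z) - d_j ln |z - x_j|` off all the singularities. -/
structure IsRegularPart (Ω : Set ℂ) {n : ℕ} (d : Fin n → ℤ) (x : Config n) (Φ : ℂ → ℝ)
    (j : Fin n) (H : ℂ → ℝ) : Prop where
  continuousOn : ContinuousOn H (Ω \ {z | ∃ k, k ≠ j ∧ z = x k})
  eqOn : ∀ z ∈ Ω \ singularPoints x, H z = Φ z - (d j : ℝ) * Real.log ‖z - x j‖

end

/-! ### Currents of circle-valued maps; holomorphy of the conjugate current of a harmonic map -/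

section Currents

open Complex Metric Filter
open scoped ComplexConjugate

/-! The energy density of a circle-valued map is the squared norm of its current. The current `J_x`
of `u_x` is the sum of the fields `d_j ∇^⊥ log |z - x_j|` and of the current of `v_x`. Its conjugate
is meromorphic with simple poles at the `x_j` (`IsHarmonicCircleMap.differentiableOn_conj_current`),
and `J_x` is divergence free in the weak sense, even across the singularities. The derivative of `W`
is obtained by an inner variation with a quadratic remainder that compares the actual maps `u_x` and
`u_y`.

For `y` near `x`, let `F` be a diffeomorphism equal to the translation by `y_j - x_j` near each
`x_j` and to the identity away from the `x_j`. The maps `u_y ∘ F` and `u_x` have the same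
singularities and the same boundary values, and their quotient avoids the negative axis. Hence `u_y
∘ F = u_x e^{iφ}` with a single-valued phase `φ` vanishing on `∂Ω`
(`IsVortexFamily.eventually_exists_phase`). Put `P = ∂F`, `q = ∂̄F`, `b = J_y ∘ F`. The chain rule
gives `∇φ = conj P b + q conj b - J_x`. Testing `div J_x = 0` with `φ` and `div J_y = 0` with `φ ∘
F⁻¹` gives the identity `∫ |∇φ|² = 2 ∫ dφ(q conj b)` (`IsRelativePhase.integral_norm_fderiv_sq`).
Since `q` is `O(|y - x|)` and lives on annuli where `b` is bounded, `∫ |∇φ|² = O(|y - x|²)`.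

Expanding the squares, the logarithmic divergences cancel because `F` maps the disc of radius `ρ` at
`x_j` onto the one at `y_j`. What remains is `W(y) - W(x) = -2 Re ∫ q (conj J_x)² + O(|y - x|²)`
(`IsRelativePhase.abs_energy_sub_le`). As `(conj J_x)²` is meromorphic, this integral is a residue:
it returns `2 d_j` times the value at `x_j` of the regular part of the current, up to a constant
factor (`IsClearRadius.integral_deformationDelBar`). The relation `J_x = ∇^⊥Φ + ∇Θ` turns this
regular part into `∇H_j - ∇^⊥Θ` (`exists_isRegularPart`).

Two analytic points need care. First, nothing is known about the currents at `∂Ω` beyond continuity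
of the maps, so integration by parts is done by truncating functions that tend to zero at `∂Ω`
(`WeakDivFree.integral_eq_zero`), and finiteness of the energy near `∂Ω` comes from a Caccioppoli
estimate of the same kind (`WeakDivFree.integrableOn_norm_fderiv_sq`). Second, the family is only
continuous into `W^{1,p}`. In the interior the mean value property upgrades this to uniform
convergence; near `∂Ω` a maximum principle for a lifted phase on small rectangles shows that `u_y
conj u_x` has positive real part (`IsVortexFamily.exists_isCompact_re_pos`). -/

/-- The circle-valued map `a` is differentiable at `z` with differential `i a(z) ⟨c, ·⟩`. -/
def HasCurrent (a : ℂ → ℂ) (z c : ℂ) : Prop :=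
  ‖a z‖ = 1 ∧ HasFDerivAt a ((innerSL ℝ c).smulRight (I * a z)) z

theorem real_inner_eq_re_mul (a b : ℂ) : inner ℝ a b = a.re * b.re + a.im * b.im := by
  rw [Complex.inner]; simp; ring

theorem clm_ext_complex {E : Type*} [NormedAddCommGroup E] [NormedSpace ℝ E] {f g : ℂ →L[ℝ] E}
    (h1 : f 1 = g 1) (hI : f I = g I) : f = g := by
  ext w
  have hw : w = w.re • (1 : ℂ) + w.im • I := by simp [Complex.re_add_im]
  rw [hw, map_add, map_add, map_smul, map_smul, map_smul, map_smul, h1, hI]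

theorem mul_conj_of_norm_eq_one {a : ℂ} (h : ‖a‖ = 1) : a * conj a = 1 := by
  rw [Complex.mul_conj, Complex.normSq_eq_norm_sq, h]; simp

/-- Differentiating `|a|² = 1` shows that every directional derivative of `a` is orthogonal to `a`,
hence a real multiple of `i a`; the multiple is the determinant with `a`. -/
theorem HasCurrent.of_norm_eq_one {a : ℂ → ℂ} {z : ℂ} (hd : DifferentiableAt ℝ a z)
    (h : ∀ᶠ w in 𝓝 z, ‖a w‖ = 1) : HasCurrent a z (current a z) := by
  have h1 : ‖a z‖ = 1 := h.self_of_nhds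
  refine ⟨h1, ?_⟩
  have key : ∀ w, (a z).re * (fderiv ℝ a z w).re + (a z).im * (fderiv ℝ a z w).im = 0 := by
    intro w
    have h2 : HasFDerivAt (fun w => ‖a w‖ ^ 2) (2 • (innerSL ℝ (a z)).comp (fderiv ℝ a z)) z :=
      hd.hasFDerivAt.norm_sq
    have h3 : HasFDerivAt (fun w => ‖a w‖ ^ 2) (0 : ℂ →L[ℝ] ℝ) z := by
      refine (hasFDerivAt_const (1 : ℝ) z).congr_of_eventuallyEq ?_
      filter_upwards [h] with w hw
      simp [hw]
    have h4 := congrArg (fun L : ℂ →L[ℝ] ℝ => L w) (h2.unique h3)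
    simp at h4
    linarith
  have h2 : (a z).re * (a z).re + (a z).im * (a z).im = 1 := by
    have := congrArg Complex.re (mul_conj_of_norm_eq_one h1)
    simpa using this
  convert hd.hasFDerivAt using 1
  apply clm_ext_complex
  · have k := key 1
    simp only [ContinuousLinearMap.smulRight_apply, innerSL_apply_apply, real_inner_eq_re_mul, current,
      planeDet, real_smul]
    apply Complex.ext <;> simp
    · linear_combination -(a z).re * k + (fderiv ℝ a z 1).re * h2
    · linear_combination -(a z).im * k + (fderiv ℝ a z 1).im * h2
  · have k := key I
    simp only [ContinuousLinearMap.smulRight_apply, innerSL_apply_apply, real_inner_eq_re_mul, current,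
      planeDet, real_smul]
    apply Complex.ext <;> simp
    · linear_combination -(a z).re * k + (fderiv ℝ a z I).re * h2
    · linear_combination -(a z).im * k + (fderiv ℝ a z I).im * h2

namespace HasCurrent

variable {a b : ℂ → ℂ} {z c c' : ℂ}

theorem differentiableAt (h : HasCurrent a z c) : DifferentiableAt ℝ a z := h.2.differentiableAt

theorem fderiv_apply (h : HasCurrent a z c) (w : ℂ) :
    fderiv ℝ a z w = (inner ℝ c w : ℝ) * (I * a z) := by
  rw [h.2.fderiv]; simp

theorem current_eq (h : HasCurrent a z c) : current a z = c := by
  have h2 : (a z).re * (a z).re + (a z).im * (a z).im = 1 := by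
    have := congrArg Complex.re (mul_conj_of_norm_eq_one h.1)
    simpa using this
  apply Complex.ext <;> simp [current, planeDet, h.fderiv_apply]
  · linear_combination c.re * h2
  · linear_combination c.im * h2

theorem dirichletDensity_eq (h : HasCurrent a z c) : dirichletDensity a z = ‖c‖ ^ 2 := by
  simp [dirichletDensity, h.fderiv_apply, h.1]
  rw [← Complex.normSq_eq_norm_sq, Complex.normSq_apply]; ring

theorem norm_fderiv (h : HasCurrent a z c) : ‖fderiv ℝ a z‖ = ‖c‖ := by
  rw [h.2.fderiv, ContinuousLinearMap.norm_smulRight_apply]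
  simp [h.1]

theorem congr_of_eventuallyEq (h : HasCurrent a z c) (hb : b =ᶠ[𝓝 z] a) : HasCurrent b z c := by
  refine ⟨by rw [hb.self_of_nhds]; exact h.1, ?_⟩
  rw [hb.self_of_nhds]
  exact h.2.congr_of_eventuallyEq hb

theorem const {w : ℂ} (hw : ‖w‖ = 1) : HasCurrent (fun _ => w) z 0 :=
  ⟨hw, by simpa using hasFDerivAt_const w z⟩

theorem mul (ha : HasCurrent a z c) (hb : HasCurrent b z c') :
    HasCurrent (fun w => a w * b w) z (c + c') := by
  refine ⟨by simp [ha.1, hb.1], ?_⟩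
  refine (ha.2.mul hb.2).congr_fderiv ?_
  apply clm_ext_complex <;> simp <;> ring

theorem star (ha : HasCurrent a z c) : HasCurrent (fun w => conj (a w)) z (-c) := by
  refine ⟨by simp [ha.1], ?_⟩
  refine ((Complex.conjCLE.hasFDerivAt (x := a z)).comp z ha.2).congr_fderiv ?_
  apply clm_ext_complex <;> simp

theorem prod {ι : Type*} (s : Finset ι) {a : ι → ℂ → ℂ} {c : ι → ℂ}
    (h : ∀ i ∈ s, HasCurrent (a i) z (c i)) :
    HasCurrent (fun w => ∏ i ∈ s, a i w) z (∑ i ∈ s, c i) := by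
  classical
  induction s using Finset.induction_on with
  | empty => simpa using const (z := z) (w := 1) (by simp)
  | insert i s hi ih =>
    simp only [Finset.prod_insert hi, Finset.sum_insert hi]
    exact (h i (by simp)).mul (ih fun k hk => h k (by simp [hk]))

theorem pow (ha : HasCurrent a z c) (n : ℕ) : HasCurrent (fun w => a w ^ n) z (n * c) := by
  have := prod (z := z) (Finset.range n) (a := fun _ => a) (c := fun _ => c) fun _ _ => ha
  simpa using this

/-- A negative power is a positive power of the conjugate. This identity is differentiated, so it is
needed on a neighbourhood of `z`, which is the purpose of `h1`. -/
theorem zpow (ha : HasCurrent a z c) (h1 : ∀ᶠ w in 𝓝 z, ‖a w‖ = 1) (n : ℤ) :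
    HasCurrent (fun w => a w ^ n) z (n * c) := by
  cases n with
  | ofNat n => simpa using ha.pow n
  | negSucc n =>
    have h2 := (ha.pow (n + 1)).star
    have : HasCurrent (fun w => a w ^ (Int.negSucc n)) z (-((n + 1 : ℕ) * c)) := by
      refine h2.congr_of_eventuallyEq ?_
      filter_upwards [h1] with w hw
      rw [zpow_negSucc, inv_eq_of_mul_eq_one_right]
      exact mul_conj_of_norm_eq_one (by simp [hw])
    convert this using 1
    push_cast [Int.negSucc_eq]; ring

/-- From `da = i a ⟨c, ·⟩` one gets `d log a = i ⟨c, ·⟩`: the current is the gradient of every local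
phase. -/
theorem hasGradientAt_arg (ha : HasCurrent a z c) (hs : a z ∈ slitPlane) :
    HasGradientAt (fun w => (a w).arg) c z := by
  rw [hasGradientAt_iff_hasFDerivAt]
  have h0 : a z ≠ 0 := by intro h; have := ha.1; simp [h] at this
  have h1 := (Complex.hasStrictFDerivAt_log_real hs).hasFDerivAt.comp z ha.2
  have h2 := (imCLM.hasFDerivAt (x := Complex.log (a z))).comp z h1
  refine (h2.congr_of_eventuallyEq (Eventually.of_forall fun w => ?_)).congr_fderiv ?_
  · simp [Complex.log_im]
  · have h3 : ∀ r : ℂ, (a z)⁻¹ * (r * (I * a z)) = r * I := by intro r; field_simp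
    apply clm_ext_complex <;> simp [h3]

/-- For the real inner product the adjoint of `w ↦ p w + q conj w` is `c ↦ conj p c + q conj c`.
Here `p` and `q` play the role of `∂F` and `∂̄F`. -/
theorem comp {F : ℂ → ℂ} {A : ℂ →L[ℝ] ℂ} {p q : ℂ} (ha : HasCurrent a (F z) c)
    (hF : HasFDerivAt F A z) (hA : ∀ w, A w = p * w + q * starRingEnd ℂ w) :
    HasCurrent (fun w => a (F w)) z (starRingEnd ℂ p * c + q * starRingEnd ℂ c) := by
  refine ⟨ha.1, (ha.2.comp z hF).congr_fderiv ?_⟩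
  apply clm_ext_complex <;> simp [hA] <;> ring_nf <;> simp

end HasCurrent

/-- The angular vector field `∇ arg (z - a)`, that is `∇^⊥ log |z - a|`. -/
noncomputable def angularField (a z : ℂ) : ℂ := I * (z - a) / (‖z - a‖ ^ 2 : ℝ)

/-- A simple pole: passing to conjugates turns divergence-free and curl-free fields into holomorphic
functions, and the angular field into the basic meromorphic one. -/
theorem conj_angularField (a z : ℂ) : conj (angularField a z) = -I / (z - a) := by
  by_cases h : z = a
  · simp [angularField, h]
  have h1 : z - a ≠ 0 := sub_ne_zero.2 h
  rw [angularField, ← Complex.normSq_eq_norm_sq, ← Complex.mul_conj]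
  have h2 : conj (z - a) ≠ 0 := (map_ne_zero _).2 h1
  rw [map_div₀, map_mul, map_mul, conj_conj, conj_I]
  field_simp

theorem norm_angularField (a z : ℂ) : ‖angularField a z‖ = ‖z - a‖⁻¹ := by
  rw [← norm_conj, conj_angularField]; simp [div_eq_mul_inv]

theorem angularField_eq_conj (a z : ℂ) : angularField a z = conj (-I / (z - a)) := by
  rw [← conj_angularField, conj_conj]

theorem contDiffAt_angularField {a z : ℂ} (h : z ≠ a) : ContDiffAt ℝ ∞ (angularField a) z := by
  have h1 : ContDiffAt ℂ ∞ (fun z => -I / (z - a)) z := by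
    refine ContDiffAt.div contDiffAt_const (by fun_prop) (sub_ne_zero.2 h)
  have h2 := (conjCLE.contDiff (n := ∞)).contDiffAt.comp z (h1.restrict_scalars ℝ)
  exact h2.congr_of_eventuallyEq (Eventually.of_forall fun w => by
    simp [angularField_eq_conj])

theorem contDiffAt_unit {z : ℂ} (h : z ≠ 0) {n : WithTop ℕ∞} :
    ContDiffAt ℝ n (fun z : ℂ => z / (‖z‖ : ℂ)) z := by
  have h1 : ContDiffAt ℝ n (fun z : ℂ => ((‖z‖ : ℝ) : ℂ)) z :=
    ofRealCLM.contDiff.contDiffAt.comp z (contDiffAt_norm ℝ h)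
  simp only [div_eq_mul_inv]
  exact contDiffAt_id.mul (h1.inv (by simpa using h))

theorem norm_unit {z : ℂ} (h : z ≠ 0) : ‖z / (‖z‖ : ℂ)‖ = 1 := by
  rw [norm_div]; simp [h]

theorem hasCurrent_unit {a z : ℂ} (h : z ≠ a) :
    HasCurrent (fun w => (w - a) / (‖w - a‖ : ℂ)) z (angularField a z) := by
  have hza : z - a ≠ 0 := sub_ne_zero.2 h
  have hne : ‖z - a‖ ≠ 0 := by simpa using hza
  refine ⟨norm_unit hza, ?_⟩
  have h0 : HasFDerivAt (fun w : ℂ => w - a) (ContinuousLinearMap.id ℝ ℂ) z :=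
    (hasFDerivAt_id z).sub_const a
  have h1 : HasFDerivAt (fun w => ‖w - a‖ ^ 2) (2 • (innerSL ℝ (z - a)).comp
    (ContinuousLinearMap.id ℝ ℂ)) z := h0.norm_sq
  have h3 := h1.sqrt (by positivity)
  simp only [Real.sqrt_sq (norm_nonneg _)] at h3
  have h4 := (hasDerivAt_inv hne).comp_hasFDerivAt z h3
  have h5 := h4.smul h0
  have hsq : ‖z - a‖ ^ 2 = (z - a).re * (z - a).re + (z - a).im * (z - a).im := by
    rw [← Complex.normSq_eq_norm_sq, Complex.normSq_apply]
  refine (h5.congr_of_eventuallyEq (Eventually.of_forall fun w => ?_)).congr_fderiv ?_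
  · simp [div_eq_mul_inv, mul_comm]
  · obtain ⟨u, hu⟩ : ∃ u, u = z - a := ⟨_, rfl⟩
    obtain ⟨r, hr⟩ : ∃ r, r = ‖u‖ := ⟨_, rfl⟩
    rw [← hu, ← hr] at hsq hne
    have hr0 : (r : ℂ) ≠ 0 := by simpa using hne
    have e1 : (r : ℂ) ^ 2 = u.re * u.re + u.im * u.im := by exact_mod_cast hsq
    have e2 : (I * u / (r ^ 2 : ℝ)).re = -u.im / r ^ 2 := by rw [div_ofReal_re]; simp
    have e3 : (I * u / (r ^ 2 : ℝ)).im = u.re / r ^ 2 := by rw [div_ofReal_im]; simp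
    have e4 : u = u.re + u.im * I := (Complex.re_add_im u).symm
    apply clm_ext_complex
    · simp only [add_apply, smul_apply, ContinuousLinearMap.smulRight_apply,
        ContinuousLinearMap.id_apply, ContinuousLinearMap.comp_apply, innerSL_apply_apply,
        Function.comp_apply, ← hu, ← hr, real_inner_eq_re_mul, angularField, e2, e3, one_re, one_im]
      simp
      field_simp
      generalize u.re = p at *
      generalize u.im = q at *
      subst e4
      linear_combination e1 + q ^ 2 * I_sq
    · simp only [add_apply, smul_apply, ContinuousLinearMap.smulRight_apply,
        ContinuousLinearMap.id_apply, ContinuousLinearMap.comp_apply, innerSL_apply_apply,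
        Function.comp_apply, ← hu, ← hr, real_inner_eq_re_mul, angularField, e2, e3, I_re, I_im]
      simp
      field_simp
      generalize u.re = p at *
      generalize u.im = q at *
      subst e4
      linear_combination I * e1 - q * p * I_sq

theorem IsHarmonicCircleMap.hasCurrent {Ω : Set ℂ} {v : ℂ → ℂ} (hv : IsHarmonicCircleMap Ω v)
    (hΩ : IsOpen Ω) {z : ℂ} (hz : z ∈ Ω) : HasCurrent v z (current v z) :=
  .of_norm_eq_one ((hv.contDiffOn.contDiffAt (hΩ.mem_nhds hz)).differentiableAt (by simp))
    (by filter_upwards [hΩ.mem_nhds hz] with w hw using hv.norm_eq_one w hw)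

/-- The conjugate current is `-2i conj v ∂_z v`. In its `∂̄`-derivative the term with `Δv = -|∇v|²
v` cancels the term from the derivative of `conj v`. Equivalently, symmetry of second derivatives
makes the current curl free and the harmonic map equation makes it divergence free. -/
theorem IsHarmonicCircleMap.differentiableOn_conj_current {Ω : Set ℂ} {v : ℂ → ℂ}
    (hv : IsHarmonicCircleMap Ω v) (hΩ : IsOpen Ω) :
    DifferentiableOn ℂ (fun z => conj (current v z)) Ω := by
  intro z hz
  apply DifferentiableAt.differentiableWithinAt
  have hc := hv.contDiffOn.contDiffAt (hΩ.mem_nhds hz)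
  have hev : (fun z => conj (current v z)) =ᶠ[𝓝 z]
      fun z => -I * (conj (v z) * (fderiv ℝ v z 1 - I * fderiv ℝ v z I)) := by
    filter_upwards [hΩ.mem_nhds hz] with w hw
    have h := hv.hasCurrent hΩ hw
    have h1 := mul_conj_of_norm_eq_one h.1
    rw [h.fderiv_apply, h.fderiv_apply, real_inner_eq_re_mul, real_inner_eq_re_mul]
    have e : (starRingEnd ℂ) (current v w) = (current v w).re - (current v w).im * I := by
      apply Complex.ext <;> simp
    simp
    rw [e]
    linear_combination (-(current v w).re + (current v w).im * I) * h1 + (v w * conj (v w)) * ((current v w).re - (current v w).im * I) * I_sq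
  refine DifferentiableAt.congr_of_eventuallyEq ?_ hev
  have h1 := hc.differentiableAt (by simp)
  have h2 : DifferentiableAt ℝ (fderiv ℝ v) z :=
    (hc.fderiv_right (m := 1) (by norm_num)).differentiableAt (by simp)
  have hs : IsSymmSndFDerivAt ℝ v z := hc.isSymmSndFDerivAt (by simp)
  have hd : ∀ w, HasFDerivAt (fun z => fderiv ℝ v z w) ((fderiv ℝ (fderiv ℝ v) z).flip w) z := by
    intro w
    have := h2.hasFDerivAt.clm_apply (hasFDerivAt_const w z)
    simpa using this
  have hconj := (conjCLE.hasFDerivAt (x := v z)).comp z h1.hasFDerivAt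
  have hall := ((hconj.mul ((hd 1).sub ((hd I).const_mul I))).const_mul (-I))
  -- It remains to check the Cauchy–Riemann equation for the explicit real derivative `hall`.
  refine differentiableAt_complex_iff_differentiableAt_real.2 ⟨hall.differentiableAt, ?_⟩
  have hl := hv.harmonic z hz
  rw [InnerProductSpace.laplacian_eq_iteratedFDeriv_complexPlane] at hl
  simp only [iteratedFDeriv_two_apply, Matrix.cons_val_zero, Matrix.cons_val_one] at hl
  have h := hv.hasCurrent hΩ hz
  have e := h.dirichletDensity_eq
  have hsym := hs 1 I
  have hall' : HasFDerivAt
      (fun z => -I * (conj (v z) * (fderiv ℝ v z 1 - I * fderiv ℝ v z I))) _ z := hall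
  rw [hall'.fderiv]
  have hl' : fderiv ℝ (fderiv ℝ v) z 1 1 = - fderiv ℝ (fderiv ℝ v) z I I -
      ((current v z).re ^ 2 + (current v z).im ^ 2) * v z := by
    rw [e, ← Complex.normSq_eq_norm_sq, Complex.normSq_apply, real_smul] at hl
    push_cast at hl
    linear_combination -hl
  simp [h.fderiv_apply]
  rw [hsym, hl']
  generalize current v z = c at *
  linear_combination (-I * conj (v z) * fderiv ℝ (fderiv ℝ v) z I 1 -
    I ^ 2 * ((c.re : ℂ) ^ 2 + c.im ^ 2) * v z * conj (v z) +
    I ^ 3 * (c.re * c.im * v z * conj (v z))) * I_sq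

end Currents

/-! ### Weakly divergence-free fields, including the singular angular fields -/

section WeakDivergence

open Complex Metric Filter
open scoped ComplexConjugate

/-- The vector field `V` is divergence free in `Ω`, in the weak sense. -/
def WeakDivFree (Ω : Set ℂ) (V : ℂ → ℂ) : Prop :=
  ∀ w : ℂ → ℝ, ContDiff ℝ 1 w → HasCompactSupport w → tsupport w ⊆ Ω →
    ∫ z, fderiv ℝ w z (V z) = 0

theorem clm_apply_eq_re_im {E : Type*} [NormedAddCommGroup E] [NormedSpace ℝ E] (L : ℂ →L[ℝ] E)
    (w : ℂ) : L w = w.re • L 1 + w.im • L I := by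
  conv_lhs => rw [show w = w.re • (1 : ℂ) + w.im • I by simp [Complex.re_add_im]]
  rw [map_add, map_smul, map_smul]

theorem integrable_mul_of_tsupport_subset {Ω : Set ℂ} {f w : ℂ → ℝ} (hΩ : IsOpen Ω)
    (hf : ContinuousOn f Ω) (hw : Continuous w) (hc : HasCompactSupport w) (hs : tsupport w ⊆ Ω) :
    Integrable (fun z => f z * w z) := by
  have h1 : Continuous (fun z => f z * w z) := by
    refine (hf.mul hw.continuousOn).continuous_of_tsupport_subset hΩ ?_
    exact (tsupport_mul_subset_right (f := f) (g := w)).trans hs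
  exact h1.integrable_of_hasCompactSupport hc.mul_left

theorem fderiv_apply_tsupport_subset {w : ℂ → ℝ} (v : ℂ) :
    tsupport (fun z => fderiv ℝ w z v) ⊆ tsupport w := by
  refine (closure_mono ?_).trans (tsupport_fderiv_subset ℝ (f := w))
  intro z hz
  simp only [Function.mem_support] at hz ⊢
  intro h; rw [h] at hz; simp at hz

theorem weakDivFree_of_div_eq_zero {Ω : Set ℂ} (hΩ : IsOpen Ω) {V : ℂ → ℂ}
    (hV : ContDiffOn ℝ 1 V Ω)
    (hdiv : ∀ z ∈ Ω, (fderiv ℝ V z 1).re + (fderiv ℝ V z I).im = 0) : WeakDivFree Ω V := by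
  intro w hw hc hs
  have hVd : ∀ z ∈ Ω, DifferentiableAt ℝ V z := fun z hz =>
    (hV.contDiffAt (hΩ.mem_nhds hz)).differentiableAt (by simp)
  have hVf : ContinuousOn (fderiv ℝ V) Ω := hV.continuousOn_fderiv_of_isOpen hΩ (by simp)
  have hVc : ContinuousOn V Ω := hV.continuousOn
  have hw' : ∀ v, Continuous fun z => fderiv ℝ w z v := fun v =>
    (hw.continuous_fderiv (by simp)).clm_apply continuous_const
  have hwc : ∀ v, HasCompactSupport fun z => fderiv ℝ w z v := fun v =>
    hc.of_isClosed_subset (isClosed_tsupport _) (fderiv_apply_tsupport_subset v)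
  have hre : ∀ z ∈ Ω, HasFDerivAt (fun z => (V z).re) (reCLM.comp (fderiv ℝ V z)) z := fun z hz =>
    (reCLM.hasFDerivAt).comp z (hVd z hz).hasFDerivAt
  have him : ∀ z ∈ Ω, HasFDerivAt (fun z => (V z).im) (imCLM.comp (fderiv ℝ V z)) z := fun z hz =>
    (imCLM.hasFDerivAt).comp z (hVd z hz).hasFDerivAt
  have i1 : Integrable fun z => (V z).re * fderiv ℝ w z 1 :=
    integrable_mul_of_tsupport_subset hΩ (continuous_re.comp_continuousOn hVc) (hw' 1) (hwc 1)
      ((fderiv_apply_tsupport_subset 1).trans hs)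
  have i2 : Integrable fun z => (V z).im * fderiv ℝ w z I :=
    integrable_mul_of_tsupport_subset hΩ (continuous_im.comp_continuousOn hVc) (hw' I) (hwc I)
      ((fderiv_apply_tsupport_subset I).trans hs)
  have cre : ContinuousOn (fun z => fderiv ℝ (fun z => (V z).re) z 1) Ω := by
    refine ContinuousOn.congr (f := fun z => (fderiv ℝ V z 1).re) ?_ fun z hz => by
      rw [(hre z hz).fderiv]; simp
    exact continuous_re.comp_continuousOn (hVf.clm_apply continuousOn_const)
  have cim : ContinuousOn (fun z => fderiv ℝ (fun z => (V z).im) z I) Ω := by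
    refine ContinuousOn.congr (f := fun z => (fderiv ℝ V z I).im) ?_ fun z hz => by
      rw [(him z hz).fderiv]; simp
    exact continuous_im.comp_continuousOn (hVf.clm_apply continuousOn_const)
  have j1 := integrable_mul_of_tsupport_subset hΩ cre hw.continuous hc hs
  have j2 := integrable_mul_of_tsupport_subset hΩ cim hw.continuous hc hs
  have k1 := integral_mul_fderiv_eq_neg_fderiv_mul_of_integrable (μ := volume) (v := (1 : ℂ))
    j1 i1 (integrable_mul_of_tsupport_subset hΩ (continuous_re.comp_continuousOn hVc)
      hw.continuous hc hs) (fun z hz => (hre z (hs hz)).differentiableAt)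
    (fun z _ => (hw.differentiable (by simp)) z)
  have k2 := integral_mul_fderiv_eq_neg_fderiv_mul_of_integrable (μ := volume) (v := I)
    j2 i2 (integrable_mul_of_tsupport_subset hΩ (continuous_im.comp_continuousOn hVc)
      hw.continuous hc hs) (fun z hz => (him z (hs hz)).differentiableAt)
    (fun z _ => (hw.differentiable (by simp)) z)
  have e : ∀ z, fderiv ℝ w z (V z) = (V z).re * fderiv ℝ w z 1 + (V z).im * fderiv ℝ w z I :=
    fun z => clm_apply_eq_re_im _ _
  simp_rw [e]
  rw [integral_add i1 i2, k1, k2, ← neg_add, ← integral_add j1 j2, neg_eq_zero]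
  refine integral_eq_zero_of_ae (Eventually.of_forall fun z => ?_)
  by_cases hz : z ∈ Ω
  · simp only [Pi.zero_apply]
    rw [(hre z hz).fderiv, (him z hz).fderiv, ← add_mul]
    have := hdiv z hz
    simp only [ContinuousLinearMap.comp_apply, reCLM_apply, imCLM_apply]
    rw [this, zero_mul]
  · have : w z = 0 := image_eq_zero_of_notMem_tsupport fun h => hz (hs h)
    simp [this]

theorem contDiffOn_of_differentiableOn_conj {Ω : Set ℂ} (hΩ : IsOpen Ω) {V : ℂ → ℂ}
    (hV : DifferentiableOn ℂ (fun z => conj (V z)) Ω) {n : WithTop ℕ∞} : ContDiffOn ℝ n V Ω := by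
  have h1 : ContDiffOn ℝ n (fun z => conj (V z)) Ω := (hV.contDiffOn hΩ).restrict_scalars ℝ
  have h2 := (conjCLE.contDiff (n := n)).comp_contDiffOn h1
  exact h2.congr fun z _ => by simp

/-- The imaginary part of the Cauchy–Riemann equation for `conj V` is `div V = 0`. -/
theorem weakDivFree_of_differentiableOn_conj {Ω : Set ℂ} (hΩ : IsOpen Ω) {V : ℂ → ℂ}
    (hV : DifferentiableOn ℂ (fun z => conj (V z)) Ω) : WeakDivFree Ω V := by
  have hV1 := contDiffOn_of_differentiableOn_conj hΩ hV (n := 1)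
  refine weakDivFree_of_div_eq_zero hΩ hV1 fun z hz => ?_
  have h1 := (hV1.contDiffAt (hΩ.mem_nhds hz)).differentiableAt (by simp)
  have h2 := (differentiableAt_complex_iff_differentiableAt_real.1
    (hV.differentiableAt (hΩ.mem_nhds hz))).2
  have h3 : HasFDerivAt (fun z => conj (V z)) _ z := (conjCLE.hasFDerivAt).comp z h1.hasFDerivAt
  rw [h3.fderiv] at h2
  have h4 := congrArg Complex.im h2
  simp at h4
  linarith

/-- In polar coordinates the Jacobian `r` cancels the singularity `1 / r`. -/
theorem integrableOn_inv_norm_sub (a : ℂ) {s : Set ℂ} (hs : Bornology.IsBounded s) :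
    IntegrableOn (fun z => ‖z - a‖⁻¹) s := by
  obtain ⟨R, hR⟩ := hs.subset_ball a
  refine IntegrableOn.mono_set ?_ hR
  have h1 : IntegrableOn (fun z : ℂ => ‖z‖⁻¹) (ball 0 R) := by
    rw [integrableOn_fun_norm_addHaar volume (f := fun r => r⁻¹)]
    refine IntegrableOn.congr_fun (f := fun _ => (1 : ℝ)) (integrableOn_const (by simp))
      (fun r hr => ?_) measurableSet_Ioo
    have : r ≠ 0 := hr.1.ne'
    simp [this]
  have h2 : MeasurePreserving (fun z : ℂ => z - a) := measurePreserving_sub_right volume a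
  have h3 : ball a R = (fun z => z - a) ⁻¹' ball 0 R := by ext z; simp [dist_eq_norm]
  rw [h3]
  exact (h2.integrableOn_comp_preimage (MeasurableEquiv.subRight a).measurableEmbedding).2 h1

theorem integrable_fderiv_angularField {w : ℂ → ℝ} (hw : ContDiff ℝ 1 w)
    (hc : HasCompactSupport w) (a : ℂ) : Integrable fun z => ‖fderiv ℝ w z‖ * ‖z - a‖⁻¹ := by
  have hcf : HasCompactSupport (fderiv ℝ w) := hc.fderiv ℝ
  have hcont : Continuous (fderiv ℝ w) := hw.continuous_fderiv (by simp)
  obtain ⟨C, hC⟩ := hcf.exists_bound_of_continuous hcont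
  have h1 := (integrableOn_inv_norm_sub a hcf.isCompact.isBounded).const_mul C
  have h2 : IntegrableOn (fun z => ‖fderiv ℝ w z‖ * ‖z - a‖⁻¹) (tsupport (fderiv ℝ w)) := by
    refine h1.mono' ?_ (Eventually.of_forall fun z => ?_)
    · exact (Measurable.aestronglyMeasurable (by fun_prop))
    · simp only [norm_mul, norm_norm, norm_inv]
      exact mul_le_mul_of_nonneg_right (hC z) (by positivity)
  refine (integrableOn_iff_integrable_of_support_subset fun z hz => ?_).1 h2
  refine subset_tsupport _ ?_
  simp only [Function.mem_support] at hz ⊢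
  intro h; rw [h] at hz; simp at hz

/-- The field is a limit of smooth fields tangent to the circles around `a` with radial coefficient,
which are divergence free on the whole plane. The limit passes under the integral because `‖dw‖ / |z
- a|` is integrable; in particular no Dirac mass appears at `a`. -/
theorem weakDivFree_angularField (Ω : Set ℂ) (a : ℂ) : WeakDivFree Ω (angularField a) := by
  intro w hw hc _
  -- Regularisation of the angular field at scale `s`, dominated by `1 / |z - a|` uniformly in `s`.
  let V : ℝ → ℂ → ℂ := fun s z => ((‖z - a‖ ^ 2 + s ^ 2)⁻¹ : ℝ) • (I * (z - a))
  have hV : ∀ s, s ≠ 0 → ∀ z, HasFDerivAt (V s) ((‖z - a‖ ^ 2 + s ^ 2)⁻¹ •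
      (I • ContinuousLinearMap.id ℝ ℂ) +
      ((-((‖z - a‖ ^ 2 + s ^ 2) ^ 2)⁻¹) • (2 • (innerSL ℝ (z - a)))).smulRight (I * (z - a))) z := by
    intro s hs z
    have hne : ‖z - a‖ ^ 2 + s ^ 2 ≠ 0 := by positivity
    have h0 : HasFDerivAt (fun w : ℂ => w - a) (ContinuousLinearMap.id ℝ ℂ) z :=
      (hasFDerivAt_id z).sub_const a
    have h1 : HasFDerivAt (fun w => ‖w - a‖ ^ 2 + s ^ 2) (2 • (innerSL ℝ (z - a)).comp
      (ContinuousLinearMap.id ℝ ℂ)) z := h0.norm_sq.add_const _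
    have h4 := (hasDerivAt_inv hne).comp_hasFDerivAt z h1
    exact h4.smul (h0.const_mul I)
  have hzero : ∀ s, s ≠ 0 → ∫ z, fderiv ℝ w z (V s z) = 0 := by
    intro s hs
    refine weakDivFree_of_div_eq_zero isOpen_univ (V := V s) ?_ (fun z _ => ?_) w hw hc
      (subset_univ _)
    · have h1 : ContDiff ℝ 1 fun z : ℂ => ‖z - a‖ ^ 2 + s ^ 2 :=
        ((contDiff_id.sub contDiff_const).norm_sq ℝ).add contDiff_const
      exact ((h1.inv fun z => by positivity).smul
        (contDiff_const.mul (contDiff_id.sub contDiff_const))).contDiffOn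
    · rw [(hV s hs z).fderiv]
      generalize (‖z - a‖ ^ 2 + s ^ 2)⁻¹ = c₁
      generalize -((‖z - a‖ ^ 2 + s ^ 2) ^ 2)⁻¹ = c₂
      simp
      ring
  have hlim : Tendsto (fun s => ∫ z, fderiv ℝ w z (V s z)) (𝓝[≠] (0 : ℝ))
      (𝓝 (∫ z, fderiv ℝ w z (angularField a z))) := by
    refine tendsto_integral_filter_of_dominated_convergence
      (fun z => ‖fderiv ℝ w z‖ * ‖z - a‖⁻¹) ?_ ?_ (integrable_fderiv_angularField hw hc a) ?_
    · filter_upwards [self_mem_nhdsWithin] with s hs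
      refine Continuous.aestronglyMeasurable ?_
      refine (hw.continuous_fderiv (by simp)).clm_apply ?_
      exact continuous_iff_continuousAt.2 fun z => (hV s hs z).continuousAt
    · filter_upwards [self_mem_nhdsWithin] with s hs
      refine Eventually.of_forall fun z => ?_
      refine ((fderiv ℝ w z).le_opNorm _).trans (mul_le_mul_of_nonneg_left ?_ (norm_nonneg _))
      by_cases hz : z = a
      · simp [V, hz]
      have hpos : 0 < ‖z - a‖ := norm_pos_iff.2 (sub_ne_zero.2 hz)
      simp only [V, norm_smul, norm_inv, Real.norm_eq_abs, norm_mul, norm_I, one_mul]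
      rw [abs_of_nonneg (by positivity), inv_mul_le_iff₀ (by positivity)]
      field_simp
      nlinarith [sq_nonneg s]
    · refine Eventually.of_forall fun z => ?_
      refine ((fderiv ℝ w z).continuous.tendsto _).comp ?_
      by_cases hz : z = a
      · simp [V, hz, angularField]
      have hne : ‖z - a‖ ^ 2 + (0 : ℝ) ^ 2 ≠ 0 := by
        have hpos : 0 < ‖z - a‖ := norm_pos_iff.2 (sub_ne_zero.2 hz)
        positivity
      have h1 : ContinuousAt (fun s : ℝ => V s z) 0 := by
        have h0 : ContinuousAt (fun s : ℝ => ‖z - a‖ ^ 2 + s ^ 2) 0 := by fun_prop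
        exact (h0.inv₀ hne).smul continuousAt_const
      have h2 : V 0 z = angularField a z := by
        simp [V, angularField]; ring
      have h3 := h1.tendsto
      rw [h2] at h3
      exact h3.mono_left nhdsWithin_le_nhds
  refine tendsto_nhds_unique hlim (tendsto_const_nhds.congr' ?_)
  filter_upwards [self_mem_nhdsWithin] with s hs using (hzero s hs).symm

end WeakDivergence

/-! ### Integration by parts for functions that merely tend to zero at the boundary -/

section Truncation

open Complex Metric Filter
open scoped ComplexConjugate

/-- On a line parallel to `v`, a zero of `w` at which the derivative along `v` does not vanish is
isolated among such zeros. So the exceptional set meets each of these lines in a countable set and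
is null by Fubini. -/
theorem ae_fderiv_apply_eq_zero {Ω : Set ℂ} (hΩ : IsOpen Ω) {w : ℂ → ℝ}
    (hw : ContDiffOn ℝ 1 w Ω) (v : ℂ) :
    ∀ᵐ z, z ∈ Ω → w z = 0 → fderiv ℝ w z v = 0 := by
  let s : Set ℂ := {z | z ∈ Ω ∧ w z = 0 ∧ fderiv ℝ w z v ≠ 0}
  have hs : MeasurableSet s := by
    have h1 : MeasurableSet (Ω \ (Ω ∩ w ⁻¹' {0}ᶜ)) :=
      hΩ.measurableSet.diff (hw.continuousOn.isOpen_inter_preimage hΩ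
        isClosed_singleton.isOpen_compl).measurableSet
    have h2 : MeasurableSet {z | fderiv ℝ w z v ≠ 0} :=
      (measurable_fderiv_apply_const ℝ w v) (measurableSet_singleton 0).compl
    convert h1.inter h2 using 1
    ext z; simp only [s, mem_ofPred_eq, mem_inter_iff, Set.mem_sdiff, mem_preimage, mem_compl_iff,
      mem_singleton_iff]; tauto
  have key : ∀ᵐ z, z ∈ sᶜ := by
    refine ae_mem_of_ae_add_linearMap_mem (LinearMap.toSpanSingleton ℝ ℂ v) volume volume hs.compl
      fun y => ?_
    have hc : {t : ℝ | y + t • v ∈ s}.Countable := by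
      refine (countable_setOfPred_isolated_right_within (s := {t : ℝ | y + t • v ∈ s})).mono ?_
      intro t ht
      refine ⟨ht, ?_⟩
      obtain ⟨h1, h2, h3⟩ := ht
      have hd : HasDerivAt (fun t : ℝ => w (y + t • v)) (fderiv ℝ w (y + t • v) v) t := by
        have e := ((hw.contDiffAt (hΩ.mem_nhds h1)).differentiableAt (by simp)).hasFDerivAt
        refine e.comp_hasDerivAt t ?_
        simpa using ((hasDerivAt_id t).smul_const v).const_add y
      have hne := hd.eventually_ne h3 (c := 0)
      rw [← empty_mem_iff_bot]
      have hle : 𝓝[{t : ℝ | y + t • v ∈ s} ∩ Ioi t] t ≤ 𝓝[≠] t :=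
        nhdsWithin_mono _ fun a ha => (ne_of_gt ha.2)
      filter_upwards [hle hne, self_mem_nhdsWithin] with a ha hb
      exact ha hb.1.2.1
    filter_upwards [hc.ae_notMem volume] with t ht
    simpa using ht
  filter_upwards [key] with z hz h1 h2
  by_contra h3
  exact hz ⟨h1, h2, h3⟩

theorem ae_gradient_eq_zero {Ω : Set ℂ} (hΩ : IsOpen Ω) {w : ℂ → ℝ} (hw : ContDiffOn ℝ 1 w Ω) :
    ∀ᵐ z, z ∈ Ω → w z = 0 → fderiv ℝ w z = 0 := by
  filter_upwards [ae_fderiv_apply_eq_zero hΩ hw 1, ae_fderiv_apply_eq_zero hΩ hw I] with z h1 h2 h h0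
  exact clm_ext_complex (by simpa using h1 h h0) (by simpa using h2 h h0)

/-- A smooth odd nondecreasing function vanishing near `0` and equal to the identity near
infinity. -/
noncomputable def smoothTruncation (t : ℝ) : ℝ := t * Real.smoothTransition (t ^ 2 - 1)

theorem contDiff_smoothTruncation : ContDiff ℝ ∞ smoothTruncation :=
  contDiff_id.mul (Real.smoothTransition.contDiff.comp (by fun_prop))

theorem smoothTruncation_eq_zero {t : ℝ} (h : |t| ≤ 1) : smoothTruncation t = 0 := by
  rw [smoothTruncation, Real.smoothTransition.zero_of_nonpos, mul_zero]
  have := abs_le.1 h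
  nlinarith

theorem deriv_smoothTruncation_eq_zero {t : ℝ} (h : |t| < 1) : deriv smoothTruncation t = 0 := by
  have : smoothTruncation =ᶠ[𝓝 t] fun _ => 0 := by
    filter_upwards [continuous_abs.continuousAt.eventually_lt continuousAt_const h] with s hs
    exact smoothTruncation_eq_zero hs.le
  rw [this.deriv_eq, deriv_const]

theorem deriv_smoothTruncation_eq_one {t : ℝ} (h : 2 < |t|) : deriv smoothTruncation t = 1 := by
  have : smoothTruncation =ᶠ[𝓝 t] fun s => s := by
    filter_upwards [continuousAt_const.eventually_lt continuous_abs.continuousAt h] with s hs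
    rw [smoothTruncation, Real.smoothTransition.one_of_one_le, mul_one]
    rw [← sq_abs]; nlinarith
  rw [this.deriv_eq, deriv_id'']

theorem deriv_smoothTruncation_nonneg (t : ℝ) : 0 ≤ deriv smoothTruncation t := by
  have hd : HasDerivAt smoothTruncation (1 * Real.smoothTransition (t ^ 2 - 1) +
      t * (deriv Real.smoothTransition (t ^ 2 - 1) * (2 * t))) t := by
    have h1 : HasDerivAt (fun t : ℝ => t ^ 2 - 1) (2 * t) t := by
      simpa using (hasDerivAt_pow 2 t).sub_const 1
    have h2 : HasDerivAt Real.smoothTransition (deriv Real.smoothTransition (t ^ 2 - 1)) (t ^ 2 - 1) :=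
      ((Real.smoothTransition.contDiff (n := 1)).differentiable (by simp) _).hasDerivAt
    have h3 : HasDerivAt (fun t : ℝ => Real.smoothTransition (t ^ 2 - 1)) _ t :=
      HasDerivAt.comp (h₂ := Real.smoothTransition) (h := fun t : ℝ => t ^ 2 - 1) t h2 h1
    exact (hasDerivAt_id t).mul h3
  rw [hd.deriv]
  have h1 := Real.smoothTransition.nonneg (t ^ 2 - 1)
  have h2 : 0 ≤ deriv Real.smoothTransition (t ^ 2 - 1) := Real.smoothTransition.monotone.deriv_nonneg
  nlinarith [mul_nonneg h2 (sq_nonneg t)]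

theorem exists_deriv_smoothTruncation_le : ∃ M, 1 ≤ M ∧ ∀ t, deriv smoothTruncation t ≤ M := by
  have hc : Continuous (deriv smoothTruncation) :=
    contDiff_smoothTruncation.continuous_deriv (by simp)
  obtain ⟨C, hC⟩ := (isCompact_Icc (a := (-2 : ℝ)) (b := 2)).exists_bound_of_continuousOn
    hc.continuousOn
  refine ⟨max C 1, le_max_right _ _, fun t => ?_⟩
  by_cases h : |t| ≤ 2
  · exact (le_abs_self _).trans ((hC t (abs_le.1 h)).trans (le_max_left _ _))
  · rw [deriv_smoothTruncation_eq_one (not_le.1 h)]; exact le_max_right _ _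

/-- The truncation of `w` at level `1 / N` has gradient `T'(N w) ∇w`, with `T` the smooth
truncation. This factor becomes `1` wherever `w ≠ 0`, while `∇w` vanishes almost everywhere on `{w =
0}`; so the truncated gradients converge to `∇w` almost everywhere. -/
theorem tendsto_deriv_smoothTruncation {t : ℝ} (h : t ≠ 0) :
    Tendsto (fun k : ℕ => deriv smoothTruncation ((k + 1) * t)) atTop (𝓝 1) := by
  refine tendsto_const_nhds.congr' ?_
  have h1 : Tendsto (fun k : ℕ => ((k : ℝ) + 1) * |t|) atTop atTop :=
    (tendsto_atTop_add_const_right _ 1 tendsto_natCast_atTop_atTop).atTop_mul_const (by positivity)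
  filter_upwards [h1.eventually_gt_atTop 2] with k hk
  rw [deriv_smoothTruncation_eq_one]
  rwa [abs_mul, abs_of_pos (by positivity)]

/-- The function `w` tends to zero at the boundary of `Ω`. -/
def VanishesAtBoundary (Ω : Set ℂ) (w : ℂ → ℝ) : Prop :=
  ∀ ε > 0, ∃ K ⊆ Ω, IsCompact K ∧ ∀ z ∈ Ω \ K, |w z| < ε

/-- The truncation of `w` at a level `1 / N`, extended by zero. -/
noncomputable def truncated (Ω : Set ℂ) (w : ℂ → ℝ) (N : ℝ) : ℂ → ℝ :=
  Ω.indicator fun z => N⁻¹ * smoothTruncation (N * w z)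

section

variable {Ω : Set ℂ} {w : ℂ → ℝ} {N : ℝ}

theorem VanishesAtBoundary.exists_isCompact (h : VanishesAtBoundary Ω w) (hN : 0 < N) :
    ∃ K ⊆ Ω, IsCompact K ∧ ∀ z ∈ Ω \ K, |N * w z| < 1 := by
  obtain ⟨K, h1, h2, h3⟩ := h N⁻¹ (by positivity)
  refine ⟨K, h1, h2, fun z hz => ?_⟩
  rw [abs_mul, abs_of_pos hN, mul_comm, ← lt_div_iff₀ hN, one_div]
  exact h3 z hz

theorem hasFDerivAt_truncated (hΩ : IsOpen Ω) (hw : ContDiffOn ℝ 1 w Ω) (hN : 0 < N) {z : ℂ}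
    (hz : z ∈ Ω) :
    HasFDerivAt (truncated Ω w N) (deriv smoothTruncation (N * w z) • fderiv ℝ w z) z := by
  have h1 := ((hw.contDiffAt (hΩ.mem_nhds hz)).differentiableAt (by simp)).hasFDerivAt
  have h2 : HasDerivAt smoothTruncation (deriv smoothTruncation (N * w z)) (N * w z) :=
    (contDiff_smoothTruncation.differentiable (by simp) _).hasDerivAt
  have h3 := (h2.comp_hasFDerivAt z (h1.const_mul N)).const_mul N⁻¹
  have h4 : truncated Ω w N =ᶠ[𝓝 z] fun z => N⁻¹ * smoothTruncation (N * w z) := by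
    filter_upwards [hΩ.mem_nhds hz] with y hy using indicator_of_mem hy _
  refine (h3.congr_of_eventuallyEq h4).congr_fderiv ?_
  ext v; simp; field_simp

theorem truncated_eq_zero {K : Set ℂ} (hK : ∀ z ∈ Ω \ K, |N * w z| < 1) {z : ℂ} (hz : z ∉ K) :
    truncated Ω w N z = 0 := by
  rw [truncated, indicator_apply_eq_zero]
  intro h
  rw [smoothTruncation_eq_zero (hK z ⟨h, hz⟩).le, mul_zero]

theorem tsupport_truncated_subset {K : Set ℂ} (hc : IsCompact K)
    (hK : ∀ z ∈ Ω \ K, |N * w z| < 1) : tsupport (truncated Ω w N) ⊆ K := by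
  refine closure_minimal (fun z hz => ?_) hc.isClosed
  by_contra h
  exact hz (truncated_eq_zero hK h)

/-- Outside a compact subset of `Ω` one has `|N w| < 1`, where the truncation is zero; its extension
by zero is therefore an admissible test function. -/
theorem contDiff_truncated (hΩ : IsOpen Ω) (hw : ContDiffOn ℝ 1 w Ω)
    (hv : VanishesAtBoundary Ω w) (hN : 0 < N) : ContDiff ℝ 1 (truncated Ω w N) := by
  obtain ⟨K, h1, h2, h3⟩ := hv.exists_isCompact hN
  rw [contDiff_iff_contDiffAt]
  intro z
  by_cases hz : z ∈ Ω
  · have h4 : truncated Ω w N =ᶠ[𝓝 z] fun z => N⁻¹ * smoothTruncation (N * w z) := by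
      filter_upwards [hΩ.mem_nhds hz] with y hy using indicator_of_mem hy _
    refine ContDiffAt.congr_of_eventuallyEq ?_ h4
    have h5 := (contDiff_smoothTruncation.of_le (m := 1) (by simp)).contDiffAt.comp z
      (contDiffAt_const (c := N) |>.mul (hw.contDiffAt (hΩ.mem_nhds hz)))
    exact contDiffAt_const.mul h5
  · have h4 : truncated Ω w N =ᶠ[𝓝 z] fun _ => 0 := by
      filter_upwards [h2.isClosed.isOpen_compl.mem_nhds fun h => hz (h1 h)] with y hy
      exact truncated_eq_zero h3 hy
    exact contDiffAt_const.congr_of_eventuallyEq h4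

theorem integral_truncated (hΩ : IsOpen Ω) (hw : ContDiffOn ℝ 1 w Ω)
    (hv : VanishesAtBoundary Ω w) (hN : 0 < N) {V : ℂ → ℂ} (hV : WeakDivFree Ω V) :
    ∫ z in Ω, deriv smoothTruncation (N * w z) * fderiv ℝ w z (V z) = 0 := by
  obtain ⟨K, h1, h2, h3⟩ := hv.exists_isCompact hN
  have ht := tsupport_truncated_subset h2 h3
  have h4 := hV _ (contDiff_truncated hΩ hw hv hN) (h2.of_isClosed_subset (isClosed_tsupport _) ht)
    (ht.trans h1)
  rw [← h4, ← setIntegral_eq_integral_of_forall_compl_eq_zero (s := Ω)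
    (f := fun z => fderiv ℝ (truncated Ω w N) z (V z))]
  · refine setIntegral_congr_fun hΩ.measurableSet fun z hz => ?_
    simp only [(hasFDerivAt_truncated hΩ hw hN hz).fderiv]
    simp
  · intro z hz
    have : fderiv ℝ (truncated Ω w N) z = 0 := by
      by_contra h
      exact hz (h1 (ht (support_fderiv_subset ℝ (f := truncated Ω w N) h)))
    rw [this]; simp

/-- Integration by parts against a divergence-free field, for functions vanishing on `∂Ω`. -/
theorem WeakDivFree.integral_eq_zero {V : ℂ → ℂ} (hV : WeakDivFree Ω V) (hΩ : IsOpen Ω)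
    (hw : ContDiffOn ℝ 1 w Ω) (hv : VanishesAtBoundary Ω w)
    (hi : IntegrableOn (fun z => fderiv ℝ w z (V z)) Ω) : ∫ z in Ω, fderiv ℝ w z (V z) = 0 := by
  obtain ⟨M, hM1, hM⟩ := exists_deriv_smoothTruncation_le
  have hlim : Tendsto (fun k : ℕ => ∫ z in Ω,
      deriv smoothTruncation ((k + 1) * w z) * fderiv ℝ w z (V z)) atTop
      (𝓝 (∫ z in Ω, fderiv ℝ w z (V z))) := by
    refine tendsto_integral_of_dominated_convergence (fun z => M * ‖fderiv ℝ w z (V z)‖) ?_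
      (hi.norm.const_mul M) ?_ ?_
    · intro k
      refine AEStronglyMeasurable.mul ?_ hi.aestronglyMeasurable
      refine ContinuousOn.aestronglyMeasurable ?_ hΩ.measurableSet
      exact (contDiff_smoothTruncation.continuous_deriv (by simp)).comp_continuousOn
        (continuousOn_const.mul hw.continuousOn)
    · intro k
      refine Eventually.of_forall fun z => ?_
      rw [norm_mul, Real.norm_of_nonneg (deriv_smoothTruncation_nonneg _)]
      exact mul_le_mul_of_nonneg_right (hM _) (norm_nonneg _)
    -- Where `w = 0` both sides vanish for almost every point; elsewhere the factor is eventually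
    -- `1`.
    · filter_upwards [ae_restrict_of_ae (ae_gradient_eq_zero hΩ hw),
        ae_restrict_mem hΩ.measurableSet] with z h1 h2
      by_cases h : w z = 0
      · simp [h1 h2 h]
      · simpa using (tendsto_deriv_smoothTruncation h).mul_const (fderiv ℝ w z (V z))
  refine tendsto_nhds_unique hlim (tendsto_const_nhds.congr fun k => ?_)
  exact (integral_truncated hΩ hw hv (by positivity) hV).symm

/-- An energy estimate of Caccioppoli type. -/
theorem WeakDivFree.integrableOn_norm_fderiv_sq {V : ℂ → ℂ} (hV : WeakDivFree Ω V)
    (hΩ : IsOpen Ω) (hb : Bornology.IsBounded Ω) (hVm : AEStronglyMeasurable V (volume.restrict Ω))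
    (hw : ContDiffOn ℝ 1 w Ω) (hv : VanishesAtBoundary Ω w) {C : ℝ}
    (hC : ∀ z ∈ Ω, fderiv ℝ w z ≠ 0 → ‖V z - gradient w z‖ ≤ C) :
    IntegrableOn (fun z => ‖fderiv ℝ w z‖ ^ 2) Ω := by
  obtain ⟨M, hM1, hM⟩ := exists_deriv_smoothTruncation_le
  have hfin : volume Ω ≠ ⊤ := hb.measure_lt_top.ne
  have hwf : ContinuousOn (fderiv ℝ w) Ω := hw.continuousOn_fderiv_of_isOpen hΩ (by simp)
  let a : ℕ → ℂ → ℝ := fun k z => deriv smoothTruncation ((k + 1) * w z)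
  have ha0 : ∀ k z, 0 ≤ a k z := fun k z => deriv_smoothTruncation_nonneg _
  have hac : ∀ k, ContinuousOn (a k) Ω := fun k =>
    (contDiff_smoothTruncation.continuous_deriv (by simp)).comp_continuousOn
      (continuousOn_const.mul hw.continuousOn)
  have i1 : ∀ k, IntegrableOn (fun z => a k z * ‖fderiv ℝ w z‖ ^ 2) Ω := by
    intro k
    obtain ⟨K, h1, h2, h3⟩ := hv.exists_isCompact (N := k + 1) (by positivity)
    refine IntegrableOn.of_forall_sdiff_eq_zero (s := K) ?_ hΩ.measurableSet fun z hz => ?_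
    · exact (((hac k).mul (hwf.norm.pow 2)).mono h1).integrableOn_compact h2
    · simp only [a]
      rw [deriv_smoothTruncation_eq_zero (h3 z hz), zero_mul]
  have hgrad : ∀ z v, fderiv ℝ w z v = inner ℝ (gradient w z) v := fun z v => by
    rw [inner_gradient_left]
  have hgn : ∀ z, ‖gradient w z‖ = ‖fderiv ℝ w z‖ := fun z => by simp [gradient]
  -- As `V` is `∇w` up to an error bounded by `C`, Young's inequality compares `dw(V)` with `|∇w|²`.
  have hest : ∀ z ∈ Ω, |fderiv ℝ w z (V z) - ‖fderiv ℝ w z‖ ^ 2| ≤ ‖fderiv ℝ w z‖ ^ 2 / 2 + C ^ 2 / 2 := by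
    intro z hz
    by_cases h : fderiv ℝ w z = 0
    · simp [h]; positivity
    have e : fderiv ℝ w z (V z) - ‖fderiv ℝ w z‖ ^ 2 =
        inner ℝ (gradient w z) (V z - gradient w z) := by
      rw [inner_sub_right, ← hgrad, real_inner_self_eq_norm_sq, hgn]
    rw [e]
    refine (abs_real_inner_le_norm _ _).trans ?_
    rw [hgn]
    have := hC z hz h
    have h0 := norm_nonneg (fderiv ℝ w z)
    nlinarith [sq_nonneg (‖fderiv ℝ w z‖ - C), mul_le_mul_of_nonneg_left this h0]
  have i2 : ∀ k, IntegrableOn (fun z => a k z * fderiv ℝ w z (V z)) Ω := by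
    intro k
    refine Integrable.mono' (g := fun z => 2 * (a k z * ‖fderiv ℝ w z‖ ^ 2) + M * C ^ 2) ?_ ?_ ?_
    · exact ((i1 k).const_mul 2).add (integrableOn_const hfin)
    · refine ((hac k).aestronglyMeasurable hΩ.measurableSet).mul ?_
      have h1 := hwf.aestronglyMeasurable (μ := volume) hΩ.measurableSet
      exact isBoundedBilinearMap_apply.continuous.comp_aestronglyMeasurable (h1.prodMk hVm)
    · filter_upwards [ae_restrict_mem hΩ.measurableSet] with z hz
      rw [norm_mul, Real.norm_of_nonneg (ha0 k z)]
      have h1 := abs_le.1 (hest z hz)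
      have h2 : ‖fderiv ℝ w z (V z)‖ ≤ 2 * ‖fderiv ℝ w z‖ ^ 2 + C ^ 2 := by
        rw [Real.norm_eq_abs, abs_le]; constructor <;> nlinarith [sq_nonneg ‖fderiv ℝ w z‖, sq_nonneg C]
      nlinarith [mul_le_mul_of_nonneg_left h2 (ha0 k z), mul_le_mul_of_nonneg_right (hM ((k + 1) * w z)) (sq_nonneg C)]
  -- Subtracting twice the vanishing integral of `a_k dw(V)` costs nothing, and by `hest` the
  -- resulting integrand is at most `a_k C² ≤ M C²`. The bound does not depend on `k`.
  have hbound : ∀ k, ∫ z in Ω, a k z * ‖fderiv ℝ w z‖ ^ 2 ≤ ∫ z in Ω, M * C ^ 2 := by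
    intro k
    have h0 : ∫ z in Ω, a k z * fderiv ℝ w z (V z) = 0 :=
      integral_truncated hΩ hw hv (N := k + 1) (by positivity) hV
    have h1 : ∫ z in Ω, (a k z * ‖fderiv ℝ w z‖ ^ 2 - 2 * (a k z * fderiv ℝ w z (V z))) ≤
        ∫ z in Ω, M * C ^ 2 := by
      refine setIntegral_mono_on ((i1 k).sub ((i2 k).const_mul 2)) (integrableOn_const hfin)
        hΩ.measurableSet fun z hz => ?_
      have h1 := abs_le.1 (hest z hz)
      nlinarith [mul_le_mul_of_nonneg_left h1.1 (ha0 k z), mul_le_mul_of_nonneg_right (hM ((k + 1) * w z)) (sq_nonneg C)]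
    rwa [integral_sub (i1 k) ((i2 k).const_mul 2), integral_const_mul, h0, mul_zero, sub_zero] at h1
  have hconv : ∀ᵐ z ∂(volume.restrict Ω), Tendsto (fun k => a k z * ‖fderiv ℝ w z‖ ^ 2) atTop
      (𝓝 (‖fderiv ℝ w z‖ ^ 2)) := by
    filter_upwards [ae_restrict_of_ae (ae_gradient_eq_zero hΩ hw),
        ae_restrict_mem hΩ.measurableSet] with z h1 h2
    by_cases h : w z = 0
    · simp [h1 h2 h]
    · simpa using (tendsto_deriv_smoothTruncation h).mul_const (‖fderiv ℝ w z‖ ^ 2)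
  refine ⟨(hwf.norm.pow 2).aestronglyMeasurable hΩ.measurableSet, ?_⟩
  -- Fatou's lemma transfers the uniform bound on the truncated energies to the limit.
  have h1 : ∫⁻ z in Ω, ‖‖fderiv ℝ w z‖ ^ 2‖ₑ ≤
      liminf (fun k => ∫⁻ z in Ω, ‖a k z * ‖fderiv ℝ w z‖ ^ 2‖ₑ) atTop := by
    rw [lintegral_congr_ae (g := fun z => liminf (fun k => ‖a k z * ‖fderiv ℝ w z‖ ^ 2‖ₑ) atTop)
      (by filter_upwards [hconv] with z hz using hz.enorm.liminf_eq.symm)]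
    exact lintegral_liminf_le' fun k => (i1 k).aestronglyMeasurable.enorm
  refine lt_of_le_of_lt h1 (lt_of_le_of_lt (b := ENNReal.ofReal (∫ z in Ω, M * C ^ 2)) ?_
    ENNReal.ofReal_lt_top)
  refine liminf_le_of_le (by isBoundedDefault) fun b hb => ?_
  obtain ⟨k, hk⟩ := hb.exists
  refine hk.trans ?_
  rw [← ofReal_integral_norm_eq_lintegral_enorm (i1 k)]
  refine ENNReal.ofReal_le_ofReal ((le_of_eq ?_).trans (hbound k))
  refine integral_congr_ae (Eventually.of_forall fun z => ?_)
  simp only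
  rw [Real.norm_of_nonneg (mul_nonneg (ha0 k z) (sq_nonneg _))]

end

end Truncation

/-! ### The current of a singular harmonic map and its square integrability up to the boundary -/

section CanonicalField

open Complex Metric Filter
open scoped ComplexConjugate Manifold

/-- The canonical phase `∏ⱼ ((z - xⱼ) / |z - xⱼ|) ^ dⱼ`. -/
noncomputable def vortexPhase {n : ℕ} (d : Fin n → ℤ) (x : Config n) (z : ℂ) : ℂ :=
  ∏ j, ((z - x j) / (‖z - x j‖ : ℂ)) ^ d j

/-- The current of the product of the canonical phase and the circle-valued map `v`. -/
noncomputable def vortexCurrent {n : ℕ} (d : Fin n → ℤ) (x : Config n) (v : ℂ → ℂ) (z : ℂ) : ℂ :=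
  ∑ j, (d j : ℂ) * angularField (x j) z + current v z

variable {n : ℕ} {d : Fin n → ℤ} {x : Config n} {Ω : Set ℂ} {u v g : ℂ → ℂ}

theorem finite_singularPoints (x : Config n) : (singularPoints x).Finite := finite_range _

theorem isOpen_diff_singularPoints (hΩ : IsOpen Ω) (x : Config n) : IsOpen (Ω \ singularPoints x) :=
  hΩ.sdiff (finite_singularPoints x).isClosed

theorem ne_of_notMem_singularPoints {z : ℂ} (hz : z ∉ singularPoints x) (j : Fin n) : z ≠ x j :=
  fun h => hz ⟨j, h.symm⟩

theorem hasCurrent_vortexPhase {z : ℂ} (hz : z ∉ singularPoints x) :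
    HasCurrent (vortexPhase d x) z (∑ j, (d j : ℂ) * angularField (x j) z) := by
  refine HasCurrent.prod _ fun j _ => ?_
  have h := ne_of_notMem_singularPoints hz j
  refine (hasCurrent_unit h).zpow ?_ (d j)
  filter_upwards [isOpen_ne.mem_nhds h] with w hw using norm_unit (sub_ne_zero.2 hw)

theorem hasCurrent_of_eqOn (hΩ : IsOpen Ω) (hv : IsHarmonicCircleMap Ω v)
    (hu : ∀ z ∈ Ω \ singularPoints x, u z = vortexPhase d x z * v z) {z : ℂ}
    (hz : z ∈ Ω \ singularPoints x) : HasCurrent u z (vortexCurrent d x v z) :=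
  ((hasCurrent_vortexPhase hz.2).mul (hv.hasCurrent hΩ hz.1)).congr_of_eventuallyEq
    (by filter_upwards [(isOpen_diff_singularPoints hΩ x).mem_nhds hz] with w hw using hu w hw)

theorem contDiffOn_current (hΩ : IsOpen Ω) (hv : IsHarmonicCircleMap Ω v) {m : WithTop ℕ∞} :
    ContDiffOn ℝ m (current v) Ω :=
  contDiffOn_of_differentiableOn_conj hΩ (hv.differentiableOn_conj_current hΩ)

theorem contDiffOn_vortexCurrent (hΩ : IsOpen Ω) (hv : IsHarmonicCircleMap Ω v) :
    ContDiffOn ℝ ∞ (vortexCurrent d x v) (Ω \ singularPoints x) := by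
  refine ContDiffOn.add (ContDiffOn.sum fun j _ => contDiffOn_const.mul fun z hz => ?_)
    ((contDiffOn_current hΩ hv).mono sdiff_subset)
  exact (contDiffAt_angularField (ne_of_notMem_singularPoints hz.2 j)).contDiffWithinAt

theorem measurable_angularField (a : ℂ) : Measurable (angularField a) := by
  unfold angularField; fun_prop

theorem aestronglyMeasurable_vortexCurrent (hΩ : IsOpen Ω) (hv : IsHarmonicCircleMap Ω v) :
    AEStronglyMeasurable (vortexCurrent d x v) (volume.restrict Ω) := by
  refine AEStronglyMeasurable.add (Measurable.aestronglyMeasurable ?_)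
    ((contDiffOn_current hΩ hv (m := 1)).continuousOn.aestronglyMeasurable hΩ.measurableSet)
  have := fun j => measurable_angularField (x j)
  fun_prop

/-- By linearity: the angular fields are divergence free across their singularities, and the current
of `v` has a holomorphic conjugate. Each pairing must first be shown integrable in order to split
the integral. -/
theorem weakDivFree_vortexCurrent (hΩ : IsOpen Ω) (hv : IsHarmonicCircleMap Ω v) :
    WeakDivFree Ω (vortexCurrent d x v) := by
  intro w hw hc hs
  have hcont := hw.continuous_fderiv (by simp)
  have i1 : ∀ j, Integrable fun z => (d j : ℝ) * fderiv ℝ w z (angularField (x j) z) := by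
    intro j
    refine Integrable.const_mul ((integrable_fderiv_angularField hw hc (x j)).mono' ?_ ?_) _
    · exact isBoundedBilinearMap_apply.continuous.comp_aestronglyMeasurable
        (hcont.aestronglyMeasurable.prodMk (measurable_angularField _).aestronglyMeasurable)
    · refine Eventually.of_forall fun z => ((fderiv ℝ w z).le_opNorm _).trans ?_
      rw [norm_angularField]
  have h2 := weakDivFree_of_differentiableOn_conj hΩ (hv.differentiableOn_conj_current hΩ) w hw hc hs
  have i2 : Integrable fun z => fderiv ℝ w z (current v z) := by
    have hc1 : Continuous fun z => fderiv ℝ w z (current v z) := by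
      refine ContinuousOn.continuous_of_tsupport_subset (s := Ω) ?_ hΩ ?_
      · exact hcont.continuousOn.clm_apply (contDiffOn_current hΩ hv (m := 1)).continuousOn
      · refine (closure_mono fun z hz => ?_).trans ((tsupport_fderiv_subset ℝ (f := w)).trans hs)
        intro h; simp only [Function.mem_support] at hz; rw [h] at hz; simp at hz
    refine hc1.integrable_of_hasCompactSupport (hc.mono' fun z hz => ?_)
    refine tsupport_fderiv_subset ℝ (subset_tsupport _ fun h => ?_)
    simp only [Function.mem_support] at hz; rw [h] at hz; simp at hz
  have e : ∀ z, fderiv ℝ w z (vortexCurrent d x v z) =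
      ∑ j, (d j : ℝ) * fderiv ℝ w z (angularField (x j) z) + fderiv ℝ w z (current v z) := by
    intro z
    rw [vortexCurrent, map_add, map_sum]
    congr 1
    refine Finset.sum_congr rfl fun j _ => ?_
    rw [← smul_eq_mul (a := (d j : ℝ)), ← map_smul, real_smul]; push_cast; rfl
  simp_rw [e]
  rw [integral_add (integrable_finsetSum _ fun j _ => i1 j) i2, h2, add_zero,
    integral_finsetSum _ fun j _ => i1 j]
  refine Finset.sum_eq_zero fun j _ => ?_
  rw [integral_const_mul, weakDivFree_angularField Ω (x j) w hw hc hs, mul_zero]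

theorem contDiffOn_one_of_hasGradientAt (hΩ : IsOpen Ω) {f : ℂ → ℝ} {c : ℂ → ℂ}
    (hf : ∀ z ∈ Ω, HasGradientAt f (c z) z) (hc : ContinuousOn c Ω) : ContDiffOn ℝ 1 f Ω := by
  rw [show (1 : WithTop ℕ∞) = 0 + 1 by simp, contDiffOn_succ_iff_fderiv_of_isOpen hΩ]
  refine ⟨fun z hz => (hf z hz).differentiableAt.differentiableWithinAt, by simp, ?_⟩
  rw [contDiffOn_zero]
  refine ContinuousOn.congr (f := fun z => InnerProductSpace.toDual ℝ ℂ (c z)) ?_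
    fun z hz => (hf z hz).hasFDerivAt.fderiv
  exact (InnerProductSpace.toDual ℝ ℂ).continuous.comp_continuousOn hc

/-- The set `K` consists of the points of the closure outside a relatively open set on which `f` is
`ε`-close to `c` and `S` is avoided. It is closed, and it misses the frontier because `f = c` there.
-/
theorem exists_isCompact_of_eq_frontier {E : Type*} [NormedAddCommGroup E] (hΩ : IsOpen Ω)
    (hb : Bornology.IsBounded Ω) {S : Set ℂ} (hS : S.Finite) (hSΩ : S ⊆ Ω) {f : ℂ → E} {c : E}
    (hf : ContinuousOn f (closure Ω \ S)) (hfc : ∀ z ∈ frontier Ω, f z = c) {ε : ℝ} (hε : 0 < ε) :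
    ∃ K ⊆ Ω, IsCompact K ∧ S ⊆ K ∧ ∀ z ∈ Ω \ K, ‖f z - c‖ < ε := by
  have hopen : IsOpen Sᶜ := hS.isClosed.isOpen_compl
  obtain ⟨W, hW, hWeq⟩ := _root_.continuousOn_iff'.1 hf (ball c ε) isOpen_ball
  let K := closure Ω \ (W ∩ Sᶜ)
  have hmem : ∀ z ∈ closure Ω, z ∉ K → z ∉ S ∧ ‖f z - c‖ < ε := by
    intro z hz hK
    have h1 : z ∈ W ∩ Sᶜ := by by_contra h; exact hK ⟨hz, h⟩
    have h2 : z ∈ f ⁻¹' ball c ε ∩ (closure Ω \ S) := hWeq ▸ ⟨h1.1, hz, h1.2⟩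
    exact ⟨h1.2, by simpa [dist_eq_norm] using h2.1⟩
  refine ⟨K, fun z hz => ?_, ?_, fun z hz => ⟨subset_closure (hSΩ hz), fun h => h.2 hz⟩,
    fun z hz => (hmem z (subset_closure hz.1) hz.2).2⟩
  · by_contra h
    have h1 : z ∈ frontier Ω := by rw [hΩ.frontier_eq]; exact ⟨hz.1, h⟩
    have h2 : z ∈ closure Ω \ S := ⟨hz.1, fun h' => h (hSΩ h')⟩
    have h3 : z ∈ f ⁻¹' ball c ε ∩ (closure Ω \ S) := ⟨by simp [hfc z h1, hε], h2⟩
    rw [hWeq] at h3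
    exact hz.2 ⟨h3.1, h2.2⟩
  · exact hb.isCompact_closure.of_isClosed_subset
      (isClosed_closure.sdiff (hW.inter hopen)) sdiff_subset

theorem measurableSet_perforated (hΩ : IsOpen Ω) (x : Config n) (ρ : ℝ) :
    MeasurableSet (perforated Ω x ρ) :=
  hΩ.measurableSet.diff (MeasurableSet.iUnion fun _ => measurableSet_ball)

theorem notMem_singularPoints_of_mem_perforated {ρ : ℝ} (hρ : 0 < ρ) {z : ℂ}
    (hz : z ∈ perforated Ω x ρ) : z ∉ singularPoints x := by
  rintro ⟨j, rfl⟩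
  exact hz.2 (mem_iUnion.2 ⟨j, mem_ball_self hρ⟩)

theorem mem_slitPlane_of_norm_sub_one_lt {w : ℂ} (hw : ‖w - 1‖ < 1) : w ∈ slitPlane := by
  left
  have := abs_le.1 ((Complex.abs_re_le_norm (w - 1)).trans hw.le)
  have h2 := (Complex.abs_re_le_norm (w - 1)).trans_lt hw
  rw [abs_lt] at h2
  simp at h2; linarith

theorem exists_arg_lt {ε : ℝ} (hε : 0 < ε) : ∃ δ > 0, ∀ w : ℂ, ‖w - 1‖ < δ → |w.arg| < ε := by
  have h : ContinuousAt Complex.arg 1 := Complex.continuousAt_arg (by simp)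
  obtain ⟨δ, h1, h2⟩ := Metric.continuousAt_iff.1 h ε hε
  refine ⟨δ, h1, fun w hw => ?_⟩
  simpa using h2 (by rwa [dist_eq_norm])

/-- Near `∂Ω` one can write `u = G e^{iφ}` with `G = g / |g|` smooth and `φ = arg (u conj G)`
tending to zero at `∂Ω`. Then `∇φ` is the divergence-free current of `u` minus the bounded current
of `G`, and the Caccioppoli estimate gives `∇φ ∈ L²`. Away from `∂Ω` and from the discs the current
is continuous on a compact set. -/
theorem integrableOn_norm_vortexCurrent_sq (hΩ : IsSmoothBoundedDomain Ω)
    (hg : IsSmoothBoundaryDatum Ω g) (hx : x ∈ configSpace Ω n) (hv : IsHarmonicCircleMap Ω v)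
    (hu : ∀ z ∈ Ω \ singularPoints x, u z = vortexPhase d x z * v z)
    (hub : HasBoundaryValues Ω x g u) {ρ : ℝ} (hρ : 0 < ρ) :
    IntegrableOn (fun z => ‖vortexCurrent d x v z‖ ^ 2) (perforated Ω x ρ) := by
  have hO := hΩ.isOpen
  have hS : singularPoints x ⊆ Ω := by rintro _ ⟨j, rfl⟩; exact hx.1 j
  have hfront : ∀ z ∈ frontier Ω, u z * conj (g z) = 1 := fun z hz => by
    rw [hub.2 hz]; exact mul_conj_of_norm_eq_one (hg.norm_eq_one z hz)
  have hcont : ContinuousOn (fun z => u z * conj (g z)) (closure Ω \ singularPoints x) :=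
    hub.1.mul (continuous_conj.comp_continuousOn hg.smooth.continuous.continuousOn)
  -- Closeness `1 / 2` of `u conj g` to `1` off `K` serves twice: it keeps `|g| ≥ 1 / 2`, and it
  -- puts `u conj G` in the right half-plane.
  obtain ⟨K, hKΩ, hK, hSK, hKc⟩ := exists_isCompact_of_eq_frontier hO hΩ.isBounded
    (finite_singularPoints x) hS hcont hfront (ε := 1 / 2) (by norm_num)
  have hu1 : ∀ z ∈ Ω \ singularPoints x, ‖u z‖ = 1 := fun z hz => (hasCurrent_of_eqOn hO hv hu hz).1
  have hgK : ∀ z ∈ Ω \ K, 1 / 2 ≤ ‖g z‖ := by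
    intro z hz
    have h1 := hKc z hz
    have h2 := norm_sub_norm_le (1 : ℂ) (u z * conj (g z))
    rw [norm_sub_rev] at h1
    rw [norm_mul, hu1 z ⟨hz.1, fun h => hz.2 (hSK h)⟩, norm_conj, norm_one] at h2
    linarith
  let G : ℂ → ℂ := fun z => g z / (‖g z‖ : ℂ)
  have hGd : ∀ z, g z ≠ 0 → ContDiffAt ℝ 2 G z := fun z hz =>
    (contDiffAt_unit hz).comp z (hg.smooth.of_le (m := 2) (by norm_cast)).contDiffAt
  have hGcur : ∀ z, g z ≠ 0 → HasCurrent G z (current G z) := fun z hz =>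
    .of_norm_eq_one ((hGd z hz).differentiableAt (by simp)) (by
      filter_upwards [hg.smooth.continuous.continuousAt.eventually_ne hz] with w hw
      exact norm_unit hw)
  obtain ⟨t, ht, hKt, htΩ⟩ := exists_compact_between hK hO hKΩ
  obtain ⟨χ, hχ1, hχ0, hχ⟩ := exists_contMDiffMap_one_nhds_of_subset_interior 
    (n := (⊤ : ℕ∞)) 𝓘(ℝ, ℂ)
    hK.isClosed hKt
  have hχc : ContDiff ℝ ∞ χ := χ.contMDiff.contDiff
  have hslit : ∀ z ∈ Ω \ K, u z * conj (G z) ∈ slitPlane := by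
    intro z hz
    have h1 := hKc z hz
    have h2 : u z * conj (G z) = (‖g z‖⁻¹ : ℝ) * (u z * conj (g z)) := by
      simp [G, div_eq_mul_inv]; ring
    left
    rw [h2, re_ofReal_mul]
    have h3 : 0 < ‖g z‖ := by linarith [hgK z hz]
    have h4 := abs_lt.1 ((Complex.abs_re_le_norm (u z * conj (g z) - 1)).trans_lt h1)
    simp only [sub_re, one_re] at h4
    exact mul_pos (by positivity) (by linarith)
  have hcurK : ∀ z ∈ Ω \ K, HasCurrent (fun z => u z * conj (G z)) z
      (vortexCurrent d x v z - current G z) := by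
    intro z hz
    have h3 : g z ≠ 0 := by
      have := hgK z hz
      intro h; rw [h] at this; norm_num at this
    have := (hasCurrent_of_eqOn hO hv hu ⟨hz.1, fun h => hz.2 (hSK h)⟩).mul (hGcur z h3).star
    rwa [← sub_eq_add_neg] at this
  -- The cutoff removes the phase near `K`, where it need not be defined, and leaves it unchanged
  -- off `t`.
  let φ : ℂ → ℝ := fun z => (1 - χ z) * (u z * conj (G z)).arg
  have hgrad1 : ∀ z ∈ Ω \ K, HasGradientAt (fun z => (u z * conj (G z)).arg)
      (vortexCurrent d x v z - current G z) z := fun z hz =>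
    (hcurK z hz).hasGradientAt_arg (hslit z hz)
  have hKo : IsOpen (Ω \ K) := hO.sdiff hK.isClosed
  have hGc : ContinuousOn (current G) {z | g z ≠ 0} := by
    intro z hz
    refine ContinuousAt.continuousWithinAt ?_
    have h1 : ContinuousAt (fderiv ℝ G) z :=
      (hGd z hz).continuousAt_fderiv (by simp)
    have h0 : ContinuousAt G z := (hGd z hz).continuousAt
    have h2 := h1.clm_apply (continuousAt_const (y := (1 : ℂ)))
    have h3 := h1.clm_apply (continuousAt_const (y := I))
    have h4 : current G = fun z => ((planeDet (G z) (fderiv ℝ G z 1) : ℝ) : ℂ) +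
        (planeDet (G z) (fderiv ℝ G z I) : ℝ) * I := by
      ext z; exact (Complex.re_add_im (current G z)).symm
    rw [h4]
    unfold planeDet
    fun_prop
  have hgK' : closure (Ω \ K) ⊆ {z | g z ≠ 0} := by
    have h1 : closure (Ω \ K) ⊆ {z | 1 / 2 ≤ ‖g z‖} :=
      closure_minimal hgK (isClosed_le continuous_const hg.smooth.continuous.norm)
    intro z hz h
    have := h1 hz
    simp only [mem_ofPred_eq, h, norm_zero] at this
    norm_num at this
  have hJc : ContinuousOn (vortexCurrent d x v) (Ω \ singularPoints x) :=
    (contDiffOn_vortexCurrent hO hv).continuousOn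
  have hargC : ContDiffOn ℝ 1 (fun z => (u z * conj (G z)).arg) (Ω \ K) := by
    refine contDiffOn_one_of_hasGradientAt hKo hgrad1 ?_
    exact (hJc.mono fun z hz => ⟨hz.1, fun h => hz.2 (hSK h)⟩).sub
      (hGc.mono fun z hz => hgK' (subset_closure hz))
  have hφ0 : ∀ z ∈ K, φ =ᶠ[𝓝 z] 0 := by
    intro z hz
    filter_upwards [(eventually_nhdsSet_iff_forall.1 hχ1) z hz] with w hw
    simp [φ, hw]
  have hφC : ContDiffOn ℝ 1 φ Ω := by
    intro z hz
    refine ContDiffAt.contDiffWithinAt ?_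
    by_cases h : z ∈ K
    · exact contDiffAt_const.congr_of_eventuallyEq (hφ0 z h)
    · exact (contDiffAt_const.sub (hχc.of_le (by simp)).contDiffAt).mul
        (hargC.contDiffAt (hKo.mem_nhds ⟨hz, h⟩))
  have hφv : VanishesAtBoundary Ω φ := by
    intro ε hε
    obtain ⟨δ, hδ, hδε⟩ := exists_arg_lt hε
    obtain ⟨K₁, h1, h2, h3, h4⟩ := exists_isCompact_of_eq_frontier hO hΩ.isBounded
      (finite_singularPoints x) hS hcont hfront hδ
    refine ⟨K₁ ∪ K, union_subset h1 hKΩ, h2.union hK, fun z hz => ?_⟩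
    have hz1 : z ∈ Ω \ K := ⟨hz.1, fun h => hz.2 (Or.inr h)⟩
    have h5 := hδε _ (h4 z ⟨hz.1, fun h => hz.2 (Or.inl h)⟩)
    have h6 : (u z * conj (G z)).arg = (u z * conj (g z)).arg := by
      have h3 : 0 < ‖g z‖ := by linarith [hgK z hz1]
      have h2 : u z * conj (G z) = (‖g z‖⁻¹ : ℝ) * (u z * conj (g z)) := by
        simp [G, div_eq_mul_inv]; ring
      rw [h2, arg_real_mul _ (by positivity)]
    simp only [φ, abs_mul, h6]
    have h7 := hχ z
    rw [abs_of_nonneg (by linarith [h7.2])]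
    nlinarith [abs_nonneg (u z * conj (g z)).arg, h7.1]
  have hKt' : ∀ z ∈ Ω \ t, HasGradientAt φ (vortexCurrent d x v z - current G z) z := by
    intro z hz
    have hz1 : z ∈ Ω \ K := ⟨hz.1, fun h => hz.2 (interior_subset (hKt h))⟩
    refine (hgrad1 z hz1).congr_of_eventuallyEq ?_
    filter_upwards [ht.isClosed.isOpen_compl.mem_nhds hz.2] with w hw
    simp [φ, hχ0 w hw]
  obtain ⟨C₁, hC₁⟩ := (hΩ.isBounded.subset sdiff_subset : Bornology.IsBounded (Ω \ K)
    ).isCompact_closure.exists_bound_of_continuousOn (hGc.mono hgK')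
  have hgradcont : ContinuousOn (fun z => gradient φ z) Ω := by
    have h1 : ContinuousOn (fderiv ℝ φ) Ω := hφC.continuousOn_fderiv_of_isOpen hO (by simp)
    exact (InnerProductSpace.toDual ℝ ℂ).symm.continuous.comp_continuousOn h1
  -- On the transition region `t` the identity for `∇φ` fails, but the support of `φ` stays away
  -- from the singularities, so compactness bounds the difference where `∇φ ≠ 0`.
  obtain ⟨C₂, hC₂⟩ : ∃ C₂, ∀ z ∈ t, fderiv ℝ φ z ≠ 0 →
      ‖vortexCurrent d x v z - gradient φ z‖ ≤ C₂ := by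
    have hcl : IsCompact (t ∩ tsupport φ) := ht.inter_right (isClosed_tsupport _)
    have hsub : t ∩ tsupport φ ⊆ Ω \ singularPoints x := by
      rintro z ⟨hz, hz2⟩
      refine ⟨htΩ hz, fun h => ?_⟩
      exact (notMem_tsupport_iff_eventuallyEq.2 (hφ0 z (hSK h))) hz2
    obtain ⟨C₂, hC₂⟩ := hcl.exists_bound_of_continuousOn
      ((hJc.mono hsub).sub (hgradcont.mono (hsub.trans sdiff_subset)))
    refine ⟨C₂, fun z hz h => hC₂ z ⟨hz, ?_⟩⟩
    exact support_fderiv_subset ℝ h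
  have hL2 : IntegrableOn (fun z => ‖fderiv ℝ φ z‖ ^ 2) Ω := by
    refine (weakDivFree_vortexCurrent (d := d) (x := x) hO hv).integrableOn_norm_fderiv_sq hO
      hΩ.isBounded (aestronglyMeasurable_vortexCurrent hO hv) hφC hφv (C := max C₁ C₂)
      fun z hz h => ?_
    by_cases hzt : z ∈ t
    · exact (hC₂ z hzt h).trans (le_max_right _ _)
    · rw [(hKt' z ⟨hz, hzt⟩).gradient, sub_sub_cancel]
      exact (hC₁ z (subset_closure ⟨hz, fun h => hzt (interior_subset (hKt h))⟩)).trans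
        (le_max_left _ _)
  have hfin : volume Ω ≠ ⊤ := hΩ.isBounded.measure_lt_top.ne
  have hJm : AEStronglyMeasurable (fun z => ‖vortexCurrent d x v z‖ ^ 2) (volume.restrict Ω) :=
    (aestronglyMeasurable_vortexCurrent hO hv).norm.pow 2
  have hA : IntegrableOn (fun z => ‖vortexCurrent d x v z‖ ^ 2) (Ω \ t) := by
    refine Integrable.mono' (g := fun z => 2 * ‖fderiv ℝ φ z‖ ^ 2 + 2 * C₁ ^ 2) ?_
      (hJm.mono_measure (Measure.restrict_mono sdiff_subset le_rfl)) ?_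
    · exact ((hL2.mono_set sdiff_subset).const_mul 2).add
        (integrableOn_const ((measure_mono sdiff_subset).trans_lt hfin.lt_top).ne)
    · filter_upwards [ae_restrict_mem (hO.measurableSet.diff ht.isClosed.measurableSet)] with z hz
      rw [Real.norm_of_nonneg (sq_nonneg _)]
      have h1 : ‖fderiv ℝ φ z‖ = ‖vortexCurrent d x v z - current G z‖ := by
        rw [(hKt' z hz).hasFDerivAt.fderiv]
        exact (InnerProductSpace.toDual ℝ ℂ).norm_map _
      have h2 := hC₁ z (subset_closure ⟨hz.1, fun h => hz.2 (interior_subset (hKt h))⟩)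
      have h3 := norm_le_norm_sub_add (vortexCurrent d x v z) (current G z)
      rw [h1]
      nlinarith [norm_nonneg (vortexCurrent d x v z), norm_nonneg (current G z),
        norm_nonneg (vortexCurrent d x v z - current G z),
        sq_nonneg (‖vortexCurrent d x v z - current G z‖ - C₁)]
  have hB : IntegrableOn (fun z => ‖vortexCurrent d x v z‖ ^ 2) (t \ ⋃ j, ball (x j) ρ) := by
    refine ContinuousOn.integrableOn_compact (ht.diff (isOpen_iUnion fun _ => isOpen_ball))
      ((hJc.norm.pow 2).mono fun z hz => ⟨htΩ hz.1, ?_⟩)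
    rintro ⟨j, rfl⟩
    exact hz.2 (mem_iUnion.2 ⟨j, mem_ball_self hρ⟩)
  refine (hA.union hB).mono_set fun z hz => ?_
  by_cases h : z ∈ t
  · exact Or.inr ⟨h, hz.2⟩
  · exact Or.inl ⟨hz.1, h⟩

theorem dirichletDensity_eq_norm_vortexCurrent_sq (hΩ : IsOpen Ω) (hv : IsHarmonicCircleMap Ω v)
    (hu : ∀ z ∈ Ω \ singularPoints x, u z = vortexPhase d x z * v z) {z : ℂ}
    (hz : z ∈ Ω \ singularPoints x) : dirichletDensity u z = ‖vortexCurrent d x v z‖ ^ 2 :=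
  (hasCurrent_of_eqOn hΩ hv hu hz).dirichletDensity_eq

end CanonicalField

/-! ### Existence of the limit defining the renormalised energy -/

section RenormalisedEnergy

open Complex Metric Filter
open scoped ComplexConjugate Manifold

variable {n : ℕ} {d : Fin n → ℤ} {x : Config n} {Ω : Set ℂ} {u v g : ℂ → ℂ}

theorem tendsto_setIntegral_perforated (hΩ : IsOpen Ω) (x : Config n) {f : ℂ → ℝ}
    (hf : IntegrableOn f Ω) :
    Tendsto (fun ρ => ∫ z in perforated Ω x ρ, f z) (𝓝[>] 0) (𝓝 (∫ z in Ω, f z)) := by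
  have h1 : ∀ ρ, ∫ z in perforated Ω x ρ, f z = ∫ z in Ω, (perforated Ω x ρ).indicator f z := by
    intro ρ
    rw [setIntegral_indicator (measurableSet_perforated hΩ x ρ),
      inter_eq_self_of_subset_right (show perforated Ω x ρ ⊆ Ω from sdiff_subset)]
  simp_rw [h1]
  refine tendsto_integral_filter_of_dominated_convergence (fun z => ‖f z‖) ?_ ?_ hf.norm ?_
  · exact Eventually.of_forall fun ρ =>
      hf.aestronglyMeasurable.indicator (measurableSet_perforated hΩ x ρ)
  · exact Eventually.of_forall fun ρ => Eventually.of_forall fun z => norm_indicator_le_norm_self _ _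
  · have h2 : ∀ᵐ z ∂(volume.restrict Ω), z ∉ singularPoints x :=
      ae_restrict_of_ae ((finite_singularPoints x).countable.ae_notMem volume)
    filter_upwards [h2, ae_restrict_mem hΩ.measurableSet] with z hz hzΩ
    refine tendsto_const_nhds.congr' ?_
    have h3 : ∀ᶠ ρ in 𝓝[>] (0 : ℝ), ∀ j, ρ < dist z (x j) := by
      rw [eventually_all]
      intro j
      refine nhdsWithin_le_nhds (gt_mem_nhds ?_)
      exact dist_pos.2 (ne_of_notMem_singularPoints hz j)
    filter_upwards [h3] with ρ hρ
    rw [indicator_of_mem]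
    refine ⟨hzΩ, fun h => ?_⟩
    obtain ⟨j, hj⟩ := mem_iUnion.1 h
    exact lt_asymm (hρ j) hj

theorem integrableOn_annulus_inv_sq (a : ℂ) {ρ δ : ℝ} (hρ : 0 < ρ) :
    IntegrableOn (fun z => (‖z - a‖ ^ 2)⁻¹) (ball a δ \ ball a ρ) := by
  refine IntegrableOn.mono_set (t := closedBall a δ \ ball a ρ) ?_
    (sdiff_subset_sdiff_left ball_subset_closedBall)
  refine ContinuousOn.integrableOn_compact ((isCompact_closedBall a δ).diff isOpen_ball) ?_
  refine ContinuousOn.inv₀ (by fun_prop) fun z hz => ?_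
  have : z ≠ a := fun h => hz.2 (by simp [h, hρ])
  have := norm_pos_iff.2 (sub_ne_zero.2 this)
  positivity

theorem integral_annulus_inv_sq (a : ℂ) {ρ δ : ℝ} (hρ : 0 < ρ) (hδ : ρ ≤ δ) :
    ∫ z in ball a δ \ ball a ρ, (‖z - a‖ ^ 2)⁻¹ = 2 * Real.pi * Real.log (δ / ρ) := by
  have h1 : ∫ z in ball a δ \ ball a ρ, (‖z - a‖ ^ 2)⁻¹ =
      ∫ z, (Ico ρ δ).indicator (fun r => (r ^ 2)⁻¹) ‖z - a‖ := by
    rw [← integral_indicator (measurableSet_ball.diff measurableSet_ball)]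
    congr 1; ext z
    by_cases h : ‖z - a‖ ∈ Ico ρ δ
    · rw [indicator_of_mem h, indicator_of_mem]
      simpa [dist_eq_norm, and_comm] using h
    · rw [indicator_of_notMem h, indicator_of_notMem]
      simpa [dist_eq_norm, and_comm] using h
  rw [h1, integral_sub_right_eq_self (fun z => (Ico ρ δ).indicator (fun r => (r ^ 2)⁻¹) ‖z‖) a,
    integral_fun_norm_addHaar volume ((Ico ρ δ).indicator (fun r => (r ^ 2)⁻¹))]
  have h2 : ∫ y in Ioi (0 : ℝ), y ^ (Module.finrank ℝ ℂ - 1) •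
      (Ico ρ δ).indicator (fun r => (r ^ 2)⁻¹) y = ∫ y in ρ..δ, y⁻¹ := by
    rw [intervalIntegral.integral_of_le hδ, ← integral_Ico_eq_integral_Ioc,
      ← integral_indicator measurableSet_Ico, ← integral_indicator measurableSet_Ioi]
    congr 1; ext y
    by_cases h : y ∈ Ico ρ δ
    · have hy : 0 < y := hρ.trans_le h.1
      rw [indicator_of_mem h, indicator_of_mem (show y ∈ Ioi (0 : ℝ) from hy), indicator_of_mem h]
      simp; field_simp
    · rw [indicator_of_notMem h, indicator_apply_eq_zero]
      intro _; simp [indicator_of_notMem h]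
  rw [h2, integral_inv_of_pos hρ (hρ.trans_le hδ)]
  have h3 : volume.real (ball (0 : ℂ) 1) = Real.pi := by
    simp [Measure.real, Complex.volume_ball]
  rw [h3]; simp; ring

/-- The part of the current which is regular at the `j`-th singularity. -/
noncomputable def regularCurrent {n : ℕ} (d : Fin n → ℤ) (x : Config n) (v : ℂ → ℂ) (j : Fin n)
    (z : ℂ) : ℂ :=
  ∑ l ∈ Finset.univ.erase j, (d l : ℂ) * angularField (x l) z + current v z

theorem vortexCurrent_eq_add_regularCurrent (j : Fin n) (z : ℂ) :
    vortexCurrent d x v z = d j * angularField (x j) z + regularCurrent d x v j z := by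
  rw [vortexCurrent, regularCurrent, ← Finset.add_sum_erase _ _ (Finset.mem_univ j), add_assoc]

/-- The poles at the other singularities lie outside `s`, and the pole at `x j` has been removed. -/
theorem differentiableOn_conj_regularCurrent (hΩ : IsOpen Ω) (hv : IsHarmonicCircleMap Ω v)
    (j : Fin n) {s : Set ℂ} (hs : s ⊆ Ω) (hsx : ∀ l, l ≠ j → x l ∉ s) :
    DifferentiableOn ℂ (fun z => conj (regularCurrent d x v j z)) s := by
  have e : ∀ z, conj (regularCurrent d x v j z) =
      ∑ l ∈ Finset.univ.erase j, (d l : ℂ) * (-I / (z - x l)) + conj (current v z) := by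
    intro z
    rw [regularCurrent, map_add, map_sum]
    simp only [map_mul, conj_angularField, map_intCast]
  simp_rw [e]
  refine DifferentiableOn.add (DifferentiableOn.fun_sum fun l hl => ?_)
    ((hv.differentiableOn_conj_current hΩ).mono hs)
  refine DifferentiableOn.const_mul (DifferentiableOn.div (by fun_prop) (by fun_prop) ?_) _
  intro z hz h
  exact hsx l (Finset.ne_of_mem_erase hl) (by rwa [← sub_eq_zero.1 h])

theorem exists_radius (hΩ : IsOpen Ω) (hx : x ∈ configSpace Ω n) :
    ∃ R > 0, (∀ j, closedBall (x j) R ⊆ Ω) ∧ ∀ j l, l ≠ j → 2 * R < dist (x l) (x j) := by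
  have h1 : ∀ᶠ R in 𝓝[>] (0 : ℝ), ∀ j, closedBall (x j) R ⊆ Ω := by
    rw [eventually_all]
    intro j
    obtain ⟨ε, hε, h⟩ := Metric.isOpen_iff.1 hΩ _ (hx.1 j)
    filter_upwards [nhdsWithin_le_nhds (gt_mem_nhds hε)] with R hR
    exact (closedBall_subset_ball hR).trans h
  have h2 : ∀ᶠ R in 𝓝[>] (0 : ℝ), ∀ j l, l ≠ j → 2 * R < dist (x l) (x j) := by
    simp only [eventually_all]
    intro j l hl
    have h0 : (0 : ℝ) < dist (x l) (x j) / 2 := half_pos (dist_pos.2 fun h => hl (hx.2 h))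
    filter_upwards [nhdsWithin_le_nhds (gt_mem_nhds h0)] with R hR
    linarith
  obtain ⟨R, ⟨h3, h4⟩, h5⟩ := ((h1.and h2).and self_mem_nhdsWithin).exists
  exact ⟨R, h5, h3, h4⟩

theorem notMem_closedBall_of_radius {R : ℝ} (hR : 0 < R)
    (hR2 : ∀ j l, l ≠ j → 2 * R < dist (x l) (x j))
    {j l : Fin n} (hl : l ≠ j) : x l ∉ closedBall (x j) R := by
  intro h
  have h1 := hR2 j l hl
  have h2 := mem_closedBall.1 h
  linarith

theorem notMem_ball_of_mem_closedBall {R : ℝ} (hR2 : ∀ j l, l ≠ j → 2 * R < dist (x l) (x j))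
    {j l : Fin n} (hl : l ≠ j) {z : ℂ} (hz : z ∈ closedBall (x j) R) : z ∉ closedBall (x l) R := by
  intro h
  have h1 := hR2 j l hl
  have h2 := mem_closedBall'.1 h
  have h3 := mem_closedBall.1 hz
  linarith [dist_triangle (x l) z (x j)]

/-- In the disc at `x_j` the density is `d_j² / |z - x_j|²` plus a cross term `O(1 / |z - x_j|)`
plus a bounded term. Subtracting the explicit singular part in each disc leaves an integrable
function, and the singular part integrates to `2π d_j² log (R / ρ)` over the annulus. -/
theorem exists_tendsto_truncatedEnergy (hΩ : IsSmoothBoundedDomain Ω)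
    (hg : IsSmoothBoundaryDatum Ω g) (hx : x ∈ configSpace Ω n) (hv : IsHarmonicCircleMap Ω v)
    (hu : ∀ z ∈ Ω \ singularPoints x, u z = vortexPhase d x z * v z)
    (hub : HasBoundaryValues Ω x g u) :
    ∃ L, Tendsto (truncatedEnergy Ω d u x) (𝓝[>] 0) (𝓝 L) := by
  have hO := hΩ.isOpen
  obtain ⟨R, hR, hRΩ, hR2⟩ := exists_radius hO hx
  let h : Fin n → ℂ → ℝ := fun j z => (ball (x j) R).indicator
    (fun z => (d j : ℝ) ^ 2 * (‖z - x j‖ ^ 2)⁻¹) z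
  let E : ℂ → ℝ := fun z => ‖vortexCurrent d x v z‖ ^ 2 - ∑ j, h j z
  have hJm := (aestronglyMeasurable_vortexCurrent (d := d) (x := x) hO hv).norm.pow 2
  have hhm : ∀ j, Measurable (h j) := fun j =>
    Measurable.indicator (by fun_prop) measurableSet_ball
  have hEm : AEStronglyMeasurable E (volume.restrict Ω) :=
    hJm.sub (Finset.measurable_fun_sum _ fun j _ => hhm j).aestronglyMeasurable
  have hE1 : IntegrableOn E (perforated Ω x R) := by
    refine (integrableOn_norm_vortexCurrent_sq hΩ hg hx hv hu hub hR).congr_fun (fun z hz => ?_)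
      (measurableSet_perforated hO x R)
    have : ∑ j, h j z = 0 := Finset.sum_eq_zero fun j _ =>
      indicator_of_notMem (fun hj => hz.2 (mem_iUnion.2 ⟨j, hj⟩)) _
    simp [E, this]
  have hE2 : ∀ j, IntegrableOn E (ball (x j) R) := by
    intro j
    have hcont : ContinuousOn (regularCurrent d x v j) (closedBall (x j) R) := by
      have h1 := (differentiableOn_conj_regularCurrent (d := d) (x := x) hO hv j (hRΩ j)
        fun l hl => notMem_closedBall_of_radius hR hR2 hl).continuousOn
      have h2 := continuous_conj.comp_continuousOn h1
      exact h2.congr fun z _ => by simp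
    obtain ⟨M, hM⟩ := (isCompact_closedBall (x j) R).exists_bound_of_continuousOn hcont
    have hsub : ball (x j) R ⊆ Ω := ball_subset_closedBall.trans (hRΩ j)
    refine Integrable.mono' (g := fun z => 2 * |(d j : ℝ)| * M * ‖z - x j‖⁻¹ + M ^ 2) ?_
      (hEm.mono_measure (Measure.restrict_mono hsub le_rfl)) ?_
    · exact ((integrableOn_inv_norm_sub (x j) isBounded_ball).const_mul _).add
        (integrableOn_const measure_ball_lt_top.ne)
    · filter_upwards [ae_restrict_mem measurableSet_ball] with z hz
      have h1 : ∑ l, h l z = (d j : ℝ) ^ 2 * (‖z - x j‖ ^ 2)⁻¹ := by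
        rw [Finset.sum_eq_single j]
        · exact indicator_of_mem hz _
        · intro l _ hl
          refine indicator_of_notMem (fun h => ?_) _
          exact notMem_ball_of_mem_closedBall hR2 hl (ball_subset_closedBall hz)
            (ball_subset_closedBall h)
        · simp
      have h2 : ‖(d j : ℂ) * angularField (x j) z‖ = |(d j : ℝ)| * ‖z - x j‖⁻¹ := by
        rw [norm_mul, norm_angularField, Complex.norm_intCast]
      simp only [E, h1]
      rw [vortexCurrent_eq_add_regularCurrent j, norm_add_sq_real, h2, mul_pow, sq_abs, inv_pow,
        add_assoc, add_sub_cancel_left]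
      have h3 := hM z (ball_subset_closedBall hz)
      have h4 := abs_real_inner_le_norm ((d j : ℂ) * angularField (x j) z) (regularCurrent d x v j z)
      rw [h2] at h4
      have h5 : |(d j : ℝ)| * ‖z - x j‖⁻¹ * ‖regularCurrent d x v j z‖ ≤
        |(d j : ℝ)| * ‖z - x j‖⁻¹ * M := by gcongr
      rw [Real.norm_eq_abs]
      refine (abs_add_le _ _).trans (add_le_add ?_ ?_)
      · rw [abs_mul, abs_two]; nlinarith
      · rw [abs_of_nonneg (sq_nonneg _)]; gcongr
  have hE : IntegrableOn E Ω := by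
    refine (hE1.union ((integrableOn_finite_iUnion).2 hE2)).mono_set fun z hz => ?_
    by_cases h : z ∈ ⋃ j, ball (x j) R
    · exact Or.inr h
    · exact Or.inl ⟨hz, h⟩
  -- The extra term is what is left of `2π d_j² log (R / ρ)` after removing `2π d_j² log (1 / ρ)`.
  refine ⟨(∫ z in Ω, E z) + 2 * Real.pi * ∑ j, (d j : ℝ) ^ 2 * Real.log R, ?_⟩
  refine ((tendsto_setIntegral_perforated hO x hE).add_const _).congr' ?_
  have hpos : ∀ᶠ ρ in 𝓝[>] (0 : ℝ), ρ < R := nhdsWithin_le_nhds (gt_mem_nhds hR)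
  filter_upwards [hpos, self_mem_nhdsWithin] with ρ hρR hρ
  have hρ0 : 0 < ρ := hρ
  have hPm := measurableSet_perforated hO x ρ
  have hinter : ∀ j, perforated Ω x ρ ∩ ball (x j) R = ball (x j) R \ ball (x j) ρ := by
    intro j
    ext z
    constructor
    · exact fun hz => ⟨hz.2, fun h => hz.1.2 (mem_iUnion.2 ⟨j, h⟩)⟩
    · refine fun hz => ⟨⟨hRΩ j (ball_subset_closedBall hz.1), fun h => ?_⟩, hz.1⟩
      obtain ⟨l, hl⟩ := mem_iUnion.1 h
      by_cases hlj : l = j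
      · exact hz.2 (hlj ▸ hl)
      · exact notMem_ball_of_mem_closedBall hR2 hlj (ball_subset_closedBall hz.1)
          (ball_subset_closedBall (ball_subset_ball hρR.le hl))
  have hint : ∀ j, IntegrableOn (h j) (perforated Ω x ρ) := by
    intro j
    have : IntegrableOn (fun z => (d j : ℝ) ^ 2 * (‖z - x j‖ ^ 2)⁻¹) (ball (x j) R ∩ perforated Ω x ρ) := by
      rw [inter_comm, hinter]
      exact (integrableOn_annulus_inv_sq (x j) hρ0).const_mul _
    rwa [IntegrableOn, integrable_indicator_iff measurableSet_ball, IntegrableOn,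
      Measure.restrict_restrict measurableSet_ball]
  have hval : ∀ j, ∫ z in perforated Ω x ρ, h j z =
      (d j : ℝ) ^ 2 * (2 * Real.pi * Real.log (R / ρ)) := by
    intro j
    rw [setIntegral_indicator measurableSet_ball, hinter, integral_const_mul,
      integral_annulus_inv_sq (x j) hρ0 hρR.le]
  have hdir : ∫ z in perforated Ω x ρ, dirichletDensity u z =
      ∫ z in perforated Ω x ρ, (E z + ∑ j, h j z) := by
    refine setIntegral_congr_fun hPm fun z hz => ?_
    rw [dirichletDensity_eq_norm_vortexCurrent_sq hO hv hu
      ⟨hz.1, notMem_singularPoints_of_mem_perforated hρ0 hz⟩]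
    simp [E]
  have hEρ : IntegrableOn E (perforated Ω x ρ) := hE.mono_set sdiff_subset
  rw [truncatedEnergy, hdir, integral_add hEρ
    (integrable_finsetSum _ fun j _ => hint j), integral_finsetSum _ fun j _ => hint j]
  simp_rw [hval, Real.log_div hR.ne' hρ0.ne', one_div, Real.log_inv]
  rw [add_sub_assoc, Finset.mul_sum, Finset.mul_sum, ← Finset.sum_sub_distrib]
  congr 1
  refine Finset.sum_congr rfl fun j _ => ?_
  ring

theorem tendsto_renormalisedEnergy (hΩ : IsSmoothBoundedDomain Ω)
    (hg : IsSmoothBoundaryDatum Ω g) (hx : x ∈ configSpace Ω n) (hv : IsHarmonicCircleMap Ω v)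
    {u : Config n → ℂ → ℂ} (hu : ∀ z ∈ Ω \ singularPoints x, u x z = vortexPhase d x z * v z)
    (hub : HasBoundaryValues Ω x g (u x)) :
    Tendsto (truncatedEnergy Ω d (u x) x) (𝓝[>] 0) (𝓝 (renormalisedEnergy Ω d u x)) :=
  tendsto_nhds_limUnder (exists_tendsto_truncatedEnergy hΩ hg hx hv hu hub)

theorem integrableOn_dirichletDensity (hΩ : IsSmoothBoundedDomain Ω)
    (hg : IsSmoothBoundaryDatum Ω g) (hx : x ∈ configSpace Ω n) (hv : IsHarmonicCircleMap Ω v)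
    (hu : ∀ z ∈ Ω \ singularPoints x, u z = vortexPhase d x z * v z)
    (hub : HasBoundaryValues Ω x g u) {ρ : ℝ} (hρ : 0 < ρ) :
    IntegrableOn (dirichletDensity u) (perforated Ω x ρ) :=
  (integrableOn_norm_vortexCurrent_sq hΩ hg hx hv hu hub hρ).congr_fun (fun _ hz =>
    (dirichletDensity_eq_norm_vortexCurrent_sq hΩ.isOpen hv hu
      ⟨hz.1, notMem_singularPoints_of_mem_perforated hρ hz⟩).symm)
    (measurableSet_perforated hΩ.isOpen x ρ)

end RenormalisedEnergy

/-! ### A maximum principle for circle-valued harmonic maps on a rectangle -/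

section BoxMaximumPrinciple

open Complex Metric Filter
open scoped ComplexConjugate

/-- On a disc the holomorphic function `conj c` has a primitive `f`, and the gradient of `Re f` is
the conjugate of `f'`. -/
theorem exists_hasGradientAt_re {c : ℂ → ℂ} {a : ℂ} {r : ℝ}
    (hc : DifferentiableOn ℂ (fun z => conj (c z)) (ball a r)) :
    ∃ f : ℂ → ℂ, DifferentiableOn ℂ f (ball a r) ∧
      ∀ z ∈ ball a r, HasGradientAt (fun z => (f z).re) (c z) z := by
  obtain ⟨f, hf⟩ := hc.isExactOn_ball
  refine ⟨f, fun z hz => (hf z hz).differentiableAt.differentiableWithinAt, fun z hz => ?_⟩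
  rw [hasGradientAt_iff_hasFDerivAt]
  refine (reCLM.hasFDerivAt.comp z ((hf z hz).hasFDerivAt.restrictScalars ℝ)).congr_fderiv ?_
  apply clm_ext_complex <;> simp

theorem eqOn_add_const_of_hasGradientAt {f g : ℂ → ℝ} {c : ℂ → ℂ} {a : ℂ} {r : ℝ}
    (hf : ∀ z ∈ ball a r, HasGradientAt f (c z) z) (hg : ∀ z ∈ ball a r, HasGradientAt g (c z) z) :
    ∀ z ∈ ball a r, f z = g z + (f a - g a) := by
  intro z hz
  have hr : 0 < r := (dist_nonneg.trans_lt hz)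
  have h1 : ∀ w ∈ ball a r, HasFDerivWithinAt (fun z => f z - g z) (0 : ℂ →L[ℝ] ℝ) (ball a r) w :=
    fun w hw => by
      have := ((hf w hw).hasFDerivAt.sub (hg w hw).hasFDerivAt).hasFDerivWithinAt (s := ball a r)
      rw [sub_self] at this
      exact this
  have h2 := (convex_ball a r).norm_image_sub_le_of_norm_hasFDerivWithin_le (C := 0) h1
    (by simp) (mem_ball_self hr) hz
  simp only [zero_mul, norm_le_zero_iff] at h2
  linarith

/-- A circle-valued map on a convex compact rectangle lifts to a phase. -/
theorem exists_lift_of_rect {a0 a1 b0 b1 : ℝ} (ha : a0 ≤ a1) (hb : b0 ≤ b1) {G : ℂ → ℂ}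
    (hG : ContinuousOn G (Icc a0 a1 ×ℂ Icc b0 b1)) (hG1 : ∀ z ∈ Icc a0 a1 ×ℂ Icc b0 b1, ‖G z‖ = 1)
    {p : ℂ} (hp : p ∈ Icc a0 a1 ×ℂ Icc b0 b1) (hGp : G p = 1) :
    ∃ ψ : ℂ → ℝ, ContinuousOn ψ (Icc a0 a1 ×ℂ Icc b0 b1) ∧ ψ p = 0 ∧
      ∀ z ∈ Icc a0 a1 ×ℂ Icc b0 b1, G z = exp (ψ z * I) := by
  -- Precomposition with the retraction onto the rectangle gives a map defined on the simply
  -- connected plane, where the covering `ℝ → 𝕊¹` provides a lift.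
  let π : ℂ → ℂ := fun z => (max a0 (min a1 z.re) : ℝ) + (max b0 (min b1 z.im) : ℝ) * I
  have hπm : ∀ z, π z ∈ Icc a0 a1 ×ℂ Icc b0 b1 := by
    intro z
    rw [mem_reProdIm]
    simp [π, ha, hb]
  have hπ : Continuous π := by fun_prop
  have hπe : ∀ z ∈ Icc a0 a1 ×ℂ Icc b0 b1, π z = z := by
    intro z hz
    rw [mem_reProdIm] at hz
    apply Complex.ext <;> simp [π, hz.1.1, hz.1.2, hz.2.1, hz.2.2]
  have hc : Continuous fun z => G (π z) := hG.comp_continuous hπ hπm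
  have hsph : ∀ z, G (π z) ∈ Submonoid.unitSphere ℂ := fun z =>
    mem_sphere_zero_iff_norm.2 (hG1 _ (hπm z))
  let F : C(ℂ, Circle) := ⟨fun z => ⟨G (π z), hsph z⟩, hc.subtype_mk hsph⟩
  obtain ⟨ψ, ⟨h0, h1⟩, -⟩ := Circle.isCoveringMap_exp.existsUnique_continuousMap_lifts F p 0 (by
    ext; change ((Circle.exp 0 : Circle) : ℂ) = G (π p); rw [hπe p hp, hGp]; simp)
  refine ⟨ψ, ψ.continuous.continuousOn, h0, fun z hz => ?_⟩
  have h2 := congrArg (fun c : Circle => (c : ℂ)) (congrFun h1 z)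
  simp only [Function.comp_apply, Circle.coe_exp] at h2
  rw [h2]
  change G z = G (π z)
  rw [hπe z hz]

/-- A circle-valued harmonic map on a subgraph `D` inside a rectangle, equal to `1` off `D` and
with positive real part on the sides, has positive real part. -/
theorem re_pos_of_rect {a0 a1 b0 b1 : ℝ} (ha : a0 ≤ a1) (hb : b0 ≤ b1) {D : Set ℂ} (hD : IsOpen D)
    {G c : ℂ → ℂ} (hG : ContinuousOn G (Icc a0 a1 ×ℂ Icc b0 b1))
    (hG1 : ∀ z ∈ Icc a0 a1 ×ℂ Icc b0 b1, z ∉ D → G z = 1)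
    (hcur : ∀ z ∈ Icc a0 a1 ×ℂ Icc b0 b1, z ∈ D → HasCurrent G z (c z))
    (hc : DifferentiableOn ℂ (fun z => conj (c z)) (D ∩ Icc a0 a1 ×ℂ Icc b0 b1))
    (htop : ∀ z ∈ Icc a0 a1 ×ℂ Icc b0 b1, z.re = a1 → z ∉ D)
    (hmono : ∀ z ∈ Icc a0 a1 ×ℂ Icc b0 b1, z ∉ D → ∀ w ∈ Icc a0 a1 ×ℂ Icc b0 b1,
      w.im = z.im → z.re ≤ w.re → w ∉ D)
    (hS : ∀ z ∈ Icc a0 a1 ×ℂ Icc b0 b1, z.re = a0 ∨ z.im = b0 ∨ z.im = b1 → 0 < (G z).re)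
    {z : ℂ} (hz : z ∈ Icc a0 a1 ×ℂ Icc b0 b1) : 0 < (G z).re := by
  set R := Icc a0 a1 ×ℂ Icc b0 b1 with hR
  have hmem : ∀ {a b : ℝ}, (a0 ≤ a ∧ a ≤ a1) → (b0 ≤ b ∧ b ≤ b1) → (⟨a, b⟩ : ℂ) ∈ R := by
    intro a b h1 h2; rw [hR, mem_reProdIm]; exact ⟨h1, h2⟩
  have hRmem : ∀ {w : ℂ}, w ∈ R → (a0 ≤ w.re ∧ w.re ≤ a1) ∧ (b0 ≤ w.im ∧ w.im ≤ b1) := by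
    intro w hw; rw [hR, mem_reProdIm] at hw; exact hw
  have hn : ∀ w ∈ R, ‖G w‖ = 1 := by
    intro w hw
    by_cases h : w ∈ D
    · exact (hcur w hw h).1
    · rw [hG1 w hw h, norm_one]
  have hp : (⟨a1, b0⟩ : ℂ) ∈ R := hmem ⟨ha, le_rfl⟩ ⟨le_rfl, hb⟩
  obtain ⟨ψ, hψ, hψp, hGψ⟩ := exists_lift_of_rect ha hb hG hn hp (hG1 _ hp (htop _ hp rfl))
  have hcos : ∀ w ∈ R, (G w).re = Real.cos (ψ w) := fun w hw => by
    rw [hGψ w hw, exp_ofReal_mul_I_re]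
  -- Along a segment where `Re G = cos ψ > 0` the continuous phase cannot cross `±π / 2`. This
  -- propagates `|ψ| < π / 2` from the corner `p`, where `ψ = 0`, to the four sides and to the
  -- complement of `D`.
  have hseg : ∀ w w' : ℂ, segment ℝ w w' ⊆ R → (∀ t ∈ segment ℝ w w', 0 < (G t).re) →
      |ψ w| < Real.pi / 2 → |ψ w'| < Real.pi / 2 := by
    intro w w' hsub hpos hw
    by_contra h
    have hpre := (convex_segment (𝕜 := ℝ) w w').isPreconnected
    have hc' := hψ.mono hsub
    rw [abs_lt] at hw
    rw [abs_lt, not_and_or, not_lt, not_lt] at h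
    rcases h with h | h
    · obtain ⟨t, ht, hte⟩ := hpre.intermediate_value (right_mem_segment ℝ w w')
        (left_mem_segment ℝ w w') hc' ⟨h, hw.1.le⟩
      have := hpos t ht
      rw [hcos t (hsub ht), hte, Real.cos_neg, Real.cos_pi_div_two] at this
      exact lt_irrefl _ this
    · obtain ⟨t, ht, hte⟩ := hpre.intermediate_value (left_mem_segment ℝ w w')
        (right_mem_segment ℝ w w') hc' ⟨hw.2.le, h⟩
      have := hpos t ht
      rw [hcos t (hsub ht), hte, Real.cos_pi_div_two] at this
      exact lt_irrefl _ this
  have hRconv : Convex ℝ R := 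
    ((convex_Icc a0 a1).linear_preimage reCLM.toLinearMap).inter
      ((convex_Icc b0 b1).linear_preimage imCLM.toLinearMap)
  have hre : ∀ w w' t : ℂ, t ∈ segment ℝ w w' → w.re = w'.re → t.re = w.re := by
    rintro w w' t ⟨x, y, hx, hy, hxy, rfl⟩ h
    simp [← h]; rw [← add_mul, hxy, one_mul]
  have him : ∀ w w' t : ℂ, t ∈ segment ℝ w w' → w.im = w'.im → t.im = w.im := by
    rintro w w' t ⟨x, y, hx, hy, hxy, rfl⟩ h
    simp [← h]; rw [← add_mul, hxy, one_mul]
  have hreI : ∀ w w' t : ℂ, t ∈ segment ℝ w w' → w'.re ≤ w.re → w'.re ≤ t.re := by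
    rintro w w' t ⟨x, y, hx, hy, hxy, rfl⟩ h
    simp
    obtain rfl : x = 1 - y := by linarith
    nlinarith [mul_nonneg hx (sub_nonneg.2 h)]
  have hG1' : ∀ w ∈ R, w ∉ D → 0 < (G w).re := fun w hw h => by rw [hG1 w hw h]; simp
  have htop' : ∀ w ∈ R, w.re = a1 → |ψ w| < Real.pi / 2 := by
    intro w hw h
    have hsub := hRconv.segment_subset hp hw
    refine hseg _ w hsub (fun t ht => ?_) (by rw [hψp, abs_zero]; positivity)
    refine hG1' t (hsub ht) (htop t (hsub ht) ?_)
    exact hre _ _ t ht h.symm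
  have hside : ∀ w ∈ R, w.im = b0 ∨ w.im = b1 → |ψ w| < Real.pi / 2 := by
    intro w hw h
    have hq : (⟨a1, w.im⟩ : ℂ) ∈ R := hmem ⟨ha, le_rfl⟩ (hRmem hw).2
    have hsub := hRconv.segment_subset hq hw
    refine hseg _ w hsub (fun t ht => ?_) (htop' _ hq rfl)
    have h1 : t.im = w.im := him ⟨a1, w.im⟩ w t ht rfl
    exact hS t (hsub ht) (Or.inr (by rwa [h1]))
  have hbot : ∀ w ∈ R, w.re = a0 → |ψ w| < Real.pi / 2 := by
    intro w hw h
    have hq : (⟨a0, b0⟩ : ℂ) ∈ R := hmem ⟨le_rfl, ha⟩ ⟨le_rfl, hb⟩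
    have hsub := hRconv.segment_subset hq hw
    refine hseg _ w hsub (fun t ht => ?_) (hside _ hq (Or.inl rfl))
    exact hS t (hsub ht) (Or.inl (hre _ _ t ht h.symm))
  -- As `D` is a subgraph in the real direction, the horizontal segment from `w` to the side `re =
  -- a1` stays outside `D`, where `G = 1`.
  have hout : ∀ w ∈ R, w ∉ D → |ψ w| < Real.pi / 2 := by
    intro w hw h
    have hq : (⟨a1, w.im⟩ : ℂ) ∈ R := hmem ⟨ha, le_rfl⟩ (hRmem hw).2
    have hsub := hRconv.segment_subset hq hw
    refine hseg _ w hsub (fun t ht => ?_) (htop' _ hq rfl)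
    exact hG1' t (hsub ht) (hmono w hw h t (hsub ht) (him ⟨a1, w.im⟩ w t ht rfl)
      (hreI _ _ t ht (hRmem hw).1.2))
  have hcomp : IsCompact R := isCompact_Icc.reProdIm isCompact_Icc
  -- A maximum principle, applied to both `ψ` and `-ψ`.
  have key : ∀ s : ℝ, s = 1 ∨ s = -1 → ∀ w ∈ R, s * ψ w < Real.pi / 2 := by
    intro s hs
    have hs1 : ∀ w, |s * ψ w| = |ψ w| := by
      rcases hs with rfl | rfl <;> simp
    have hsc : ContinuousOn (fun w => s * ψ w) R := continuousOn_const.mul hψ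
    obtain ⟨m, hm, hmax⟩ := hcomp.exists_isMaxOn ⟨_, hp⟩ hsc
    by_contra! hcon
    obtain ⟨w₁, hw₁, hw₁'⟩ := hcon
    have hM : Real.pi / 2 ≤ s * ψ m := hw₁'.trans (hmax hw₁)
    have hclosed : IsCompact (R ∩ (fun w => s * ψ w) ⁻¹' {s * ψ m}) := by
      refine hcomp.of_isClosed_subset ?_ inter_subset_left
      exact hsc.preimage_isClosed_of_isClosed hcomp.isClosed isClosed_singleton
    -- Among the maximum points take one with the largest real part. If the maximum is at least `π /
    -- 2`, this point is interior to `R` and to `D`, and local constancy there will produce a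
    -- maximum point further to the right.
    obtain ⟨q, ⟨hqR, hq⟩, hqmax⟩ := hclosed.exists_isMaxOn ⟨m, hm, rfl⟩ continuous_re.continuousOn
    have hq : s * ψ q = s * ψ m := hq
    have hnot : ¬ |ψ q| < Real.pi / 2 := by
      rw [← hs1, hq, not_lt]; exact hM.trans (le_abs_self _)
    have hqD : q ∈ D := by by_contra h; exact hnot (hout q hqR h)
    have hqint : q ∈ Ioo a0 a1 ×ℂ Ioo b0 b1 := by
      have h := hRmem hqR
      rw [mem_reProdIm]
      refine ⟨⟨lt_of_le_of_ne h.1.1 fun h' => hnot (hbot q hqR h'.symm),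
        lt_of_le_of_ne h.1.2 fun h' => hnot (htop' q hqR h')⟩,
        ⟨lt_of_le_of_ne h.2.1 fun h' => hnot (hside q hqR (Or.inl h'.symm)),
        lt_of_le_of_ne h.2.2 fun h' => hnot (hside q hqR (Or.inr h'))⟩⟩
    have hopen : IsOpen (Ioo a0 a1 ×ℂ Ioo b0 b1) := isOpen_Ioo.reProdIm isOpen_Ioo
    have hsubR : Ioo a0 a1 ×ℂ Ioo b0 b1 ⊆ R := by
      intro w hw
      rw [mem_reProdIm] at hw
      exact hmem ⟨hw.1.1.le, hw.1.2.le⟩ ⟨hw.2.1.le, hw.2.2.le⟩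
    have hψq : ContinuousAt ψ q := hψ.continuousAt (mem_of_superset (hopen.mem_nhds hqint) hsubR)
    have hnear : ∀ᶠ w in 𝓝 q, |ψ w - ψ q| < Real.pi / 2 := by
      have := Metric.continuousAt_iff'.1 hψq (Real.pi / 2) (by positivity)
      simpa [Real.dist_eq] using this
    have hin : ∀ᶠ w in 𝓝 q, w ∈ Ioo a0 a1 ×ℂ Ioo b0 b1 := hopen.mem_nhds hqint
    have hinD : ∀ᶠ w in 𝓝 q, w ∈ D := hD.mem_nhds hqD
    obtain ⟨r, hr, hball⟩ := Metric.eventually_nhds_iff_ball.1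
      (hnear.and (hin.and hinD))
    obtain ⟨f, hf, hfg⟩ := exists_hasGradientAt_re (c := c) (a := q) (r := r)
      (hc.mono fun w hw => ⟨(hball w hw).2.2, hsubR (hball w hw).2.1⟩)
    have hψg : ∀ w ∈ ball q r, HasGradientAt ψ (c w) w := by
      intro w hw
      have h1 : HasCurrent (fun t => G t * conj (G q)) w (c w) := by
        have := (hcur w (hsubR (hball w hw).2.1) (hball w hw).2.2).mul
          (HasCurrent.const (z := w) (w := conj (G q)) (by simp [hn q hqR]))
        simpa using this
      have harg : ∀ t ∈ ball q r, G t * conj (G q) = exp ((ψ t - ψ q : ℝ) * I) := by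
        intro t ht
        rw [hGψ t (hsubR (hball t ht).2.1), hGψ q hqR, ← exp_conj, ← Complex.exp_add]
        congr 1; simp; ring
      have hpi := Real.pi_pos
      have harg' : ∀ t ∈ ball q r, (G t * conj (G q)).arg = ψ t - ψ q := by
        intro t ht
        have h3 := abs_lt.1 (hball t ht).1
        rw [harg t ht, arg_exp_mul_I, toIocMod_eq_self]
        constructor <;> linarith
      have hslit : G w * conj (G q) ∈ slitPlane := by
        left
        rw [harg w hw, exp_ofReal_mul_I_re]
        have h3 := abs_lt.1 (hball w hw).1
        exact Real.cos_pos_of_mem_Ioo ⟨by linarith, by linarith⟩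
      have h4 : HasGradientAt (fun t => (G t * conj (G q)).arg + ψ q) (c w) w := by
        have := h1.hasGradientAt_arg hslit
        rw [hasGradientAt_iff_hasFDerivAt] at this ⊢
        exact this.add_const _
      refine h4.congr_of_eventuallyEq ?_
      filter_upwards [isOpen_ball.mem_nhds hw] with t ht
      rw [harg' t ht]; ring
    have heq := eqOn_add_const_of_hasGradientAt hψg hfg
    -- Near `q` the phase is `Re f` plus a constant, so a local maximum of `s ψ` is one of `|exp (s
    -- f)|`, and the maximum modulus principle applies.
    have hloc : IsLocalMax (norm ∘ fun w => exp (s * f w)) q := by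
      filter_upwards [ball_mem_nhds q hr] with w hw
      simp only [Function.comp_apply, norm_exp, re_ofReal_mul]
      refine Real.exp_le_exp.2 ?_
      have h1 : s * ψ w ≤ s * ψ m := hmax (hsubR (hball w hw).2.1)
      rw [← hq, heq w hw] at h1
      linarith
    have hdiff : ∀ᶠ w in 𝓝 q, DifferentiableAt ℂ (fun w => exp (s * f w)) w := by
      filter_upwards [ball_mem_nhds q hr] with w hw
      exact ((hf.differentiableAt (isOpen_ball.mem_nhds hw)).const_mul _).cexp
    have hconst := Complex.eventually_eq_of_isLocalMax_norm hdiff hloc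
    obtain ⟨r', hr', hr''⟩ := Metric.eventually_nhds_iff_ball.1 (hconst.and (ball_mem_nhds q hr))
    have hmem' : q + ((r' / 2 : ℝ) : ℂ) ∈ ball q r' := by
      simp [abs_of_pos hr']; linarith
    obtain ⟨h1, h2⟩ := hr'' _ hmem'
    have h3 := congrArg norm h1
    simp only [norm_exp, re_ofReal_mul, Real.exp_eq_exp] at h3
    have h4 : s * ψ (q + ((r' / 2 : ℝ) : ℂ)) = s * ψ m := by
      rw [heq _ h2, ← hq]; linarith
    have h5 := hqmax (show q + ((r' / 2 : ℝ) : ℂ) ∈ R ∩ (fun w => s * ψ w) ⁻¹' {s * ψ m} from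
      ⟨hsubR (hball _ h2).2.1, h4⟩)
    simp only [mem_ofPred_eq, add_re, ofReal_re] at h5
    linarith
  rw [hcos z hz]
  have h1 := key 1 (Or.inl rfl) z hz
  have h2 := key (-1) (Or.inr rfl) z hz
  exact Real.cos_pos_of_mem_Ioo ⟨by linarith, by linarith⟩

end BoxMaximumPrinciple

/-! ### Mean values on discs, and `L¹` convergence of the currents away from the singularities -/

section InteriorConvergence

open Complex Metric Filter
open scoped ComplexConjugate ENNReal

theorem integral_ball_eq_polar {E : Type*} [NormedAddCommGroup E] [NormedSpace ℝ E]
    {a : ℂ} {r : ℝ} (hr : 0 ≤ r) {f : ℂ → E} (hf : ContinuousOn f (closedBall a r)) :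
    ∫ z in ball a r, f z = ∫ s in 0..r, (2 * Real.pi * s) • Real.circleAverage f a s := by
  have h1 : ∫ z in ball a r, f z = ∫ z, (ball (0 : ℂ) r).indicator (fun w => f (a + w)) z := by
    rw [← integral_indicator measurableSet_ball,
      ← integral_add_left_eq_self ((ball a r).indicator f) a]
    congr 1; ext w
    by_cases h : w ∈ ball (0 : ℂ) r
    · rw [indicator_of_mem h, indicator_of_mem]; simpa using h
    · rw [indicator_of_notMem h, indicator_of_notMem]; simpa using h
  have hcm : ∀ p : ℝ × ℝ, a + Complex.polarCoord.symm p = circleMap a p.1 p.2 := by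
    intro p
    rw [Complex.polarCoord_symm_apply, circleMap, Complex.exp_mul_I]; simp
  have h2 : ∫ z, (ball (0 : ℂ) r).indicator (fun w => f (a + w)) z =
      ∫ p in Ioo 0 r ×ˢ Ioo (-Real.pi) Real.pi, p.1 • f (circleMap a p.1 p.2) := by
    rw [← Complex.integral_comp_polarCoord_symm,
      show polarCoord.target = Ioi (0 : ℝ) ×ˢ Ioo (-Real.pi) Real.pi from rfl,
      ← integral_indicator (measurableSet_Ioi.prod measurableSet_Ioo),
      ← integral_indicator (measurableSet_Ioo.prod measurableSet_Ioo)]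
    congr 1; ext p
    by_cases h : p ∈ Ioo 0 r ×ˢ Ioo (-Real.pi) Real.pi
    · rw [indicator_of_mem h, indicator_of_mem (show p ∈ Ioi (0 : ℝ) ×ˢ Ioo (-Real.pi) Real.pi from
        ⟨h.1.1, h.2⟩), indicator_of_mem, hcm]
      simpa [Complex.norm_polarCoord_symm, abs_of_pos h.1.1] using h.1.2
    · rw [indicator_of_notMem h, indicator_apply_eq_zero]
      intro h3
      rw [indicator_of_notMem, smul_zero]
      intro h4
      have h5 : |p.1| < r := by simpa [Complex.norm_polarCoord_symm] using h4
      rw [abs_of_pos h3.1] at h5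
      exact h ⟨⟨h3.1, h5⟩, h3.2⟩
  have hint : IntegrableOn (fun p : ℝ × ℝ => p.1 • f (circleMap a p.1 p.2))
      (Ioo 0 r ×ˢ Ioo (-Real.pi) Real.pi) := by
    refine IntegrableOn.mono_set (t := Icc 0 r ×ˢ Icc (-Real.pi) Real.pi) ?_
      (Set.prod_mono Ioo_subset_Icc_self Ioo_subset_Icc_self)
    refine ContinuousOn.integrableOn_compact (isCompact_Icc.prod isCompact_Icc) ?_
    refine continuousOn_fst.smul (hf.comp ?_ ?_)
    · unfold circleMap; fun_prop
    · intro p hp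
      simp [circleMap, dist_eq_norm, abs_of_nonneg hp.1.1, hp.1.2]
  rw [h1, h2, Measure.volume_eq_prod, setIntegral_prod _ hint, intervalIntegral.integral_of_le hr,
    integral_Ioc_eq_integral_Ioo]
  refine setIntegral_congr_fun measurableSet_Ioo fun s hs => ?_
  simp only
  rw [integral_smul, Real.circleAverage_def, smul_smul]
  have h3 : ∫ θ in Ioo (-Real.pi) Real.pi, f (circleMap a s θ) =
      ∫ θ in 0..2 * Real.pi, f (circleMap a s θ) := by
    rw [← integral_Ioc_eq_integral_Ioo, ← intervalIntegral.integral_of_le (by linarith [Real.pi_pos])]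
    have hper : Function.Periodic (fun θ => f (circleMap a s θ)) (2 * Real.pi) :=
      fun θ => by simp [periodic_circleMap a s θ]
    have := hper.intervalIntegral_add_eq (-Real.pi) 0
    rw [zero_add] at this
    rw [← this]; congr 1; ring
  rw [h3]
  congr 1
  have := Real.pi_pos
  field_simp

/-- The mean value property on discs. -/
theorem integral_ball_eq_of_differentiableOn {a : ℂ} {r : ℝ} (hr : 0 ≤ r) {h : ℂ → ℂ}
    (hc : ContinuousOn h (closedBall a r)) (hd : DifferentiableOn ℂ h (ball a r)) :
    ∫ z in ball a r, h z = (Real.pi * r ^ 2 : ℝ) * h a := by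
  rw [integral_ball_eq_polar hr hc]
  have h1 : ∫ s in 0..r, (2 * Real.pi * s) • Real.circleAverage h a s =
      ∫ s in 0..r, (2 * Real.pi * s) • h a := by
    refine intervalIntegral.integral_congr fun s hs => ?_
    rw [uIcc_of_le hr] at hs
    rw [circleAverage_of_differentiable_on_off_countable countable_empty]
    · exact hc.mono (closedBall_subset_closedBall (by rw [abs_of_nonneg hs.1]; exact hs.2))
    · intro z hz
      exact hd.differentiableAt (isOpen_ball.mem_nhds
        (ball_subset_ball (by rw [abs_of_nonneg hs.1]; exact hs.2) hz.1))
  rw [h1, intervalIntegral.integral_smul_const, intervalIntegral.integral_const_mul, integral_id,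
    real_smul]
  congr 2; ring

theorem norm_mul_le_integral_ball {a : ℂ} {r : ℝ} (hr : 0 ≤ r) {h : ℂ → ℂ}
    (hc : ContinuousOn h (closedBall a r)) (hd : DifferentiableOn ℂ h (ball a r)) :
    Real.pi * r ^ 2 * ‖h a‖ ≤ ∫ z in ball a r, ‖h z‖ := by
  have h1 := norm_integral_le_integral_norm (μ := volume.restrict (ball a r)) h
  rw [integral_ball_eq_of_differentiableOn hr hc hd, norm_mul, norm_real,
    Real.norm_of_nonneg (by positivity)] at h1
  exact h1

/-- A family of singular harmonic maps with a choice of their regular factors. -/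
structure IsVortexFamily (Ω : Set ℂ) (g : ℂ → ℂ) {n : ℕ} (d : Fin n → ℤ) (p : ℝ≥0∞)
    (U : Set (Config n)) (u v : Config n → ℂ → ℂ) : Prop where
  domain : IsSmoothBoundedDomain Ω
  datum : IsSmoothBoundaryDatum Ω g
  isOpen : IsOpen U
  subset : U ⊆ configSpace Ω n
  one_le : 1 ≤ p
  harmonic : ∀ y ∈ U, IsHarmonicCircleMap Ω (v y)
  eq_mul : ∀ y ∈ U, ∀ z ∈ Ω \ singularPoints y, u y z = vortexPhase d y z * v y z
  boundaryValues : ∀ y ∈ U, HasBoundaryValues Ω y g (u y)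
  sobolev : IsSobolevContinuousFamily Ω p U u

namespace IsVortexFamily

variable {Ω : Set ℂ} {g : ℂ → ℂ} {n : ℕ} {d : Fin n → ℤ} {p : ℝ≥0∞} {U : Set (Config n)}
  {u v : Config n → ℂ → ℂ} {x y : Config n}

theorem hasCurrent (h : IsVortexFamily Ω g d p U u v) (hy : y ∈ U) {z : ℂ}
    (hz : z ∈ Ω \ singularPoints y) : HasCurrent (u y) z (vortexCurrent d y (v y) z) :=
  hasCurrent_of_eqOn h.domain.isOpen (h.harmonic y hy) (h.eq_mul y hy) hz

theorem mem_nhds (h : IsVortexFamily Ω g d p U u v) (hx : x ∈ U) : U ∈ 𝓝 x := h.isOpen.mem_nhds hx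

theorem ae_notMem_singularPoints (y : Config n) (s : Set ℂ) :
    ∀ᵐ z ∂(volume.restrict s), z ∉ singularPoints y :=
  ae_restrict_of_ae ((finite_singularPoints y).countable.ae_notMem volume)

theorem aestronglyMeasurable (h : IsVortexFamily Ω g d p U u v) (hy : y ∈ U) :
    AEStronglyMeasurable (u y) (volume.restrict Ω) := by
  have hO := isOpen_diff_singularPoints h.domain.isOpen y
  have h1 : AEStronglyMeasurable (u y) (volume.restrict (Ω \ singularPoints y)) :=
    ((h.boundaryValues y hy).1.mono (sdiff_subset_sdiff_left subset_closure)).aestronglyMeasurable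
      hO.measurableSet
  rwa [Measure.restrict_congr_set] at h1
  exact sdiff_null_ae_eq_self ((finite_singularPoints y).measure_zero volume)

/-- Hölder's inequality on a set of finite measure; only `L¹` convergence is used afterwards. -/
theorem eventually_lintegral_le_of_tendsto_eLpNorm {E : Type*} [NormedAddCommGroup E]
    {s : Set ℂ} (hs : volume s ≠ ⊤) (hp : 1 ≤ p) {l : Filter (Config n)} {f : Config n → ℂ → E}
    (hm : ∀ᶠ y in l, AEStronglyMeasurable (f y) (volume.restrict s))
    (ht : Tendsto (fun y => eLpNorm (f y) p (volume.restrict s)) l (𝓝 0)) {ε : ℝ≥0∞} (hε : 0 < ε) :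
    ∀ᶠ y in l, ∫⁻ z in s, ‖f y z‖ₑ ≤ ε := by
  have hC : (volume.restrict s) univ ^ (1 / (1 : ℝ≥0∞).toReal - 1 / p.toReal) ≠ ⊤ := by
    refine ENNReal.rpow_ne_top_of_nonneg ?_ (by simpa using hs)
    rcases eq_or_ne p ⊤ with rfl | hp'
    · simp
    · have : 1 ≤ p.toReal := by
        rw [← ENNReal.toReal_one]; exact ENNReal.toReal_mono hp' hp
      simp only [ENNReal.toReal_one, div_one, sub_nonneg]
      rw [one_div]; exact inv_le_one_of_one_le₀ this
  have h1 := ENNReal.Tendsto.mul_const ht (Or.inr hC)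
  rw [zero_mul] at h1
  filter_upwards [hm, h1.eventually (gt_mem_nhds hε)] with y hy h2
  rw [← eLpNorm_one_eq_lintegral_enorm]
  exact (eLpNorm_le_eLpNorm_mul_rpow_measure_univ hp hy).trans h2.le

theorem eventually_lintegral_sub_le (h : IsVortexFamily Ω g d p U u v) (hx : x ∈ U) {ε : ℝ≥0∞}
    (hε : 0 < ε) : ∀ᶠ y in 𝓝 x, ∫⁻ z in Ω, ‖u y z - u x z‖ₑ ≤ ε := by
  have h1 := (h.sobolev x hx).1
  rw [nhdsWithin_eq_nhds.2 (h.mem_nhds hx)] at h1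
  refine eventually_lintegral_le_of_tendsto_eLpNorm h.domain.isBounded.measure_lt_top.ne h.one_le ?_
    h1 hε
  filter_upwards [h.mem_nhds hx] with y hy
  exact (h.aestronglyMeasurable hy).sub (h.aestronglyMeasurable hx)

theorem eventually_lintegral_fderiv_sub_le (h : IsVortexFamily Ω g d p U u v) (hx : x ∈ U)
    {ε : ℝ≥0∞} (hε : 0 < ε) :
    ∀ᶠ y in 𝓝 x, ∫⁻ z in Ω, ‖fderiv ℝ (u y) z - fderiv ℝ (u x) z‖ₑ ≤ ε := by
  have h1 := (h.sobolev x hx).2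
  rw [nhdsWithin_eq_nhds.2 (h.mem_nhds hx)] at h1
  refine eventually_lintegral_le_of_tendsto_eLpNorm h.domain.isBounded.measure_lt_top.ne h.one_le ?_
    h1 hε
  exact Eventually.of_forall fun y =>
    ((measurable_fderiv ℝ _).sub (measurable_fderiv ℝ _)).aestronglyMeasurable

/-- Since `da = i a ⟨c, ·⟩` and `db = i b ⟨e, ·⟩`, one has `i a ⟨c - e, ·⟩ = (da - db) - i (a - b)
⟨e, ·⟩`. -/
theorem norm_current_sub_le {a b : ℂ → ℂ} {z c e : ℂ} (ha : HasCurrent a z c)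
    (hb : HasCurrent b z e) :
    ‖c - e‖ ≤ ‖fderiv ℝ a z - fderiv ℝ b z‖ + ‖a z - b z‖ * ‖e‖ := by
  have h1 : ‖(innerSL ℝ (c - e)).smulRight (I * a z)‖ = ‖c - e‖ := by
    rw [ContinuousLinearMap.norm_smulRight_apply, innerSL_apply_norm]; simp [ha.1]
  have h2 : ‖(innerSL ℝ e).smulRight (I * (a z - b z))‖ = ‖a z - b z‖ * ‖e‖ := by
    rw [ContinuousLinearMap.norm_smulRight_apply]; simp [mul_comm]
  have h3 : (innerSL ℝ (c - e)).smulRight (I * a z) =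
      (fderiv ℝ a z - fderiv ℝ b z) - (innerSL ℝ e).smulRight (I * (a z - b z)) := by
    rw [ha.2.fderiv, hb.2.fderiv]
    apply clm_ext_complex <;> simp <;> ring
  rw [← h1, ← h2, h3]
  exact norm_sub_le _ _

/-- The difficulty is the product `|u_y - u_x| |J_x|`, whose factors tend to zero in `L¹` and lie in
`L²` respectively. Young's inequality with a large parameter `M`, together with `|u_y - u_x| ≤ 2`,
splits it into `M |u_y - u_x|` and a small multiple of `|J_x|²`. -/
theorem eventually_lintegral_current_sub_le (h : IsVortexFamily Ω g d p U u v) (hx : x ∈ U)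
    {ρ : ℝ} (hρ : 0 < ρ) {ε : ℝ} (hε : 0 < ε) :
    ∀ᶠ y in 𝓝 x, ∫⁻ z in perforated Ω x ρ,
      ‖vortexCurrent d y (v y) z - vortexCurrent d x (v x) z‖ₑ ≤ ENNReal.ofReal ε := by
  have hO := h.domain.isOpen
  have hP : perforated Ω x ρ ⊆ Ω := sdiff_subset
  have hL2 := integrableOn_norm_vortexCurrent_sq h.domain h.datum (h.subset hx) (h.harmonic x hx)
    (h.eq_mul x hx) (h.boundaryValues x hx) hρ
  set A := ∫ z in perforated Ω x ρ, ‖vortexCurrent d x (v x) z‖ ^ 2 with hA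
  have hA0 : 0 ≤ A := integral_nonneg fun z => by positivity
  -- Chosen so that `A / M ≤ ε / 3`; the summand `1` keeps `M` positive when `A = 0`.
  set M := 3 * (A + 1) / ε with hM
  have hM0 : 0 < M := by positivity
  have e1 : (0 : ℝ≥0∞) < ENNReal.ofReal (ε / 3) := by simpa using hε
  have e2 : (0 : ℝ≥0∞) < ENNReal.ofReal (ε / (3 * M)) := by
    rw [ENNReal.ofReal_pos]; positivity
  filter_upwards [h.mem_nhds hx, h.eventually_lintegral_sub_le hx e2,
    h.eventually_lintegral_fderiv_sub_le hx e1] with y hy h1 h2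
  have hpt : ∀ᵐ z ∂(volume.restrict (perforated Ω x ρ)),
      ‖vortexCurrent d y (v y) z - vortexCurrent d x (v x) z‖ₑ ≤
        ‖fderiv ℝ (u y) z - fderiv ℝ (u x) z‖ₑ +
        (ENNReal.ofReal M * ‖u y z - u x z‖ₑ +
          ENNReal.ofReal (M⁻¹ * ‖vortexCurrent d x (v x) z‖ ^ 2)) := by
    filter_upwards [ae_notMem_singularPoints x _, ae_notMem_singularPoints y _,
      ae_restrict_mem (measurableSet_perforated hO x ρ)] with z hz1 hz2 hz
    have c1 := h.hasCurrent hy ⟨hP hz, hz2⟩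
    have c2 := h.hasCurrent hx ⟨hP hz, hz1⟩
    have h3 := norm_current_sub_le c1 c2
    have h4 : ‖u y z - u x z‖ ≤ 2 := (norm_sub_le _ _).trans (by rw [c1.1, c2.1]; norm_num)
    have h5 : ‖u y z - u x z‖ * ‖vortexCurrent d x (v x) z‖ ≤
        M * ‖u y z - u x z‖ + M⁻¹ * ‖vortexCurrent d x (v x) z‖ ^ 2 := by
      have h0 := norm_nonneg (u y z - u x z)
      have h6 : 0 ≤ M⁻¹ * (‖vortexCurrent d x (v x) z‖ - M * ‖u y z - u x z‖) ^ 2 := by positivity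
      have h7 : M⁻¹ * (‖vortexCurrent d x (v x) z‖ - M * ‖u y z - u x z‖) ^ 2 =
          M⁻¹ * ‖vortexCurrent d x (v x) z‖ ^ 2 -
          2 * (‖u y z - u x z‖ * ‖vortexCurrent d x (v x) z‖) + M * ‖u y z - u x z‖ ^ 2 := by
        field_simp; ring
      have h8 : M * ‖u y z - u x z‖ ^ 2 ≤ 2 * (M * ‖u y z - u x z‖) := by
        have := mul_le_mul_of_nonneg_left h4 (mul_nonneg hM0.le h0)
        linarith
      have h9 : 0 ≤ M⁻¹ * ‖vortexCurrent d x (v x) z‖ ^ 2 := by positivity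
      linarith
    rw [← ofReal_norm, ← ofReal_norm, ← ofReal_norm,
      ← ENNReal.ofReal_mul hM0.le, ← ENNReal.ofReal_add (by positivity) (by positivity),
      ← ENNReal.ofReal_add (by positivity) (by positivity)]
    exact ENNReal.ofReal_le_ofReal (h3.trans (by linarith))
  have hm1 : AEMeasurable (fun z => ‖fderiv ℝ (u y) z - fderiv ℝ (u x) z‖ₑ)
      (volume.restrict (perforated Ω x ρ)) :=
    ((measurable_fderiv ℝ _).sub (measurable_fderiv ℝ _)).enorm.aemeasurable
  have hm2 : AEMeasurable (fun z => ENNReal.ofReal M * ‖u y z - u x z‖ₑ)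
      (volume.restrict (perforated Ω x ρ)) :=
    (((h.aestronglyMeasurable hy).sub (h.aestronglyMeasurable hx)).enorm.mono_measure
      (Measure.restrict_mono hP le_rfl)).const_mul _
  refine (lintegral_mono_ae hpt).trans ?_
  rw [lintegral_add_left' hm1, lintegral_add_left' hm2, lintegral_const_mul' _ _ ENNReal.ofReal_ne_top,
    ← ofReal_integral_eq_lintegral_ofReal (hL2.const_mul _)
      (Eventually.of_forall fun z => by positivity), integral_const_mul, ← hA]
  have t1 := (lintegral_mono_set (μ := volume)
    (f := fun z => ‖fderiv ℝ (u y) z - fderiv ℝ (u x) z‖ₑ) hP).trans h2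
  have t2 := (lintegral_mono_set (μ := volume) (f := fun z => ‖u y z - u x z‖ₑ) hP).trans h1
  have t3 : ENNReal.ofReal M * ENNReal.ofReal (ε / (3 * M)) = ENNReal.ofReal (ε / 3) := by
    rw [← ENNReal.ofReal_mul hM0.le]; congr 1; field_simp
  have t4 : M⁻¹ * A ≤ ε / 3 := by
    rw [hM, inv_div, div_mul_eq_mul_div, div_le_div_iff₀ (by positivity) (by norm_num)]
    nlinarith
  calc _ ≤ ENNReal.ofReal (ε / 3) + (ENNReal.ofReal (ε / 3) + ENNReal.ofReal (ε / 3)) := by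
        refine add_le_add t1 (add_le_add ?_ (ENNReal.ofReal_le_ofReal t4))
        rw [← t3]; gcongr
    _ = ENNReal.ofReal ε := by
        rw [← ENNReal.ofReal_add (by positivity) (by positivity),
          ← ENNReal.ofReal_add (by positivity) (by positivity)]
        congr 1; ring

/-- Continuity in both variables at each point of a compact set is uniform over that set, by the
tube lemma. -/
theorem eventually_forall_norm_sub_lt {F : Config n × ℂ → ℂ} {K : Set ℂ} (hK : IsCompact K)
    (hF : ∀ z ∈ K, ContinuousAt F (x, z)) {ε : ℝ} (hε : 0 < ε) :
    ∀ᶠ y in 𝓝 x, ∀ z ∈ K, ‖F (y, z) - F (x, z)‖ < ε := by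
  refine hK.eventually_forall_of_forall_eventually (P := fun y z => ‖F (y, z) - F (x, z)‖ < ε)
    fun z hz => ?_
  have hsnd : ContinuousAt (fun q : Config n × ℂ => ((x, q.2) : Config n × ℂ)) (x, z) := by fun_prop
  have h1 : ContinuousAt (fun q : Config n × ℂ => F (x, q.2)) (x, z) :=
    ContinuousAt.comp (g := F) (hF z hz) hsnd
  have h2 := ((hF z hz).sub h1).norm
  refine h2.eventually_lt continuousAt_const ?_
  simpa using hε

theorem continuousAt_sub_coord (x : Config n) (z : ℂ) (j : Fin n) :
    ContinuousAt (fun q : Config n × ℂ => q.2 - q.1 j) (x, z) := by fun_prop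

theorem continuousAt_vortexPhase (d : Fin n → ℤ) {z : ℂ} (hz : z ∉ singularPoints x) :
    ContinuousAt (fun q : Config n × ℂ => vortexPhase d q.1 q.2) (x, z) := by
  unfold vortexPhase
  refine tendsto_finsetProd _ fun j _ => ?_
  have hne := sub_ne_zero.2 (ne_of_notMem_singularPoints hz j)
  have hn0 : ((‖z - x j‖ : ℝ) : ℂ) ≠ 0 := by simpa using hne
  have h1 := continuousAt_sub_coord x z j
  have h2 : ContinuousAt (fun q : Config n × ℂ => ((‖q.2 - q.1 j‖ : ℝ) : ℂ)) (x, z) :=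
    continuous_ofReal.continuousAt.comp h1.norm
  exact ContinuousAt.zpow₀ (h1.div h2 hn0) _ (Or.inl (div_ne_zero hne hn0))

theorem continuousAt_sum_angularField (d : Fin n → ℤ) {z : ℂ} (hz : z ∉ singularPoints x) :
    ContinuousAt (fun q : Config n × ℂ => ∑ j, (d j : ℂ) * angularField (q.1 j) q.2) (x, z) := by
  refine tendsto_finsetSum _ fun j _ => ?_
  have hne := sub_ne_zero.2 (ne_of_notMem_singularPoints hz j)
  have h1 := continuousAt_sub_coord x z j
  have h2 : ContinuousAt (fun q : Config n × ℂ => ((‖q.2 - q.1 j‖ ^ 2 : ℝ) : ℂ)) (x, z) :=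
    continuous_ofReal.continuousAt.comp (h1.norm.pow 2)
  unfold angularField
  exact continuousAt_const.mul ((continuousAt_const.mul h1).div h2 (by simpa using hne))

theorem eventually_notMem_singularPoints {K : Set ℂ} (hK : IsCompact K)
    (hKx : ∀ z ∈ K, z ∉ singularPoints x) : ∀ᶠ y in 𝓝 x, ∀ z ∈ K, z ∉ singularPoints y := by
  refine hK.eventually_forall_of_forall_eventually fun z hz => ?_
  have : ∀ᶠ q : Config n × ℂ in 𝓝 (x, z), ∀ j, q.2 - q.1 j ≠ 0 := by
    rw [eventually_all]
    exact fun j => (continuousAt_sub_coord x z j).eventually_ne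
      (sub_ne_zero.2 (ne_of_notMem_singularPoints (hKx z hz) j))
  filter_upwards [this] with q hq
  rintro ⟨j, hj⟩
  exact hq j (by rw [sub_eq_zero]; exact hj.symm)

end IsVortexFamily

end InteriorConvergence

/-! ### Uniform convergence of the family on compact subsets of the domain -/

section InteriorCloseness

open Complex Metric Filter
open scoped ComplexConjugate ENNReal

theorem norm_mul_conj_sub_one {a b : ℂ} (hb : ‖b‖ = 1) : ‖a * conj b - 1‖ = ‖a - b‖ := by
  have h := mul_conj_of_norm_eq_one hb
  rw [show a * conj b - 1 = (a - b) * conj b by rw [← h]; ring, norm_mul, norm_conj, hb, mul_one]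

namespace IsVortexFamily

variable {Ω : Set ℂ} {g : ℂ → ℂ} {n : ℕ} {d : Fin n → ℤ} {p : ℝ≥0∞} {U : Set (Config n)}
  {u v : Config n → ℂ → ℂ} {x y : Config n}

/-- The centre may itself be a singularity: only the annulus around it has to be free of
singularities. -/
theorem exists_clear_radius {Ω : Set ℂ} (hΩ : IsOpen Ω) (x : Config n) {z₀ : ℂ} (hz : z₀ ∈ Ω) :
    ∃ R > 0, closedBall z₀ (2 * R) ⊆ Ω ∧
      closedBall z₀ (3 / 2 * R) \ ball z₀ (R / 2) ⊆ perforated Ω x (R / 2) := by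
  have h1 : (Ω \ (singularPoints x \ {z₀})) ∈ 𝓝 z₀ :=
    (hΩ.sdiff ((finite_singularPoints x).subset sdiff_subset).isClosed).mem_nhds
      ⟨hz, fun h => h.2 rfl⟩
  obtain ⟨r, hr, hsub⟩ := Metric.nhds_basis_closedBall.mem_iff.1 h1
  refine ⟨r / 2, by positivity, fun z hzr => (hsub (by
    rw [mem_closedBall] at hzr ⊢; linarith)).1, fun z hzr => ?_⟩
  have h2 : dist z z₀ ≤ 3 / 2 * (r / 2) := hzr.1
  have h3 : r / 2 / 2 ≤ dist z z₀ := not_lt.1 hzr.2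
  refine ⟨(hsub (show z ∈ closedBall z₀ r by rw [mem_closedBall]; linarith)).1, fun h => ?_⟩
  obtain ⟨j, hj⟩ := mem_iUnion.1 h
  rw [mem_ball] at hj
  by_cases hjz : x j = z₀
  · rw [hjz] at hj; linarith
  · refine (hsub (show x j ∈ closedBall z₀ r from ?_)).2 ⟨⟨j, rfl⟩, hjz⟩
    have := dist_triangle (x j) z z₀
    rw [dist_comm] at hj
    rw [mem_closedBall]; linarith

/-- The conjugate of `current (v y) - current (v x)` is holomorphic on the whole disc, even if the
disc contains singularities of `u`. On the circle of radius `R` it is controlled by the mean value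
property on discs of radius `R / 2` inside the clear annulus, where the `L¹` closeness of the full
currents is available; the maximum principle then covers the interior. -/
theorem eventually_current_close (h : IsVortexFamily Ω g d p U u v) (hx : x ∈ U) {z₀ : ℂ} {R : ℝ}
    (hR : 0 < R) (hRΩ : closedBall z₀ (2 * R) ⊆ Ω)
    (hA : closedBall z₀ (3 / 2 * R) \ ball z₀ (R / 2) ⊆ perforated Ω x (R / 2))
    {ε : ℝ} (hε : 0 < ε) :
    ∀ᶠ y in 𝓝 x, ∀ z ∈ closedBall z₀ R, ‖current (v y) z - current (v x) z‖ ≤ ε := by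
  have hO := h.domain.isOpen
  have hAc : IsCompact (closedBall z₀ (3 / 2 * R) \ ball z₀ (R / 2)) :=
    (isCompact_closedBall _ _).diff isOpen_ball
  have hAx : ∀ z ∈ closedBall z₀ (3 / 2 * R) \ ball z₀ (R / 2), z ∉ singularPoints x :=
    fun z hz => notMem_singularPoints_of_mem_perforated (by positivity) (hA hz)
  have hpi := Real.pi_pos
  filter_upwards [h.mem_nhds hx,
    eventually_forall_norm_sub_lt hAc (fun z hz => continuousAt_sum_angularField d (hAx z hz))
      (half_pos hε),
    h.eventually_lintegral_current_sub_le hx (ρ := R / 2) (by positivity)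
      (ε := Real.pi * (R / 2) ^ 2 * (ε / 2)) (by positivity)] with y hy h1 h2
  have hdiff : DifferentiableOn ℂ (fun z => conj (current (v y) z - current (v x) z)) Ω := by
    simp only [map_sub]
    exact ((h.harmonic y hy).differentiableOn_conj_current hO).sub
      ((h.harmonic x hx).differentiableOn_conj_current hO)
  have hsph : ∀ z ∈ sphere z₀ R, ‖conj (current (v y) z - current (v x) z)‖ ≤ ε := by
    intro z hz
    have hzd : dist z z₀ = R := hz
    have hBA : closedBall z (R / 2) ⊆ closedBall z₀ (3 / 2 * R) \ ball z₀ (R / 2) := by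
      intro w hw
      rw [mem_closedBall] at hw
      have t1 := dist_triangle w z z₀
      have t2 := dist_triangle z w z₀
      rw [dist_comm z w] at t2
      refine ⟨by rw [mem_closedBall]; linarith, fun hw' => ?_⟩
      rw [mem_ball] at hw'; linarith
    have hBΩ : closedBall z (R / 2) ⊆ Ω := hBA.trans (hA.trans sdiff_subset)
    have hcont := hdiff.continuousOn.mono hBΩ
    have h3 := norm_mul_le_integral_ball (by positivity) hcont
      (hdiff.mono (ball_subset_closedBall.trans hBΩ))
    rw [integral_norm_eq_lintegral_enorm ((hcont.mono
      ball_subset_closedBall).aestronglyMeasurable measurableSet_ball)] at h3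
    have h4 : ∫⁻ w in ball z (R / 2), ‖conj (current (v y) w - current (v x) w)‖ₑ ≤
        ENNReal.ofReal (Real.pi * (R / 2) ^ 2 * ε) := by
      have hle : ∀ w ∈ ball z (R / 2), ‖conj (current (v y) w - current (v x) w)‖ₑ ≤
          ‖vortexCurrent d y (v y) w - vortexCurrent d x (v x) w‖ₑ + ENNReal.ofReal (ε / 2) := by
        intro w hw
        have h5 := h1 w (hBA (ball_subset_closedBall hw))
        rw [← ofReal_norm, ← ofReal_norm, ← ENNReal.ofReal_add (by positivity) (by positivity),
          norm_conj]
        refine ENNReal.ofReal_le_ofReal ?_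
        have h6 : current (v y) w - current (v x) w =
            (vortexCurrent d y (v y) w - vortexCurrent d x (v x) w) -
            (∑ j, (d j : ℂ) * angularField (y j) w - ∑ j, (d j : ℂ) * angularField (x j) w) := by
          rw [vortexCurrent, vortexCurrent]; ring
        rw [h6]
        exact (norm_sub_le _ _).trans (by linarith)
      refine (setLIntegral_mono' measurableSet_ball hle).trans ?_
      rw [lintegral_add_right' _ aemeasurable_const, setLIntegral_const, Complex.volume_ball]
      refine (add_le_add ((lintegral_mono_set (ball_subset_closedBall.trans (hBA.trans hA))).trans
        h2) le_rfl).trans (le_of_eq ?_)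
      rw [← ENNReal.ofReal_pow (by positivity), show (NNReal.pi : ℝ≥0∞) = ENNReal.ofReal Real.pi by
        rw [ENNReal.ofReal, ← NNReal.coe_real_pi, Real.toNNReal_coe],
        ← ENNReal.ofReal_mul (by positivity), ← ENNReal.ofReal_mul (by positivity),
        ← ENNReal.ofReal_add (by positivity) (by positivity)]
      congr 1; ring
    have h5 := h3.trans (ENNReal.toReal_mono ENNReal.ofReal_ne_top h4)
    rw [ENNReal.toReal_ofReal (by positivity)] at h5
    exact le_of_mul_le_mul_left h5 (by positivity)
  intro z hz
  have hb : Bornology.IsBounded (ball z₀ R) := isBounded_ball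
  have hsub : closedBall z₀ R ⊆ Ω := (closedBall_subset_closedBall (by linarith)).trans hRΩ
  have hcl : DiffContOnCl ℂ (fun z => conj (current (v y) z - current (v x) z)) (ball z₀ R) := by
    refine (hdiff.mono ?_).diffContOnCl
    rw [closure_ball _ hR.ne']; exact hsub
  have := Complex.norm_le_of_forall_mem_frontier_norm_le hb hcl (C := ε)
    (by rw [frontier_ball _ hR.ne']; exact hsph) (z := z) (by rwa [closure_ball _ hR.ne'])
  rwa [norm_conj] at this

/-- The map `v_y conj v_x` has small gradient by the closeness of the currents, so it is enough to
find one point where it is close to `1`. Such a point exists in a small ball of the clear annulus,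
since `u_y - u_x` is small in `L¹`. -/
theorem eventually_mul_conj_close (h : IsVortexFamily Ω g d p U u v) (hx : x ∈ U) {z₀ : ℂ} {R : ℝ}
    (hR : 0 < R) (hRΩ : closedBall z₀ (2 * R) ⊆ Ω)
    (hA : closedBall z₀ (3 / 2 * R) \ ball z₀ (R / 2) ⊆ perforated Ω x (R / 2))
    {ε : ℝ} (hε : 0 < ε) :
    ∀ᶠ y in 𝓝 x, ∀ z ∈ closedBall z₀ R, ‖v y z * conj (v x z) - 1‖ ≤ ε := by
  have hO := h.domain.isOpen
  have hAc : IsCompact (closedBall z₀ (3 / 2 * R) \ ball z₀ (R / 2)) :=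
    (isCompact_closedBall _ _).diff isOpen_ball
  have hAx : ∀ z ∈ closedBall z₀ (3 / 2 * R) \ ball z₀ (R / 2), z ∉ singularPoints x :=
    fun z hz => notMem_singularPoints_of_mem_perforated (by positivity) (hA hz)
  have hpi := Real.pi_pos
  have hε' : (0 : ℝ≥0∞) < ENNReal.ofReal (Real.pi * (R / 4) ^ 2 * (ε / 8)) := by
    rw [ENNReal.ofReal_pos]; positivity
  filter_upwards [h.mem_nhds hx, eventually_notMem_singularPoints hAc hAx,
    eventually_forall_norm_sub_lt hAc (fun z hz => continuousAt_vortexPhase d (hAx z hz))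
      (show 0 < ε / 4 by positivity),
    h.eventually_lintegral_sub_le hx hε',
    h.eventually_current_close hx hR hRΩ hA (show 0 < ε / (4 * R) by positivity)]
    with y hy h0 h1 h2 h3
  have hsub : closedBall z₀ R ⊆ Ω := (closedBall_subset_closedBall (by linarith)).trans hRΩ
  -- A ball contained both in the disc of radius `R` and in the clear annulus.
  set B := ball (z₀ + (3 / 4 * R : ℝ)) (R / 4) with hB
  have hBmem : ∀ w ∈ B, w ∈ closedBall z₀ R ∧
      w ∈ closedBall z₀ (3 / 2 * R) \ ball z₀ (R / 2) := by
    intro w hw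
    rw [hB, mem_ball] at hw
    have t0 : dist (z₀ + (3 / 4 * R : ℝ)) z₀ = 3 / 4 * R := by
      rw [dist_eq_norm, add_sub_cancel_left, norm_real, Real.norm_of_nonneg (by positivity)]
    have t1 := dist_triangle w (z₀ + (3 / 4 * R : ℝ)) z₀
    have t2 := dist_triangle (z₀ + (3 / 4 * R : ℝ)) w z₀
    rw [dist_comm _ w] at t2
    refine ⟨by rw [mem_closedBall]; linarith, by rw [mem_closedBall]; linarith, fun hw' => ?_⟩
    rw [mem_ball] at hw'; linarith
  obtain ⟨w, hwB, hw⟩ : ∃ w ∈ B, ‖u y w - u x w‖ ≤ ε / 4 := by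
    by_contra! hcon
    have h4 : ∫⁻ w in B, ENNReal.ofReal (ε / 4) ≤ ∫⁻ w in B, ‖u y w - u x w‖ₑ := by
      refine setLIntegral_mono' measurableSet_ball fun w hw => ?_
      rw [← ofReal_norm]
      exact ENNReal.ofReal_le_ofReal (hcon w hw).le
    have h5 := (h4.trans (lintegral_mono_set fun w hw => hsub (hBmem w hw).1)).trans h2
    rw [setLIntegral_const, hB, Complex.volume_ball, ← ENNReal.ofReal_pow (by positivity),
      show (NNReal.pi : ℝ≥0∞) = ENNReal.ofReal Real.pi by
        rw [ENNReal.ofReal, ← NNReal.coe_real_pi, Real.toNNReal_coe],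
      ← ENNReal.ofReal_mul (by positivity), ← ENNReal.ofReal_mul (by positivity),
      ENNReal.ofReal_le_ofReal_iff (by positivity)] at h5
    have h6 : 0 < Real.pi * (R / 4) ^ 2 * ε := by positivity
    linarith
  have hn : ∀ z ∈ Ω, ‖v x z‖ = 1 := (h.harmonic x hx).norm_eq_one
  have hwA := (hBmem w hwB).2
  have hwR := (hBmem w hwB).1
  have hFw : ‖v y w * conj (v x w) - 1‖ ≤ ε / 2 := by
    rw [norm_mul_conj_sub_one (hn w (hsub hwR))]
    have e1 : vortexPhase d y w * (v y w - v x w) =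
        (u y w - u x w) - (vortexPhase d y w - vortexPhase d x w) * v x w := by
      rw [h.eq_mul y hy w ⟨hsub hwR, h0 w hwA⟩, h.eq_mul x hx w ⟨hsub hwR, hAx w hwA⟩]; ring
    have e2 : ‖v y w - v x w‖ = ‖vortexPhase d y w * (v y w - v x w)‖ := by
      rw [norm_mul, (hasCurrent_vortexPhase (h0 w hwA)).1, one_mul]
    have e3 := h1 w hwA
    rw [e2, e1]
    refine (norm_sub_le _ _).trans ?_
    rw [norm_mul, hn w (hsub hwR), mul_one]
    linarith
  intro z hz
  have hcur : ∀ t ∈ closedBall z₀ R, HasCurrent (fun z => v y z * conj (v x z)) t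
      (current (v y) t - current (v x) t) := fun t ht => by
    have := ((h.harmonic y hy).hasCurrent hO (hsub ht)).mul
      ((h.harmonic x hx).hasCurrent hO (hsub ht)).star
    rwa [← sub_eq_add_neg] at this
  have hmvt := (convex_closedBall z₀ R).norm_image_sub_le_of_norm_fderiv_le (𝕜 := ℝ)
    (f := fun z => v y z * conj (v x z)) (C := ε / (4 * R))
    (fun t ht => (hcur t ht).differentiableAt)
    (fun t ht => by rw [(hcur t ht).norm_fderiv]; exact h3 t ht) hwR hz
  have hd : ‖z - w‖ ≤ 2 * R := by
    rw [← dist_eq_norm]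
    have := dist_triangle_right z w z₀
    rw [mem_closedBall] at hz hwR
    linarith
  have h7 : ε / (4 * R) * ‖z - w‖ ≤ ε / 2 := by
    calc _ ≤ ε / (4 * R) * (2 * R) := by gcongr
      _ = ε / 2 := by field_simp; norm_num
  have h8 := norm_sub_le_norm_sub_add_norm_sub (v y z * conj (v x z)) (v y w * conj (v x w)) 1
  linarith

theorem eventually_forall_isCompact {P : Config n → ℂ → Prop} {Ω K : Set ℂ} (hK : IsCompact K)
    (hKΩ : K ⊆ Ω) (hP : ∀ z₀ ∈ Ω, ∃ R > 0, ∀ᶠ y in 𝓝 x, ∀ z ∈ closedBall z₀ R, P y z) :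
    ∀ᶠ y in 𝓝 x, ∀ z ∈ K, P y z := by
  refine hK.induction_on (p := fun s => ∀ᶠ y in 𝓝 x, ∀ z ∈ s, P y z) (by simp) ?_ ?_ ?_
  · intro s t hst ht
    filter_upwards [ht] with y hy z hz using hy z (hst hz)
  · intro s t hs ht
    filter_upwards [hs, ht] with y h1 h2 z hz using hz.elim (h1 z) (h2 z)
  · intro z₀ hz₀
    obtain ⟨R, hR, h1⟩ := hP z₀ (hKΩ hz₀)
    exact ⟨_, mem_nhdsWithin_of_mem_nhds (closedBall_mem_nhds z₀ hR), h1⟩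

theorem eventually_forall_current_close (h : IsVortexFamily Ω g d p U u v) (hx : x ∈ U) {K : Set ℂ}
    (hK : IsCompact K) (hKΩ : K ⊆ Ω) {ε : ℝ} (hε : 0 < ε) :
    ∀ᶠ y in 𝓝 x, ∀ z ∈ K, ‖current (v y) z - current (v x) z‖ ≤ ε :=
  eventually_forall_isCompact hK hKΩ fun z₀ hz₀ => by
    obtain ⟨R, hR, h1, h2⟩ := exists_clear_radius h.domain.isOpen x hz₀
    exact ⟨R, hR, h.eventually_current_close hx hR h1 h2 hε⟩

theorem eventually_forall_mul_conj_close (h : IsVortexFamily Ω g d p U u v) (hx : x ∈ U) {K : Set ℂ}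
    (hK : IsCompact K) (hKΩ : K ⊆ Ω) {ε : ℝ} (hε : 0 < ε) :
    ∀ᶠ y in 𝓝 x, ∀ z ∈ K, ‖v y z * conj (v x z) - 1‖ ≤ ε :=
  eventually_forall_isCompact hK hKΩ fun z₀ hz₀ => by
    obtain ⟨R, hR, h1, h2⟩ := exists_clear_radius h.domain.isOpen x hz₀
    exact ⟨R, hR, h.eventually_mul_conj_close hx hR h1 h2 hε⟩

/-- On compact sets without singularities the maps of the family depend continuously on the
singularities, uniformly. -/
theorem eventually_forall_family_close (h : IsVortexFamily Ω g d p U u v) (hx : x ∈ U) {K : Set ℂ}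
    (hK : IsCompact K) (hKΩ : K ⊆ Ω) (hKx : ∀ z ∈ K, z ∉ singularPoints x) {ε : ℝ} (hε : 0 < ε) :
    ∀ᶠ y in 𝓝 x, ∀ z ∈ K, ‖u y z * conj (u x z) - 1‖ ≤ ε := by
  filter_upwards [h.mem_nhds hx, eventually_notMem_singularPoints hK hKx,
    eventually_forall_norm_sub_lt hK (fun z hz => continuousAt_vortexPhase d (hKx z hz))
      (half_pos hε), h.eventually_forall_mul_conj_close hx hK hKΩ (half_pos hε)]
    with y hy h0 h1 h2 z hz
  have n1 := (h.hasCurrent hx ⟨hKΩ hz, hKx z hz⟩).1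
  have n2 := (h.harmonic x hx).norm_eq_one z (hKΩ hz)
  have n3 := (hasCurrent_vortexPhase (d := d) (h0 z hz)).1
  have e3 := h1 z hz
  have e4 := h2 z hz
  rw [norm_mul_conj_sub_one n2] at e4
  rw [norm_mul_conj_sub_one n1, h.eq_mul y hy z ⟨hKΩ hz, h0 z hz⟩,
    h.eq_mul x hx z ⟨hKΩ hz, hKx z hz⟩, show vortexPhase d y z * v y z - vortexPhase d x z * v x z =
      vortexPhase d y z * (v y z - v x z) + (vortexPhase d y z - vortexPhase d x z) * v x z by ring]
  refine (norm_add_le _ _).trans ?_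
  rw [norm_mul, norm_mul, n2, n3, mul_one, one_mul]
  linarith

end IsVortexFamily

end InteriorCloseness

/-! ### Closeness of the family near the boundary -/

section BoundaryCloseness

open Complex Metric Filter
open scoped ComplexConjugate ENNReal

theorem differentiableOn_conj_vortexCurrent {n : ℕ} {d : Fin n → ℤ} {x : Config n} {Ω : Set ℂ}
    {v : ℂ → ℂ} (hΩ : IsOpen Ω) (hv : IsHarmonicCircleMap Ω v) :
    DifferentiableOn ℂ (fun z => conj (vortexCurrent d x v z)) (Ω \ singularPoints x) := by
  have e : ∀ z, conj (vortexCurrent d x v z) =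
      ∑ l, (d l : ℂ) * (-I / (z - x l)) + conj (current v z) := by
    intro z
    rw [vortexCurrent, map_add, map_sum]
    simp only [map_mul, conj_angularField, map_intCast]
  simp_rw [e]
  refine DifferentiableOn.add (DifferentiableOn.fun_sum fun l _ => ?_)
    ((hv.differentiableOn_conj_current hΩ).mono sdiff_subset)
  refine DifferentiableOn.const_mul (DifferentiableOn.div (by fun_prop) (by fun_prop) ?_) _
  exact fun z hz => sub_ne_zero.2 (ne_of_notMem_singularPoints hz.2 l)

/-- Near a boundary point, a smooth domain is a subgraph in the direction of the normal. -/
theorem exists_normal_rect {Ω : Set ℂ} (hΩ : IsOpen Ω) {p ν : ℂ} (hp : p ∈ frontier Ω)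
    (hν : IsOuterNormal Ω p ν) {O : Set ℂ} (hO : O ∈ 𝓝 p) :
    ‖ν‖ = 1 ∧ ∃ α > 0, ∃ β > 0, ∀ z ∈ Icc (-α) α ×ℂ Icc (-β) β, p + ν * z ∈ O ∧
      (z.re = -α → p + ν * z ∈ Ω) ∧ (z.re = α → p + ν * z ∉ Ω) ∧
      (p + ν * z ∉ Ω → ∀ w ∈ Icc (-α) α ×ℂ Icc (-β) β, w.im = z.im → z.re ≤ w.re →
        p + ν * w ∉ Ω) := by
  obtain ⟨r, hr, hg, hΩr, hνe⟩ := hν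
  have hgn : 0 < ‖gradient r p‖ := norm_pos_iff.2 hg
  have hν1 : ‖ν‖ = 1 := by rw [hνe, norm_smul, norm_inv, norm_norm, inv_mul_cancel₀ hgn.ne']
  refine ⟨hν1, ?_⟩
  have hrd : Differentiable ℝ r := hr.differentiable (by simp)
  have hcont : Continuous fun z => fderiv ℝ r z ν :=
    (hr.continuous_fderiv (by simp)).clm_apply continuous_const
  have hpos : 0 < fderiv ℝ r p ν := by
    have h1 : fderiv ℝ r p ν = inner ℝ (gradient r p) ν := by
      rw [(hrd p).hasGradientAt.hasFDerivAt.fderiv]; simp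
    rw [h1, hνe, inner_smul_right, real_inner_self_eq_norm_sq]
    positivity
  have hev : ∀ᶠ z in 𝓝 p, 0 < fderiv ℝ r z ν := hcont.continuousAt.eventually (lt_mem_nhds hpos)
  have hrp : r p = 0 := by
    have h1 : ¬ r p < 0 := fun h => by
      have := hΩr.self_of_nhds.2 h
      rw [hΩ.frontier_eq] at hp
      exact hp.2 this
    refine le_antisymm (not_lt.1 fun h => ?_) (not_lt.1 h1)
    have h2 : ∀ᶠ z in 𝓝 p, z ∉ Ω := by
      filter_upwards [hΩr, hrd.continuous.continuousAt.eventually (lt_mem_nhds h)] with z hz1 hz2 hz3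
      exact lt_asymm hz2 (hz1.1 hz3)
    exact (mem_closure_iff_frequently.1 (frontier_subset_closure hp)) h2
  have hOe : ∀ᶠ z in 𝓝 p, z ∈ O := hO
  obtain ⟨δ, hδ, hball⟩ := Metric.eventually_nhds_iff_ball.1 (hΩr.and (hev.and hOe))
  set α := δ / 3 with hα
  have hα0 : 0 < α := by positivity
  have hmem : ∀ a b : ℝ, |a| ≤ α → |b| ≤ α → p + ν * (a + b * I) ∈ ball p δ := by
    intro a b ha hb
    rw [mem_ball, dist_eq_norm, add_sub_cancel_left, norm_mul, hν1, one_mul]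
    refine (norm_add_le _ _).trans_lt ?_
    simp only [norm_mul, norm_real, norm_I, mul_one, Real.norm_eq_abs]
    linarith
  -- The defining function increases strictly in the direction of the normal, so its sublevel set is
  -- a subgraph in the coordinates `p + ν z`.
  have hmono : ∀ b : ℝ, |b| ≤ α → StrictMonoOn (fun a : ℝ => r (p + ν * (a + b * I)))
      (Icc (-α) α) := by
    intro b hb
    have hd : ∀ a : ℝ, HasDerivAt (fun a : ℝ => r (p + ν * (a + b * I)))
        (fderiv ℝ r (p + ν * (a + b * I)) ν) a := by
      intro a
      have h1 : HasDerivAt (fun a : ℝ => p + ν * ((a : ℂ) + b * I)) ν a := by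
        simpa using (((ofRealCLM.hasDerivAt (x := a)).add_const (b * I)).const_mul ν).const_add p
      exact (hrd _).hasFDerivAt.comp_hasDerivAt a h1
    refine strictMonoOn_of_deriv_pos (convex_Icc _ _)
      (continuous_iff_continuousAt.2 fun a => (hd a).continuousAt).continuousOn fun a ha => ?_
    rw [interior_Icc] at ha
    rw [(hd a).deriv]
    exact (hball _ (hmem a b (abs_le.2 ⟨ha.1.le, ha.2.le⟩) hb)).2.1
  have h0 : r (p + ν * ((0 : ℝ) + (0 : ℝ) * I)) = 0 := by simp [hrp]
  have hz0 : |(0 : ℝ)| ≤ α := by simpa using hα0.le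
  have hbot : r (p + ν * ((-α : ℝ) + (0 : ℝ) * I)) < 0 := by
    have t := hmono 0 hz0 ⟨le_rfl, by linarith⟩ ⟨by linarith, hα0.le⟩ (neg_lt_zero.2 hα0)
    beta_reduce at t
    rwa [h0] at t
  have htop : 0 < r (p + ν * ((α : ℝ) + (0 : ℝ) * I)) := by
    have t := hmono 0 hz0 ⟨by linarith, hα0.le⟩ ⟨by linarith, le_rfl⟩ hα0
    beta_reduce at t
    rwa [h0] at t
  have hcb : ∀ a : ℝ, Continuous fun b : ℝ => r (p + ν * ((a : ℝ) + (b : ℝ) * I)) := fun a =>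
    hrd.continuous.comp (by fun_prop)
  have e1 := (hcb (-α)).continuousAt.eventually (gt_mem_nhds hbot)
  have e2 := (hcb α).continuousAt.eventually (lt_mem_nhds htop)
  obtain ⟨β₀, hβ₀, hβ⟩ := Metric.eventually_nhds_iff_ball.1 (e1.and e2)
  refine ⟨α, hα0, min α (β₀ / 2), by positivity, fun z hz => ?_⟩
  rw [mem_reProdIm] at hz
  have hform : ∀ w : ℂ, p + ν * w = p + ν * (w.re + w.im * I) := fun w => by rw [re_add_im]
  have hzre : |z.re| ≤ α := abs_le.2 hz.1
  have hzim : |z.im| ≤ min α (β₀ / 2) := abs_le.2 hz.2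
  have hzα : |z.im| ≤ α := hzim.trans (min_le_left _ _)
  have hzβ : z.im ∈ ball (0 : ℝ) β₀ := by
    rw [mem_ball, Real.dist_eq, sub_zero]
    linarith [hzim.trans (min_le_right _ _)]
  have hzb : p + ν * z ∈ ball p δ := by rw [hform]; exact hmem _ _ hzre hzα
  refine ⟨(hball _ hzb).2.2, fun h => ?_, fun h => ?_, fun h w hw hwim hwre => ?_⟩
  · rw [(hball _ hzb).1, hform, h]; exact (hβ _ hzβ).1
  · rw [(hball _ hzb).1, hform, h, not_lt]; exact (hβ _ hzβ).2.le
  · rw [mem_reProdIm] at hw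
    have hwb : p + ν * w ∈ ball p δ := by
      rw [hform]; exact hmem _ _ (abs_le.2 hw.1) (by rw [hwim]; exact hzα)
    rw [(hball _ hzb).1, not_lt, hform] at h
    rw [(hball _ hwb).1, not_lt, hform w, hwim]
    exact h.trans ((hmono _ hzα).monotoneOn hz.1 hw.1 hwre)

/-- A circle-valued map whose current is small in `L¹` is close to `1` on some segment. -/
theorem exists_side_re_pos {a0 a1 b0 b1 : ℝ} (hb : b0 < b1) {D : Set ℂ}
    (hD : IsOpen D) {G c : ℂ → ℂ}
    (hG1 : ∀ z ∈ Icc a0 a1 ×ℂ Icc b0 b1, z ∉ D → G z = 1)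
    (hcur : ∀ z ∈ Icc a0 a1 ×ℂ Icc b0 b1, z ∈ D → HasCurrent G z (c z))
    (hc : ContinuousOn c (D ∩ Icc a0 a1 ×ℂ Icc b0 b1))
    (hmono : ∀ z ∈ Icc a0 a1 ×ℂ Icc b0 b1, z ∉ D → ∀ w ∈ Icc a0 a1 ×ℂ Icc b0 b1,
      w.im = z.im → z.re ≤ w.re → w ∉ D)
    (hbot : ∀ z ∈ Icc a0 a1 ×ℂ Icc b0 b1, z.re = a0 → ‖G z - 1‖ ≤ 1 / 4)
    (hint : ∫⁻ z in D ∩ Icc a0 a1 ×ℂ Icc b0 b1, ‖c z‖ₑ ≤ ENNReal.ofReal ((b1 - b0) / 4)) :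
    ∃ b ∈ Icc b0 b1, ∀ z ∈ Icc a0 a1 ×ℂ Icc b0 b1, z.im = b → 0 < (G z).re := by
  classical
  set R := Icc a0 a1 ×ℂ Icc b0 b1 with hR
  have hRm : MeasurableSet R := (isClosed_Icc.reProdIm isClosed_Icc).measurableSet
  have hDm : MeasurableSet (D ∩ R) := hD.measurableSet.inter hRm
  let F : ℂ → ℝ≥0∞ := fun z => ‖(D ∩ R).piecewise c 0 z‖ₑ
  have hF : Measurable F := (hc.measurable_piecewise continuousOn_const hDm).enorm
  have hFD : ∀ z ∈ D ∩ R, F z = ‖c z‖ₑ := fun z hz => by simp only [F, piecewise_eq_of_mem _ _ _ hz]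
  have hF1 : ∫⁻ z, F z = ∫⁻ z in D ∩ R, ‖c z‖ₑ := by
    rw [← lintegral_indicator hDm]
    congr 1; ext z
    by_cases h : z ∈ D ∩ R
    · rw [hFD z h, indicator_of_mem h]
    · rw [indicator_of_notMem h]; simp only [F, piecewise_eq_of_notMem _ _ _ h]; simp
  have hF2 : ∫⁻ z, F z = ∫⁻ b, ∫⁻ a, F ⟨a, b⟩ := by
    rw [← Complex.volume_preserving_equiv_real_prod.symm.lintegral_comp hF, Measure.volume_eq_prod]
    exact lintegral_prod_symm _ (hF.comp measurableEquivRealProd.symm.measurable).aemeasurable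
  have hFm : Measurable fun b : ℝ => ∫⁻ a : ℝ, F ⟨a, b⟩ := by
    have : Measurable fun q : ℝ × ℝ => F ⟨q.1, q.2⟩ := hF.comp measurableEquivRealProd.symm.measurable
    exact this.lintegral_prod_left'
  have hv0 : volume (Icc b0 b1) ≠ 0 := by simpa using hb
  -- By Fubini some horizontal line carries at most the average of the integral of `|c|`, that is at
  -- most `1 / 4`.
  obtain ⟨b, hbI, hble⟩ := exists_le_setLAverage hv0 (by simp) (hFm.aemeasurable
    (μ := volume.restrict (Icc b0 b1)))
  have hline : ∫⁻ a, F ⟨a, b⟩ ≤ ENNReal.ofReal (1 / 4) := by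
    refine hble.trans ?_
    rw [setLAverage_eq, Real.volume_Icc]
    refine ENNReal.div_le_of_le_mul ?_
    rw [← ENNReal.ofReal_mul (by norm_num)]
    refine (setLIntegral_le_lintegral _ _).trans ?_
    rw [← hF2, hF1]
    refine hint.trans (le_of_eq ?_)
    congr 1; ring
  refine ⟨b, hbI, fun z hz hzb => ?_⟩
  by_cases hzD : z ∈ D
  swap
  · rw [hG1 z hz hzD]; simp
  have hz' := hz
  rw [hR, mem_reProdIm] at hz'
  have hmem : ∀ t ∈ Icc a0 z.re, (⟨t, b⟩ : ℂ) ∈ D ∩ R := by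
    intro t ht
    have h1 : (⟨t, b⟩ : ℂ) ∈ R := by
      rw [hR, mem_reProdIm]; exact ⟨⟨ht.1, ht.2.trans hz'.1.2⟩, hbI⟩
    refine ⟨?_, h1⟩
    by_contra h
    exact hmono _ h1 h z hz hzb ht.2 hzD
  have hder : ∀ t ∈ Icc a0 z.re, HasDerivAt (fun t : ℝ => G ⟨t, b⟩)
      ((inner ℝ (c ⟨t, b⟩) 1 : ℝ) * (I * G ⟨t, b⟩)) t := by
    intro t ht
    have h1 : HasDerivAt (fun t : ℝ => (⟨t, b⟩ : ℂ)) 1 t := by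
      have := (ofRealCLM.hasDerivAt (x := t)).add_const (b * I)
      simp only [ofRealCLM_apply, ofReal_one] at this
      refine this.congr_of_eventuallyEq (Eventually.of_forall fun s => ?_)
      apply Complex.ext <;> simp
    have h2 := (hcur _ (hmem t ht).2 (hmem t ht).1).2.comp_hasDerivAt t h1
    refine h2.congr_deriv ?_
    simp
  have hcl : Continuous fun t : ℝ => (⟨t, b⟩ : ℂ) := by
    have : (fun t : ℝ => (⟨t, b⟩ : ℂ)) = fun t : ℝ => (t : ℂ) + b * I := by
      ext t; apply Complex.ext <;> simp
    rw [this]; fun_prop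
  have hcc : ContinuousOn (fun t : ℝ => c ⟨t, b⟩) (Icc a0 z.re) :=
    hc.comp hcl.continuousOn hmem
  have hGc : ContinuousOn (fun t : ℝ => G ⟨t, b⟩) (Icc a0 z.re) := fun t ht =>
    (hder t ht).continuousAt.continuousWithinAt
  have hdc : ContinuousOn (fun t : ℝ => ((inner ℝ (c ⟨t, b⟩) 1 : ℝ) : ℂ) * (I * G ⟨t, b⟩))
      (Icc a0 z.re) := by
    refine (continuous_ofReal.comp_continuousOn (hcc.inner continuousOn_const)).mul
      (continuousOn_const.mul hGc)
  have hftc := intervalIntegral.integral_eq_sub_of_hasDerivAt (a := a0) (b := z.re)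
    (fun t ht => hder t (by rwa [uIcc_of_le hz'.1.1] at ht))
    (hdc.intervalIntegrable_of_Icc hz'.1.1)
  -- On this line `G` varies by at most the integral of `|c|`. With the value at the left end within
  -- `1 / 4` of `1`, this gives `|G - 1| ≤ 1 / 2`.
  have hen : ‖G ⟨z.re, b⟩ - G ⟨a0, b⟩‖ₑ ≤ ENNReal.ofReal (1 / 4) := by
    rw [← hftc, intervalIntegral.integral_of_le hz'.1.1]
    refine (enorm_integral_le_lintegral_enorm _).trans (le_trans ?_ hline)
    refine le_trans ?_ (setLIntegral_le_lintegral (Ioc a0 z.re) _)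
    refine setLIntegral_mono' measurableSet_Ioc fun t ht => ?_
    have ht' := hmem t ⟨ht.1.le, ht.2⟩
    rw [hFD _ ht', enorm_le_iff_norm_le, norm_mul, norm_mul, (hcur _ ht'.2 ht'.1).1]
    simp only [norm_real, norm_I, mul_one]
    simpa using norm_inner_le_norm (𝕜 := ℝ) (c ⟨t, b⟩) 1
  rw [← ofReal_norm, ENNReal.ofReal_le_ofReal_iff (by norm_num)] at hen
  have hb' := hbot ⟨a0, b⟩ (hmem a0 ⟨le_rfl, hz'.1.1⟩).2 rfl
  have hze : (⟨z.re, b⟩ : ℂ) = z := by rw [← hzb]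
  rw [hze] at hen
  have h3 := norm_sub_le_norm_sub_add_norm_sub (G z) (G ⟨a0, b⟩) 1
  have h4 := abs_le.1 ((Complex.abs_re_le_norm (G z - 1)).trans (h3.trans (add_le_add hen hb')))
  simp only [sub_re, one_re] at h4
  linarith

namespace IsVortexFamily

variable {Ω : Set ℂ} {g : ℂ → ℂ} {n : ℕ} {d : Fin n → ℤ} {p : ℝ≥0∞} {U : Set (Config n)}
  {u v : Config n → ℂ → ℂ} {x y : Config n}

/-- On `∂Ω` both maps equal `g`, so the quotient `u_y conj u_x` is `1` there and extends
continuously by `1` outside `Ω`. -/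
theorem continuousOn_extend_one (h : IsVortexFamily Ω g d p U u v) (hx : x ∈ U) (hy : y ∈ U)
    [DecidablePred (· ∈ Ω)] :
    ContinuousOn (fun z => if z ∈ Ω then u y z * conj (u x z) else 1)
      (singularPoints x ∪ singularPoints y)ᶜ := by
  refine ContinuousOn.if (p := fun z => z ∈ Ω) ?_ ?_ continuousOn_const
  · rintro z ⟨-, hz⟩
    have hz : z ∈ frontier Ω := hz
    rw [(h.boundaryValues y hy).2 hz, (h.boundaryValues x hx).2 hz]
    exact mul_conj_of_norm_eq_one (h.datum.norm_eq_one z hz)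
  · refine ContinuousOn.mul ((h.boundaryValues y hy).1.mono ?_)
      (continuous_conj.comp_continuousOn ((h.boundaryValues x hx).1.mono ?_))
    · exact fun z hz => ⟨hz.2, fun h' => hz.1 (Or.inr h')⟩
    · exact fun z hz => ⟨hz.2, fun h' => hz.1 (Or.inl h')⟩

/-- Uniform convergence is not available up to `∂Ω`. In a rectangle aligned with the normal, the
inner side is a compact subset of `Ω`, where uniform closeness holds; two sides transverse to `∂Ω`
are selected by `L¹` smallness of the current; the outer side lies outside `Ω`. The maximum
principle on rectangles then controls the interior. -/
theorem exists_nhds_re_pos (h : IsVortexFamily Ω g d p U u v) (hx : x ∈ U) {q : ℂ}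
    (hq : q ∈ frontier Ω) :
    ∃ O ∈ 𝓝 q, ∀ᶠ y in 𝓝 x, ∀ z ∈ O ∩ Ω, 0 < (u y z * conj (u x z)).re := by
  classical
  have hO := h.domain.isOpen
  obtain ⟨ν, hν⟩ := h.domain.smooth_boundary q hq
  have hqΩ : q ∉ Ω := by rw [hO.frontier_eq] at hq; exact hq.2
  have hqx : q ∉ singularPoints x := by
    rintro ⟨j, rfl⟩; exact hqΩ ((h.subset hx).1 j)
  obtain ⟨ρ, hρ, hρq⟩ : ∃ ρ > 0, ball q (2 * ρ) ⊆ (singularPoints x)ᶜ := by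
    obtain ⟨r, hr, h1⟩ := Metric.mem_nhds_iff.1
      ((finite_singularPoints x).isClosed.isOpen_compl.mem_nhds hqx)
    exact ⟨r / 2, by positivity, by rwa [mul_div_cancel₀ _ two_ne_zero]⟩
  obtain ⟨hν1, α, hα, β, hβ, hrect⟩ := exists_normal_rect hO hq hν (ball_mem_nhds q hρ)
  set R := Icc (-α) α ×ℂ Icc (-β) β with hR
  have hRc : IsCompact R := isCompact_Icc.reProdIm isCompact_Icc
  let T : ℂ → ℂ := fun z => q + ν * z
  have hT : Continuous T := by fun_prop
  have hTperf : ∀ z ∈ R, T z ∈ Ω → T z ∈ perforated Ω x ρ := by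
    intro z hz hzΩ
    refine ⟨hzΩ, fun h1 => ?_⟩
    obtain ⟨j, hj⟩ := mem_iUnion.1 h1
    have h2 := (hrect z hz).1
    refine hρq (a := x j) ?_ ⟨j, rfl⟩
    have h3 := dist_triangle (x j) (T z) q
    rw [mem_ball] at hj h2 ⊢
    rw [dist_comm] at hj
    have : dist (T z) q < ρ := h2
    linarith
  have hTx : ∀ z ∈ R, T z ∉ singularPoints x := fun z hz h1 =>
    hρq (ball_subset_ball (by linarith) (hrect z hz).1) h1
  have hν0 : ν ≠ 0 := by intro h0; simp [h0] at hν1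
  have hTmp : MeasurePreserving T := by
    have h1 := (rotation ⟨ν, by simpa [Submonoid.unitSphere] using hν1⟩).measurePreserving
    have h2 := (measurePreserving_add_left (volume : Measure ℂ) q).comp h1
    exact h2
  have hTemb : MeasurableEmbedding T := by
    have : Topology.IsClosedEmbedding T :=
      ((Homeomorph.mulLeft₀ ν hν0).trans (Homeomorph.addLeft q)).isClosedEmbedding
    exact this.measurableEmbedding
  have hbotc : IsCompact (T '' ({-α} ×ℂ Icc (-β) β)) :=
    (isCompact_singleton.reProdIm isCompact_Icc).image hT
  have hbotR : ({-α} : Set ℝ) ×ℂ Icc (-β) β ⊆ R := by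
    intro z hz
    rw [mem_reProdIm] at hz
    rw [hR, mem_reProdIm]
    refine ⟨?_, hz.2⟩
    rw [mem_singleton_iff.1 hz.1]; exact ⟨le_rfl, by linarith⟩
  have hfam := h.eventually_forall_family_close hx hbotc (by
      rintro _ ⟨z, hz, rfl⟩
      exact (hrect z (hbotR hz)).2.1 ((mem_reProdIm.1 hz).1))
    (by rintro _ ⟨z, hz, rfl⟩; exact hTx z (hbotR hz)) (show (0 : ℝ) < 1 / 4 by norm_num)
  have hsing := eventually_notMem_singularPoints (hRc.image hT)
    (by rintro _ ⟨z, hz, rfl⟩; exact hTx z hz)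
  -- Half the width `β` is kept: the transverse sides will be chosen, depending on `y`, in the
  -- strips `[-β, -β / 2]` and `[β / 2, β]`, so the neighbourhood itself does not depend on `y`.
  refine ⟨{z | conj ν * (z - q) ∈ Ioo (-α) α ×ℂ Ioo (-(β / 2)) (β / 2)}, ?_, ?_⟩
  · refine IsOpen.mem_nhds ((isOpen_Ioo.reProdIm isOpen_Ioo).preimage (by fun_prop)) ?_
    simp [mem_reProdIm, hα, hβ]
  filter_upwards [h.mem_nhds hx, hfam, hsing,
    h.eventually_lintegral_current_sub_le hx hρ (show 0 < β / 2 / 4 by positivity)] with y hy h1 h2 h3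
  have hTy : ∀ z ∈ R, T z ∉ singularPoints y := fun z hz => h2 _ (mem_image_of_mem T hz)
  let D : Set ℂ := T ⁻¹' Ω
  have hD : IsOpen D := hO.preimage hT
  let G : ℂ → ℂ := fun z => if T z ∈ Ω then u y (T z) * conj (u x (T z)) else 1
  let c : ℂ → ℂ := fun z => conj ν *
    (vortexCurrent d y (v y) (T z) - vortexCurrent d x (v x) (T z))
  have hGc : ContinuousOn G R := by
    refine (h.continuousOn_extend_one hx hy).comp hT.continuousOn fun z hz => ?_
    rintro (h' | h')
    exacts [hTx z hz h', hTy z hz h']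
  have hG1 : ∀ z ∈ R, z ∉ D → G z = 1 := fun z _ hz => if_neg hz
  have hcur : ∀ z ∈ R, z ∈ D → HasCurrent G z (c z) := by
    intro z hz hzD
    have e1 := (h.hasCurrent hy ⟨hzD, hTy z hz⟩).mul (h.hasCurrent hx ⟨hzD, hTx z hz⟩).star
    have e2 : HasFDerivAt T (ν • ContinuousLinearMap.id ℝ ℂ) z := by
      have := ((hasFDerivAt_id (𝕜 := ℝ) z).const_mul ν).const_add q
      exact this
    have e3 := e1.comp (p := ν) (q := 0) e2 (by intro w; simp)
    rw [zero_mul, add_zero, ← sub_eq_add_neg] at e3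
    refine e3.congr_of_eventuallyEq ?_
    filter_upwards [hD.mem_nhds hzD] with w hw
    exact if_pos hw
  have hdiff : DifferentiableOn ℂ (fun z => conj (c z)) (D ∩ R) := by
    have e1 : ∀ z, conj (c z) = ν * (conj (vortexCurrent d y (v y) (T z)) -
        conj (vortexCurrent d x (v x) (T z))) := by intro z; simp [c]
    simp_rw [e1]
    have hTd : DifferentiableOn ℂ T (D ∩ R) := by
      have : Differentiable ℂ T := by fun_prop
      exact this.differentiableOn
    refine DifferentiableOn.const_mul (DifferentiableOn.sub ?_ ?_) ν
    · exact (differentiableOn_conj_vortexCurrent hO (h.harmonic y hy)).comp hTd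
        fun z hz => ⟨hz.1, hTy z hz.2⟩
    · exact (differentiableOn_conj_vortexCurrent hO (h.harmonic x hx)).comp hTd
        fun z hz => ⟨hz.1, hTx z hz.2⟩
  have hcc : ContinuousOn c (D ∩ R) := by
    have := continuous_conj.comp_continuousOn hdiff.continuousOn
    exact this.congr fun z _ => by simp
  have hint : ∫⁻ z in D ∩ R, ‖c z‖ₑ ≤ ENNReal.ofReal (β / 2 / 4) := by
    have e1 : ∀ z, ‖c z‖ₑ = ‖vortexCurrent d y (v y) (T z) - vortexCurrent d x (v x) (T z)‖ₑ := by
      intro z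
      rw [← ofReal_norm, ← ofReal_norm, norm_mul, norm_conj, hν1, one_mul]
    simp_rw [e1]
    refine (lintegral_mono_set (fun z hz => hTperf z hz.2 hz.1)).trans (le_trans (le_of_eq ?_) h3)
    exact hTmp.setLIntegral_comp_preimage_emb hTemb
      (fun z => ‖vortexCurrent d y (v y) z - vortexCurrent d x (v x) z‖ₑ) (perforated Ω x ρ)
  have hbot : ∀ z ∈ R, z.re = -α → ‖G z - 1‖ ≤ 1 / 4 := by
    intro z hz hza
    have e1 : z ∈ ({-α} : Set ℝ) ×ℂ Icc (-β) β := by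
      rw [mem_reProdIm]; exact ⟨hza, ((mem_reProdIm.1 hz).2)⟩
    have e2 := h1 _ (mem_image_of_mem T e1)
    simp only [G]
    rwa [if_pos ((hrect z hz).2.1 hza)]
  have hmono : ∀ z ∈ R, z ∉ D → ∀ w ∈ R, w.im = z.im → z.re ≤ w.re → w ∉ D :=
    fun z hz hzD => (hrect z hz).2.2.2 hzD
  have hsub : ∀ {b₀ b₁ : ℝ}, -β ≤ b₀ → b₁ ≤ β → Icc (-α) α ×ℂ Icc b₀ b₁ ⊆ R := by
    intro b₀ b₁ e0 e1 z hz
    rw [mem_reProdIm] at hz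
    rw [hR, mem_reProdIm]
    exact ⟨hz.1, e0.trans hz.2.1, hz.2.2.trans e1⟩
  have side : ∀ {b₀ b₁ : ℝ}, -β ≤ b₀ → b₁ ≤ β → b₁ - b₀ = β / 2 →
      ∃ b ∈ Icc b₀ b₁, ∀ z ∈ Icc (-α) α ×ℂ Icc b₀ b₁, z.im = b → 0 < (G z).re := by
    intro b₀ b₁ e0 e1 e2
    have s := hsub e0 e1
    refine exists_side_re_pos (by linarith) hD (fun z hz => hG1 z (s hz))
      (fun z hz => hcur z (s hz)) (hcc.mono (inter_subset_inter_right _ s))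
      (fun z hz e3 w hw => hmono z (s hz) e3 w (s hw)) (fun z hz => hbot z (s hz)) ?_
    rw [e2]
    exact (lintegral_mono_set (inter_subset_inter_right _ s)).trans hint
  obtain ⟨b₀, hb₀, hs₀⟩ := side (b₀ := -β) (b₁ := -(β / 2)) le_rfl (by linarith) (by ring)
  obtain ⟨b₁, hb₁, hs₁⟩ := side (b₀ := β / 2) (b₁ := β) (by linarith) le_rfl (by ring)
  have s := hsub hb₀.1 hb₁.2
  have hmain : ∀ z ∈ Icc (-α) α ×ℂ Icc b₀ b₁, 0 < (G z).re := by
    intro z hz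
    refine re_pos_of_rect (by linarith) (by linarith [hb₀.2, hb₁.1]) hD (hGc.mono s)
      (fun z hz => hG1 z (s hz)) (fun z hz => hcur z (s hz))
      (hdiff.mono (inter_subset_inter_right _ s)) (fun z hz => (hrect z (s hz)).2.2.1)
      (fun z hz e3 w hw => hmono z (s hz) e3 w (s hw)) (fun z hz hor => ?_) hz
    rw [mem_reProdIm] at hz
    rcases hor with e | e | e
    · have e2 := hbot z (s (mem_reProdIm.2 hz)) e
      have e4 := abs_le.1 ((Complex.abs_re_le_norm (G z - 1)).trans e2)
      simp only [sub_re, one_re] at e4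
      linarith
    · exact hs₀ z (mem_reProdIm.2 ⟨hz.1, by rw [e]; exact hb₀⟩) e
    · exact hs₁ z (mem_reProdIm.2 ⟨hz.1, by rw [e]; exact hb₁⟩) e
  rintro z ⟨hz, hzΩ⟩
  have hTz : T (conj ν * (z - q)) = z := by
    have := mul_conj_of_norm_eq_one hν1
    simp only [T]
    rw [← mul_assoc, this]; ring
  have hz : conj ν * (z - q) ∈ Ioo (-α) α ×ℂ Ioo (-(β / 2)) (β / 2) := hz
  have e1 := hmain (conj ν * (z - q)) (by
    rw [mem_reProdIm] at hz ⊢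
    exact ⟨Ioo_subset_Icc_self hz.1, by linarith [hz.2.1, hb₀.2], by linarith [hz.2.2, hb₁.1]⟩)
  simp only [G, hTz] at e1
  rwa [if_pos hzΩ] at e1

/-- Near the boundary the maps of the family are close to each other. -/
theorem exists_isCompact_re_pos (h : IsVortexFamily Ω g d p U u v) (hx : x ∈ U) :
    ∃ K ⊆ Ω, IsCompact K ∧ singularPoints x ⊆ K ∧
      ∀ᶠ y in 𝓝 x, ∀ z ∈ Ω \ K, 0 < (u y z * conj (u x z)).re := by
  have hO := h.domain.isOpen
  have hc : IsCompact (frontier Ω) :=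
    h.domain.isBounded.isCompact_closure.of_isClosed_subset isClosed_frontier frontier_subset_closure
  obtain ⟨O, hOo, hsub, hP⟩ : ∃ O, IsOpen O ∧ frontier Ω ⊆ O ∧
      ∀ᶠ y in 𝓝 x, ∀ z ∈ O ∩ Ω, 0 < (u y z * conj (u x z)).re := by
    refine hc.induction_on (p := fun s => ∃ O, IsOpen O ∧ s ⊆ O ∧
      ∀ᶠ y in 𝓝 x, ∀ z ∈ O ∩ Ω, 0 < (u y z * conj (u x z)).re) ?_ ?_ ?_ ?_
    · exact ⟨∅, isOpen_empty, le_rfl, by simp⟩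
    · rintro s t hst ⟨O, h1, h2, h3⟩
      exact ⟨O, h1, hst.trans h2, h3⟩
    · rintro s t ⟨O, h1, h2, h3⟩ ⟨O', h1', h2', h3'⟩
      refine ⟨O ∪ O', h1.union h1', union_subset_union h2 h2', ?_⟩
      filter_upwards [h3, h3'] with y e1 e2 z hz
      exact hz.1.elim (fun hz1 => e1 z ⟨hz1, hz.2⟩) fun hz1 => e2 z ⟨hz1, hz.2⟩
    · intro q hq
      obtain ⟨O, hOq, h1⟩ := h.exists_nhds_re_pos hx hq
      refine ⟨interior O, mem_nhdsWithin_of_mem_nhds (interior_mem_nhds.2 hOq), interior O,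
        isOpen_interior, le_rfl, ?_⟩
      filter_upwards [h1] with y e1 z hz using e1 z ⟨interior_subset hz.1, hz.2⟩
  have hKc : IsCompact (closure Ω \ O) := h.domain.isBounded.isCompact_closure.diff hOo
  refine ⟨closure Ω \ O ∪ singularPoints x, ?_, hKc.union (finite_singularPoints x).isCompact,
    subset_union_right, ?_⟩
  · rintro z (hz | ⟨j, rfl⟩)
    · by_contra hzΩ
      exact hz.2 (hsub (by rw [hO.frontier_eq]; exact ⟨hz.1, hzΩ⟩))
    · exact (h.subset hx).1 j
  · filter_upwards [hP] with y e1 z hz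
    refine e1 z ⟨?_, hz.1⟩
    by_contra hzO
    exact hz.2 (Or.inl ⟨subset_closure hz.1, hzO⟩)

end IsVortexFamily

end BoundaryCloseness

/-! ### Deformations of the domain that move the singularities -/

section Deformation

open Complex Metric Filter
open scoped ComplexConjugate

/-- A smooth radial cutoff, equal to `1` at distance at most `r` from `a` and to `0` at distance at
least `2 r`. -/
noncomputable def radialCutoff (r : ℝ) (a z : ℂ) : ℝ :=
  Real.smoothTransition (2 - ‖z - a‖ ^ 2 / r ^ 2)

/-- The derivative of the radial cutoff with respect to `‖z - a‖ ^ 2`. -/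
noncomputable def radialCutoffDeriv (r : ℝ) (a z : ℂ) : ℝ :=
  -(deriv Real.smoothTransition (2 - ‖z - a‖ ^ 2 / r ^ 2) / r ^ 2)

variable {r : ℝ} {a z : ℂ}

theorem radialCutoff_eq_one (hr : 0 < r) (h : ‖z - a‖ ≤ r) : radialCutoff r a z = 1 := by
  refine Real.smoothTransition.one_of_one_le ?_
  have : ‖z - a‖ ^ 2 / r ^ 2 ≤ 1 := by
    rw [div_le_one (by positivity)]; gcongr
  linarith

theorem radialCutoff_eq_zero (hr : 0 < r) (h : 2 * r ≤ ‖z - a‖) : radialCutoff r a z = 0 := by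
  refine Real.smoothTransition.zero_of_nonpos ?_
  have : 2 ≤ ‖z - a‖ ^ 2 / r ^ 2 := by
    rw [le_div_iff₀ (by positivity)]
    nlinarith
  linarith

theorem radialCutoff_mem_Icc : radialCutoff r a z ∈ Icc (0 : ℝ) 1 :=
  ⟨Real.smoothTransition.nonneg _, Real.smoothTransition.le_one _⟩

theorem contDiff_radialCutoff (r : ℝ) (a : ℂ) : ContDiff ℝ ∞ (radialCutoff r a) := by
  refine Real.smoothTransition.contDiff.comp ?_
  have h1 : ContDiff ℝ ∞ fun z : ℂ => ‖z - a‖ ^ 2 := (contDiff_id.sub contDiff_const).norm_sq ℝ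
  exact contDiff_const.sub (h1.div_const _)

theorem hasDerivAt_smoothTransition (t : ℝ) :
    HasDerivAt Real.smoothTransition (deriv Real.smoothTransition t) t :=
  ((Real.smoothTransition.contDiff (n := 1)).differentiable (by simp) t).hasDerivAt

theorem continuous_deriv_smoothTransition : Continuous (deriv Real.smoothTransition) :=
  (Real.smoothTransition.contDiff (n := 1)).continuous_deriv (by simp)

theorem deriv_smoothTransition_eq_zero {t : ℝ} (h : t < 0 ∨ 1 < t) :
    deriv Real.smoothTransition t = 0 := by
  rcases h with h | h
  · have : Real.smoothTransition =ᶠ[𝓝 t] fun _ => 0 := by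
      filter_upwards [gt_mem_nhds h] with s hs
      exact Real.smoothTransition.zero_of_nonpos hs.le
    rw [this.deriv_eq, deriv_const]
  · have : Real.smoothTransition =ᶠ[𝓝 t] fun _ => 1 := by
      filter_upwards [lt_mem_nhds h] with s hs
      exact Real.smoothTransition.one_of_one_le hs.le
    rw [this.deriv_eq, deriv_const]

theorem continuous_radialCutoffDeriv (r : ℝ) (a : ℂ) : Continuous (radialCutoffDeriv r a) := by
  unfold radialCutoffDeriv
  have := continuous_deriv_smoothTransition
  fun_prop

theorem radialCutoffDeriv_eq_zero (hr : 0 < r) (h : ‖z - a‖ < r ∨ 2 * r ≤ ‖z - a‖) :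
    radialCutoffDeriv r a z = 0 := by
  have : deriv Real.smoothTransition (2 - ‖z - a‖ ^ 2 / r ^ 2) = 0 := by
    apply deriv_smoothTransition_eq_zero
    rcases h with h | h
    · right
      have : ‖z - a‖ ^ 2 / r ^ 2 < 1 := by
        rw [div_lt_one (by positivity)]; gcongr
      linarith
    · left
      have : 2 < ‖z - a‖ ^ 2 / r ^ 2 := by
        rw [lt_div_iff₀ (by positivity)]
        have : 0 < r ^ 2 := by positivity
        nlinarith
      linarith
  rw [radialCutoffDeriv, this, zero_div, neg_zero]

theorem hasFDerivAt_radialCutoff (r : ℝ) (a z : ℂ) :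
    HasFDerivAt (radialCutoff r a) ((2 * radialCutoffDeriv r a z) • innerSL ℝ (z - a)) z := by
  have h0 : HasFDerivAt (fun w : ℂ => w - a) (ContinuousLinearMap.id ℝ ℂ) z :=
    (hasFDerivAt_id z).sub_const a
  have h1 : HasFDerivAt (fun w : ℂ => ‖w - a‖ ^ 2)
      (2 • (innerSL ℝ (z - a)).comp (ContinuousLinearMap.id ℝ ℂ)) z := h0.norm_sq
  have h2 := (h1.mul_const (r ^ 2)⁻¹).const_sub 2
  have h3 := (hasDerivAt_smoothTransition (2 - ‖z - a‖ ^ 2 * (r ^ 2)⁻¹)).comp_hasFDerivAt z h2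
  refine (h3.congr_of_eventuallyEq (Eventually.of_forall fun w => ?_)).congr_fderiv ?_
  · simp [radialCutoff, div_eq_mul_inv]
  · ext w
    simp only [radialCutoffDeriv, smul_apply, neg_apply, ContinuousLinearMap.comp_apply,
      ContinuousLinearMap.id_apply, smul_eq_mul, nsmul_eq_mul, div_eq_mul_inv]
    push_cast; ring

theorem exists_radialCutoffDeriv_mul_le (hr : 0 < r) (a : ℂ) :
    ∃ C, 0 ≤ C ∧ ∀ z, |radialCutoffDeriv r a z| * ‖z - a‖ ≤ C := by
  obtain ⟨C, hC⟩ := (isCompact_closedBall a (2 * r)).exists_bound_of_continuousOn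
    ((continuous_radialCutoffDeriv r a).mul (by fun_prop : Continuous fun z => ‖z - a‖)).continuousOn
  refine ⟨max C 0, le_max_right _ _, fun z => ?_⟩
  by_cases h : z ∈ closedBall a (2 * r)
  · have := hC z h
    rw [Pi.mul_apply, Real.norm_eq_abs, abs_mul, abs_norm] at this
    exact this.trans (le_max_left _ _)
  · rw [mem_closedBall, not_le, dist_eq_norm] at h
    rw [radialCutoffDeriv_eq_zero hr (Or.inr h.le), abs_zero, zero_mul]
    exact le_max_right _ _

/-- A radius such that the discs of four times this radius around the points of the configuration
are contained in `Ω` and disjoint. -/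
structure IsClearRadius (Ω : Set ℂ) {n : ℕ} (x : Config n) (r : ℝ) : Prop where
  pos : 0 < r
  subset : ∀ j, closedBall (x j) (4 * r) ⊆ Ω
  separated : ∀ j l, l ≠ j → 8 * r < dist (x l) (x j)

variable {n : ℕ} {x y : Config n} {Ω : Set ℂ}

theorem exists_isClearRadius (hΩ : IsOpen Ω) (hx : x ∈ configSpace Ω n) :
    ∃ r, IsClearRadius Ω x r := by
  obtain ⟨R, hR, h1, h2⟩ := exists_radius hΩ hx
  refine ⟨R / 4, by positivity, fun j => ?_, fun j l h => ?_⟩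
  · rw [mul_div_cancel₀ _ (by norm_num)]; exact h1 j
  · have := h2 j l h; linarith

/-- The deformation of the plane that moves the points `x` to the points `y`. -/
noncomputable def deformation (r : ℝ) (x y : Config n) (z : ℂ) : ℂ :=
  z + ∑ j, radialCutoff r (x j) z * (y j - x j)

/-- The `∂`-derivative of the displacement. -/
noncomputable def deformationDel (r : ℝ) (x y : Config n) (z : ℂ) : ℂ :=
  ∑ j, radialCutoffDeriv r (x j) z * conj (z - x j) * (y j - x j)

/-- The `∂̄`-derivative of the displacement. -/
noncomputable def deformationDelBar (r : ℝ) (x y : Config n) (z : ℂ) : ℂ :=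
  ∑ j, radialCutoffDeriv r (x j) z * (z - x j) * (y j - x j)

theorem norm_coord_sub_le (x y : Config n) (j : Fin n) : ‖y j - x j‖ ≤ ‖y - x‖ :=
  PiLp.norm_apply_le (y - x) j

/-- The differential of the cutoff is `2χ' ⟨z - a, w⟩ = χ' (conj (z - a) w + (z - a) conj w)`, where
`χ'` is the derivative with respect to the squared distance; this separates the `∂` and `∂̄` parts.
-/
theorem hasFDerivAt_deformation (r : ℝ) (x y : Config n) (z : ℂ) :
    HasFDerivAt (deformation r x y)
      ((1 + deformationDel r x y z) • ContinuousLinearMap.id ℝ ℂ +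
        deformationDelBar r x y z • conjCLE.toContinuousLinearMap) z := by
  have h1 : ∀ j, HasFDerivAt (fun z => (radialCutoff r (x j) z : ℂ) * (y j - x j))
      ((ofRealCLM.comp ((2 * radialCutoffDeriv r (x j) z) • innerSL ℝ (z - x j))).smulRight
        (y j - x j)) z := by
    intro j
    refine ((ofRealCLM.hasFDerivAt.comp z (hasFDerivAt_radialCutoff r (x j) z)).mul_const
      (y j - x j)).congr_fderiv ?_
    ext w; simp [mul_comm]
  refine ((hasFDerivAt_id z).add (HasFDerivAt.fun_sum fun j (_ : j ∈ Finset.univ) =>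
    h1 j)).congr_fderiv ?_
  ext w
  simp only [add_apply, ContinuousLinearMap.id_apply, sum_apply,
    ContinuousLinearMap.smulRight_apply, ContinuousLinearMap.comp_apply, smul_apply,
    innerSL_apply_apply, smul_eq_mul, ofRealCLM_apply, real_inner_eq_re_mul, deformationDel,
    deformationDelBar, ContinuousLinearEquiv.coe_coe, conjCLE_apply]
  rw [add_mul, one_mul, add_assoc, Finset.sum_mul, Finset.sum_mul, ← Finset.sum_add_distrib]
  congr 1
  refine Finset.sum_congr rfl fun j _ => ?_
  have e : (((z - x j).re * w.re + (z - x j).im * w.im : ℝ) : ℂ) * 2 =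
      conj (z - x j) * w + (z - x j) * conj w := by
    apply Complex.ext <;> simp <;> ring
  push_cast at e ⊢
  linear_combination (radialCutoffDeriv r (x j) z : ℂ) * (y j - x j) * e

theorem contDiff_deformation (r : ℝ) (x y : Config n) : ContDiff ℝ ∞ (deformation r x y) := by
  refine contDiff_id.add (ContDiff.sum fun j _ => ?_)
  exact (ofRealCLM.contDiff.comp (contDiff_radialCutoff r (x j))).mul contDiff_const

theorem exists_deformationDel_le (hr : 0 < r) (x : Config n) :
    ∃ C, 0 ≤ C ∧ ∀ y z, ‖deformationDel r x y z‖ ≤ C * ‖y - x‖ ∧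
      ‖deformationDelBar r x y z‖ ≤ C * ‖y - x‖ := by
  choose C hC0 hC using fun j => exists_radialCutoffDeriv_mul_le hr (x j)
  refine ⟨∑ j, C j, Finset.sum_nonneg fun j _ => hC0 j, fun y z => ⟨?_, ?_⟩⟩
  · refine (norm_sum_le _ _).trans ?_
    rw [Finset.sum_mul]
    refine Finset.sum_le_sum fun j _ => ?_
    rw [norm_mul, norm_mul, norm_conj, norm_real, Real.norm_eq_abs]
    exact mul_le_mul (hC j z) (norm_coord_sub_le x y j) (norm_nonneg _) (hC0 j)
  · refine (norm_sum_le _ _).trans ?_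
    rw [Finset.sum_mul]
    refine Finset.sum_le_sum fun j _ => ?_
    rw [norm_mul, norm_mul, norm_real, Real.norm_eq_abs]
    exact mul_le_mul (hC j z) (norm_coord_sub_le x y j) (norm_nonneg _) (hC0 j)

theorem deformation_eq_self (hr : 0 < r) (y : Config n) (h : ∀ j, 2 * r ≤ ‖z - x j‖) :
    deformation r x y z = z := by
  rw [deformation, Finset.sum_eq_zero, add_zero]
  intro j _
  rw [radialCutoff_eq_zero hr (h j), ofReal_zero, zero_mul]

theorem norm_deformation_sub_le (r : ℝ) (x y : Config n) (z : ℂ) :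
    ‖deformation r x y z - z‖ ≤ n * ‖y - x‖ := by
  rw [deformation, add_sub_cancel_left]
  refine (norm_sum_le _ _).trans ?_
  have : ∀ j ∈ Finset.univ, ‖(radialCutoff r (x j) z : ℂ) * (y j - x j)‖ ≤ ‖y - x‖ := fun j _ => by
    rw [norm_mul, norm_real, Real.norm_eq_abs, abs_of_nonneg radialCutoff_mem_Icc.1]
    have := mul_le_mul radialCutoff_mem_Icc.2 (norm_coord_sub_le x y j) (norm_nonneg _)
      (zero_le_one' ℝ) (a := radialCutoff r (x j) z)
    rwa [one_mul] at this
  refine (Finset.sum_le_sum this).trans ?_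
  simp

theorem deformationDel_eq_zero (hr : 0 < r) (y : Config n)
    (h : ∀ j, ‖z - x j‖ < r ∨ 2 * r ≤ ‖z - x j‖) :
    deformationDel r x y z = 0 ∧ deformationDelBar r x y z = 0 := by
  constructor <;>
  · refine Finset.sum_eq_zero fun j _ => ?_
    rw [radialCutoffDeriv_eq_zero hr (h j), ofReal_zero, zero_mul, zero_mul]

theorem continuous_deformationDelBar (r : ℝ) (x y : Config n) :
    Continuous (deformationDelBar r x y) := by
  unfold deformationDelBar
  have := fun j => continuous_radialCutoffDeriv r (x j)
  fun_prop

theorem continuous_deformationDel (r : ℝ) (x y : Config n) :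
    Continuous (deformationDel r x y) := by
  unfold deformationDel
  have := fun j => continuous_radialCutoffDeriv r (x j)
  fun_prop

theorem det_smul_id_add_smul_conj (P q : ℂ) :
    (P • ContinuousLinearMap.id ℝ ℂ + q • conjCLE.toContinuousLinearMap : ℂ →L[ℝ] ℂ).det =
      ‖P‖ ^ 2 - ‖q‖ ^ 2 := by
  rw [ContinuousLinearMap.det, ← LinearMap.det_toMatrix basisOneI, Matrix.det_fin_two]
  simp only [LinearMap.toMatrix_apply, ← Complex.normSq_eq_norm_sq, Complex.normSq_apply]
  simp
  ring

namespace IsClearRadius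

theorem far_of_near (h : IsClearRadius Ω x r) {j l : Fin n} (hl : l ≠ j)
    (hz : ‖z - x j‖ ≤ 4 * r) : 4 * r < ‖z - x l‖ := by
  have h1 := h.separated j l hl
  have h2 := dist_triangle (x l) z (x j)
  rw [dist_comm (x l) z, dist_eq_norm z, dist_eq_norm z] at h2
  linarith

theorem deformation_eq_translation (h : IsClearRadius Ω x r) (y : Config n) {j : Fin n}
    (hz : ‖z - x j‖ ≤ r) : deformation r x y z = z + (y j - x j) := by
  have hr := h.pos
  rw [deformation, Finset.sum_eq_single j, radialCutoff_eq_one hr hz, ofReal_one, one_mul]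
  · intro l _ hl
    have := h.far_of_near hl (z := z) (by linarith)
    rw [radialCutoff_eq_zero hr (by linarith), ofReal_zero, zero_mul]
  · simp

theorem deformation_apply (h : IsClearRadius Ω x r) (y : Config n) (j : Fin n) :
    deformation r x y (x j) = y j := by
  rw [h.deformation_eq_translation y (j := j) (by simpa using h.pos.le)]; ring

/-- Small deformations are diffeomorphisms of the domain, and translations near the points. -/
theorem exists_homeomorph (h : IsClearRadius Ω x r) : ∃ ε > 0, ∀ y : Config n, ‖y - x‖ < ε →
    ∃ e : ℂ ≃ₜ ℂ, (∀ z, e z = deformation r x y z) ∧ ContDiff ℝ 1 e.symm ∧ e ⁻¹' Ω = Ω ∧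
      (∀ ρ ≤ r, e ⁻¹' perforated Ω y ρ = perforated Ω x ρ) ∧
      ∀ z, ‖deformationDelBar r x y z‖ ^ 2 < ‖1 + deformationDel r x y z‖ ^ 2 := by
  have hr := h.pos
  obtain ⟨C, hC0, hC⟩ := exists_deformationDel_le hr x
  -- The first bound makes each of the two parts of the differential of the displacement at most `1
  -- / 4`, so that the displacement is `1 / 2`-Lipschitz; the second makes the displacement smaller
  -- than `r`.
  refine ⟨min (1 / (4 * (C + 1))) (r / (n + 1)), by positivity, fun y hy => ?_⟩
  have hy1 : C * ‖y - x‖ ≤ 1 / 4 := by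
    have h1 := hy.trans_le (min_le_left _ _)
    calc C * ‖y - x‖ ≤ (C + 1) * (1 / (4 * (C + 1))) := by gcongr <;> linarith
      _ = 1 / 4 := by field_simp
  have hy2 : n * ‖y - x‖ < r := by
    have h1 := hy.trans_le (min_le_right _ _)
    rw [lt_div_iff₀ (by positivity)] at h1
    nlinarith [norm_nonneg (y - x)]
  have hdet : ∀ z, ‖deformationDelBar r x y z‖ ^ 2 < ‖1 + deformationDel r x y z‖ ^ 2 := by
    intro z
    have h1 := (hC y z).1.trans hy1
    have h2 := (hC y z).2.trans hy1
    have h3 : 1 - ‖deformationDel r x y z‖ ≤ ‖1 + deformationDel r x y z‖ := by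
      have := norm_sub_le (1 + deformationDel r x y z) (deformationDel r x y z)
      rw [add_sub_cancel_right, norm_one] at this
      linarith
    have h4 := norm_nonneg (deformationDelBar r x y z)
    gcongr
    linarith
  -- A perturbation of the identity with Lipschitz constant less than `1` is a homeomorphism of the
  -- plane.
  have happ : ApproximatesLinearOn (deformation r x y)
      (ContinuousLinearEquiv.refl ℝ ℂ : ℂ →L[ℝ] ℂ) univ (1 / 2) := by
    rw [ApproximatesLinearOn.approximatesLinearOn_iff_lipschitzOnWith, lipschitzOnWith_univ]
    have hd : ∀ z, HasFDerivAt (deformation r x y - ⇑(ContinuousLinearEquiv.refl ℝ ℂ : ℂ →L[ℝ] ℂ))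
        (deformationDel r x y z • ContinuousLinearMap.id ℝ ℂ +
          deformationDelBar r x y z • conjCLE.toContinuousLinearMap) z := fun z => by
      refine ((hasFDerivAt_deformation r x y z).sub
        (ContinuousLinearEquiv.refl ℝ ℂ : ℂ →L[ℝ] ℂ).hasFDerivAt).congr_fderiv ?_
      ext w; simp; ring
    refine lipschitzWith_of_nnnorm_fderiv_le (𝕜 := ℝ) (fun z => (hd z).differentiableAt) fun z => ?_
    rw [(hd z).fderiv, ← NNReal.coe_le_coe, coe_nnnorm]
    refine ContinuousLinearMap.opNorm_le_bound _ (by positivity) fun w => ?_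
    simp only [add_apply, smul_apply, ContinuousLinearMap.id_apply, smul_eq_mul,
      ContinuousLinearEquiv.coe_coe, conjCLE_apply]
    refine (norm_add_le _ _).trans ?_
    rw [norm_mul, norm_mul, norm_conj, ← add_mul]
    gcongr
    push_cast
    linarith [(hC y z).1, (hC y z).2]
  let e : ℂ ≃ₜ ℂ := happ.toHomeomorph (deformation r x y) (Or.inr (by
    have h1 : ‖((ContinuousLinearEquiv.refl ℝ ℂ).symm : ℂ →L[ℝ] ℂ)‖₊ = 1 := by
      rw [ContinuousLinearEquiv.refl_symm, ← NNReal.coe_inj, coe_nnnorm]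
      exact ContinuousLinearMap.norm_id
    rw [h1, inv_one]
    exact NNReal.half_lt_self one_ne_zero))
  have he : ∀ z, e z = deformation r x y z := fun z => rfl
  have hout : ∀ z ∉ Ω, e z = z := fun z hz => by
    rw [he, deformation_eq_self hr]
    intro j
    by_contra! hlt
    refine hz (h.subset j ?_)
    rw [mem_closedBall, dist_eq_norm]; linarith
  have hin : ∀ z ∈ Ω, e z ∈ Ω := fun z hz => by
    by_cases hj : ∀ j, 2 * r ≤ ‖z - x j‖
    · rw [he, deformation_eq_self hr y hj]; exact hz
    · push Not at hj
      obtain ⟨j, hj⟩ := hj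
      refine h.subset j ?_
      have h1 := (norm_deformation_sub_le r x y z).trans_lt hy2
      have h2 := norm_sub_le_norm_sub_add_norm_sub (e z) z (x j)
      rw [← he] at h1
      rw [mem_closedBall, dist_eq_norm]; linarith
  have hpre : e ⁻¹' Ω = Ω := by
    ext z
    refine ⟨fun hz => ?_, fun hz => hin z hz⟩
    by_contra hz'
    rw [mem_preimage, hout z hz'] at hz
    exact hz' hz
  have hball : ∀ ρ ≤ r, ∀ z j, e z ∈ ball (y j) ρ ↔ z ∈ ball (x j) ρ := by
    intro ρ hρ z j
    have htr : ∀ w ∈ ball (x j) ρ, e w = w + (y j - x j) := fun w hw => by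
      rw [mem_ball, dist_eq_norm] at hw
      exact h.deformation_eq_translation y (hw.le.trans hρ)
    refine ⟨fun hz => ?_, fun hz => ?_⟩
    -- The translated point is a preimage of `e z` in the disc at `x j`; by injectivity it is `z`.
    · have hw : e z - (y j - x j) ∈ ball (x j) ρ := by
        rw [mem_ball, dist_eq_norm] at hz ⊢
        convert hz using 2; ring
      have h1 := htr _ hw
      rw [sub_add_cancel] at h1
      rwa [e.injective h1] at hw
    · rw [htr z hz]
      rw [mem_ball, dist_eq_norm] at hz ⊢
      convert hz using 2; ring
  refine ⟨e, he, ?_, hpre, fun ρ hρ => ?_, hdet⟩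
  · have hne : ∀ z, ((1 + deformationDel r x y z) • ContinuousLinearMap.id ℝ ℂ +
        deformationDelBar r x y z • conjCLE.toContinuousLinearMap : ℂ →L[ℝ] ℂ).det ≠ 0 := fun z => by
      rw [det_smul_id_add_smul_conj]
      exact (sub_pos.2 (hdet z)).ne'
    refine e.contDiff_symm (f₀' := fun z => ContinuousLinearMap.toContinuousLinearEquivOfDetNeZero _
      (hne z)) (fun z => ?_) ((contDiff_deformation r x y).of_le (by simp))
    rw [ContinuousLinearMap.coe_toContinuousLinearEquivOfDetNeZero]
    exact hasFDerivAt_deformation r x y z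
  · rw [perforated, perforated, preimage_sdiff, hpre, preimage_iUnion]
    congr 1
    refine iUnion_congr fun j => ?_
    ext z; exact hball ρ hρ z j

end IsClearRadius

end Deformation

/-! ### The global relative phase of the deformed map -/

section DeformedPhase

open Complex Metric Filter
open scoped ComplexConjugate ENNReal

/-- The unit vector in the direction of `z`, with value `1` at the origin. -/
noncomputable def unitOrOne (z : ℂ) : ℂ := if z = 0 then 1 else z / (‖z‖ : ℂ)

theorem norm_unitOrOne (z : ℂ) : ‖unitOrOne z‖ = 1 := by
  unfold unitOrOne
  split_ifs with h
  · simp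
  · exact norm_unit h

theorem unitOrOne_of_ne {z : ℂ} (h : z ≠ 0) : unitOrOne z = z / (‖z‖ : ℂ) := if_neg h

theorem contDiffAt_unitOrOne {z : ℂ} (h : z ≠ 0) : ContDiffAt ℝ 1 unitOrOne z :=
  (contDiffAt_unit h).congr_of_eventuallyEq (by
    filter_upwards [isOpen_ne.mem_nhds h] with w hw using unitOrOne_of_ne hw)

theorem _root_.ContDiffAt.zpow_complex {E : Type*} [NormedAddCommGroup E] [NormedSpace ℝ E]
    {f : E → ℂ} {z : E} {m : WithTop ℕ∞} (hf : ContDiffAt ℝ m f z) (h0 : f z ≠ 0) (k : ℤ) :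
    ContDiffAt ℝ m (fun w => f w ^ k) z := by
  cases k with
  | ofNat k => simpa using hf.pow k
  | negSucc k =>
    simp only [zpow_negSucc]
    exact (hf.pow (k + 1)).inv (pow_ne_zero _ h0)

variable {n : ℕ} {x y : Config n} {Ω : Set ℂ} {r : ℝ} {z : ℂ}

/-- The phase shift between the canonical phase of `y` composed with the deformation and the
canonical phase of `x`. -/
noncomputable def deformedPhase (d : Fin n → ℤ) (r : ℝ) (x y : Config n) (z : ℂ) : ℂ :=
  ∏ l, (unitOrOne (deformation r x y z - y l) * conj (unitOrOne (z - x l))) ^ d l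

theorem deformedPhase_eq (d : Fin n → ℤ) (hF : ∀ l, deformation r x y z = y l ↔ z = x l)
    (hz : z ∉ singularPoints x) :
    deformedPhase d r x y z = vortexPhase d y (deformation r x y z) * conj (vortexPhase d x z) := by
  rw [deformedPhase, vortexPhase, vortexPhase, map_prod, ← Finset.prod_mul_distrib]
  refine Finset.prod_congr rfl fun l _ => ?_
  have h1 := ne_of_notMem_singularPoints hz l
  have h2 : deformation r x y z ≠ y l := fun h => h1 ((hF l).1 h)
  rw [unitOrOne_of_ne (sub_ne_zero.2 h1), unitOrOne_of_ne (sub_ne_zero.2 h2), mul_zpow, map_zpow₀]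

/-- Near `x l` the deformation is a translation, so the two unit vectors coincide. The value given
to `unitOrOne` at the origin makes this hold at `x l` too, and the product is smooth across the
singularities. -/
theorem IsClearRadius.phase_factor_eq_one (h : IsClearRadius Ω x r) (y : Config n) {l : Fin n}
    (hz : ‖z - x l‖ ≤ r) :
    unitOrOne (deformation r x y z - y l) * conj (unitOrOne (z - x l)) = 1 := by
  rw [h.deformation_eq_translation y hz, show z + (y l - x l) - y l = z - x l by ring]
  exact mul_conj_of_norm_eq_one (norm_unitOrOne _)

theorem IsClearRadius.contDiffAt_deformedPhase (h : IsClearRadius Ω x r) (d : Fin n → ℤ)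
    (hF : ∀ l, deformation r x y z = y l ↔ z = x l) :
    ContDiffAt ℝ 1 (deformedPhase d r x y) z := by
  unfold deformedPhase
  refine contDiffAt_prod fun l _ => ?_
  by_cases hl : z = x l
  · refine contDiffAt_const (c := (1 : ℂ)) |>.congr_of_eventuallyEq ?_
    filter_upwards [closedBall_mem_nhds z h.pos] with w hw
    rw [h.phase_factor_eq_one y (by rwa [← hl, ← dist_eq_norm]), one_zpow]
  · have h1 : deformation r x y z - y l ≠ 0 := sub_ne_zero.2 fun h' => hl ((hF l).1 h')
    have h2 : z - x l ≠ 0 := sub_ne_zero.2 hl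
    have c1 : ContDiffAt ℝ 1 (fun w => unitOrOne (deformation r x y w - y l)) z :=
      (contDiffAt_unitOrOne h1).comp z
        (((contDiff_deformation r x y).of_le (by simp)).contDiffAt.sub contDiffAt_const)
    have c2 : ContDiffAt ℝ 1 (fun w => unitOrOne (w - x l)) z :=
      (contDiffAt_unitOrOne h2).comp z (contDiffAt_id.sub contDiffAt_const)
    have c3 := (conjCLE.contDiff (n := 1)).contDiffAt.comp z c2
    refine (c1.mul c3).zpow_complex ?_ (d l)
    rw [← norm_ne_zero_iff]
    simp [norm_unitOrOne]

theorem continuous_deformation_joint (r : ℝ) (x : Config n) :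
    Continuous fun q : Config n × ℂ => deformation r x q.1 q.2 := by
  unfold deformation
  have := fun j => (contDiff_radialCutoff r (x j)).continuous
  fun_prop

theorem deformation_self (r : ℝ) (x : Config n) (z : ℂ) : deformation r x x z = z := by
  simp [deformation]

theorem IsClearRadius.continuousAt_deformedPhase (h : IsClearRadius Ω x r) (d : Fin n → ℤ)
    (z : ℂ) : ContinuousAt (fun q : Config n × ℂ => deformedPhase d r x q.1 q.2) (x, z) := by
  unfold deformedPhase
  refine tendsto_finsetProd _ fun l _ => ?_
  by_cases hl : z = x l
  · refine (continuousAt_const (y := (1 : ℂ))).congr ?_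
    have : ∀ᶠ q : Config n × ℂ in 𝓝 (x, z), q.2 ∈ closedBall z r :=
      continuous_snd.continuousAt.eventually (closedBall_mem_nhds z h.pos)
    filter_upwards [this] with q hq
    rw [h.phase_factor_eq_one q.1 (by rwa [← hl, ← dist_eq_norm]), one_zpow]
  · have h2 : z - x l ≠ 0 := sub_ne_zero.2 hl
    have h1 : deformation r x x z - x l ≠ 0 := by rwa [deformation_self]
    have c0 : ContinuousAt (fun q : Config n × ℂ => deformation r x q.1 q.2 - q.1 l) (x, z) := by
      have := (continuous_deformation_joint r x).continuousAt (x := (x, z))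
      refine this.sub ?_
      fun_prop
    have c1 : ContinuousAt (fun q : Config n × ℂ => unitOrOne (deformation r x q.1 q.2 - q.1 l))
        (x, z) :=
      ContinuousAt.comp (g := unitOrOne) (contDiffAt_unitOrOne h1).continuousAt c0
    have c2 : ContinuousAt (fun q : Config n × ℂ => unitOrOne (q.2 - x l)) (x, z) :=
      ContinuousAt.comp (g := unitOrOne) (x := (x, z)) (f := fun q : Config n × ℂ => q.2 - x l)
        (contDiffAt_unitOrOne h2).continuousAt (by fun_prop)
    have c3 := continuous_conj.continuousAt.comp c2
    refine ContinuousAt.zpow₀ (c1.mul c3) _ (Or.inl ?_)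
    rw [← norm_ne_zero_iff]
    simp [norm_unitOrOne]

theorem deformedPhase_self (d : Fin n → ℤ) (r : ℝ) (x : Config n) (z : ℂ) :
    deformedPhase d r x x z = 1 := by
  rw [deformedPhase]
  refine Finset.prod_eq_one fun l _ => ?_
  rw [deformation_self, mul_conj_of_norm_eq_one (norm_unitOrOne _), one_zpow]

/-- The current of the map with singularities `y`, composed with the deformation. -/
noncomputable def deformedCurrent (d : Fin n → ℤ) (r : ℝ) (x y : Config n) (v : ℂ → ℂ) (z : ℂ) : ℂ :=
  conj (1 + deformationDel r x y z) * vortexCurrent d y v (deformation r x y z) +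
    deformationDelBar r x y z * conj (vortexCurrent d y v (deformation r x y z))

/-- The part of the domain where the deformation may act. -/
theorem IsClearRadius.isCompact_iUnion_closedBall (h : IsClearRadius Ω x r) :
    IsCompact (⋃ j, closedBall (x j) (4 * r)) ∧ ⋃ j, closedBall (x j) (4 * r) ⊆ Ω :=
  ⟨isCompact_iUnion fun _ => isCompact_closedBall _ _, iUnion_subset h.subset⟩

theorem IsClearRadius.deformation_eq_self_of_notMem (h : IsClearRadius Ω x r) (y : Config n)
    (hz : z ∉ ⋃ j, closedBall (x j) (4 * r)) : deformation r x y z = z := by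
  refine deformation_eq_self h.pos y fun j => ?_
  by_contra! hlt
  refine hz (mem_iUnion.2 ⟨j, ?_⟩)
  rw [mem_closedBall, dist_eq_norm]; linarith [h.pos]

theorem IsClearRadius.deformation_mem (h : IsClearRadius Ω x r) {y : Config n}
    (hy : n * ‖y - x‖ ≤ 2 * r) {K : Set ℂ} (hK : ⋃ j, closedBall (x j) (4 * r) ⊆ K) (hz : z ∈ K) :
    deformation r x y z ∈ K := by
  by_cases hj : ∀ j, 2 * r ≤ ‖z - x j‖
  · rwa [deformation_eq_self h.pos y hj]
  · push Not at hj
    obtain ⟨j, hj⟩ := hj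
    refine hK (mem_iUnion.2 ⟨j, ?_⟩)
    have h1 := (norm_deformation_sub_le r x y z).trans hy
    have h2 := norm_sub_le_norm_sub_add_norm_sub (deformation r x y z) z (x j)
    rw [mem_closedBall, dist_eq_norm]; linarith

theorem contDiffAt_arg {w : ℂ} (hw : w ∈ slitPlane) : ContDiffAt ℝ 1 Complex.arg w := by
  have h1 : ContDiffAt ℝ 1 (fun w => (Complex.log w).im) w :=
    imCLM.contDiff.contDiffAt.comp w ((Complex.contDiffAt_log hw).restrict_scalars ℝ)
  simpa only [Complex.log_im] using h1

namespace IsVortexFamily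

variable {g : ℂ → ℂ} {d : Fin n → ℤ} {p : ℝ≥0∞} {U : Set (Config n)} {u v : Config n → ℂ → ℂ}

/-- The composition of the map with singularities `y` with the deformation has a global phase
relative to the map with singularities `x`. -/
theorem eventually_exists_phase (h : IsVortexFamily Ω g d p U u v) (hx : x ∈ U)
    (hr : IsClearRadius Ω x r) :
    ∀ᶠ y in 𝓝 x, ∃ φ : ℂ → ℝ, ContDiffOn ℝ 1 φ Ω ∧ VanishesAtBoundary Ω φ ∧
      ∀ z ∈ Ω \ singularPoints x,
        HasGradientAt φ (deformedCurrent d r x y (v y) z - vortexCurrent d x (v x) z) z := by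
  have hO := h.domain.isOpen
  obtain ⟨K₀, hK₀Ω, hK₀, hSK, hre⟩ := h.exists_isCompact_re_pos hx
  obtain ⟨hBc, hBΩ⟩ := hr.isCompact_iUnion_closedBall
  set B := ⋃ j, closedBall (x j) (4 * r) with hB
  set K := K₀ ∪ B with hKdef
  have hK : IsCompact K := hK₀.union hBc
  have hKΩ : K ⊆ Ω := union_subset hK₀Ω hBΩ
  obtain ⟨ε, hε, hhom⟩ := hr.exists_homeomorph
  have hvx := h.harmonic x hx
  obtain ⟨δ, hδ, huc⟩ := Metric.uniformContinuousOn_iff.1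
    (hK.uniformContinuousOn_of_continuous (hvx.contDiffOn.continuousOn.mono hKΩ)) (1 / 4)
    (by norm_num)
  have hlim : Tendsto (fun y => ‖y - x‖) (𝓝 x) (𝓝 0) := by
    have : Continuous fun y : Config n => ‖y - x‖ := by fun_prop
    simpa using this.tendsto x
  have hlim' : Tendsto (fun y => n * ‖y - x‖) (𝓝 x) (𝓝 0) := by simpa using hlim.const_mul (n : ℝ)
  filter_upwards [h.mem_nhds hx, hre, hlim.eventually (gt_mem_nhds hε),
    hlim'.eventually (gt_mem_nhds (show 0 < 2 * r by linarith [hr.pos])),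
    hlim'.eventually (gt_mem_nhds hδ),
    h.eventually_forall_mul_conj_close hx hK hKΩ (show (0 : ℝ) < 1 / 4 by norm_num),
    eventually_forall_norm_sub_lt hK (fun z _ => hr.continuousAt_deformedPhase d z)
      (show (0 : ℝ) < 1 / 4 by norm_num)] with y hy hre hyε hyr hyδ hclose hphase
  obtain ⟨e, he, -, hpre, -, -⟩ := hhom y hyε
  have hF : ∀ z l, deformation r x y z = y l ↔ z = x l := fun z l => by
    rw [← hr.deformation_apply y l, ← he, ← he, e.injective.eq_iff]
  have hFΩ : ∀ z ∈ Ω, deformation r x y z ∈ Ω := fun z hz => by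
    rw [← he]; rw [← hpre] at hz; exact hz
  have hvy := h.harmonic y hy
  -- The quotient of `u_y ∘ F` by `u_x`, written so that it is defined and of class `C¹` also at the
  -- singularities.
  let ψ : ℂ → ℂ := fun z => deformedPhase d r x y z * (v y (deformation r x y z) * conj (v x z))
  have hFs : ∀ z ∈ Ω \ singularPoints x, deformation r x y z ∈ Ω \ singularPoints y := by
    rintro z ⟨hz, hzs⟩
    refine ⟨hFΩ z hz, ?_⟩
    rintro ⟨l, hl⟩
    exact hzs ⟨l, ((hF z l).1 hl.symm).symm⟩
  have hψ : ∀ z ∈ Ω \ singularPoints x, ψ z = u y (deformation r x y z) * conj (u x z) := by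
    intro z hz
    rw [h.eq_mul y hy _ (hFs z hz), h.eq_mul x hx z hz]
    simp only [ψ]
    rw [deformedPhase_eq d (hF z) hz.2, map_mul]; ring
  have hψC : ContDiffOn ℝ 1 ψ Ω := by
    intro z hz
    refine ContDiffAt.contDiffWithinAt ?_
    have c1 := hr.contDiffAt_deformedPhase d (hF z)
    have c2 : ContDiffAt ℝ 1 (fun z => v y (deformation r x y z)) z :=
      ContDiffAt.comp z ((hvy.contDiffOn.contDiffAt (hO.mem_nhds (hFΩ z hz))).of_le (by norm_num))
        ((contDiff_deformation r x y).of_le (by simp)).contDiffAt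
    have c3 : ContDiffAt ℝ 1 (fun z => conj (v x z)) z :=
      (conjCLE.contDiff (n := 1)).contDiffAt.comp z
        ((hvx.contDiffOn.contDiffAt (hO.mem_nhds hz)).of_le (by norm_num))
    exact c1.mul (c2.mul c3)
  have hout : ∀ z ∈ Ω \ K, ψ z = u y z * conj (u x z) := by
    intro z hz
    rw [hψ z ⟨hz.1, fun h' => hz.2 (Or.inl (hSK h'))⟩,
      hr.deformation_eq_self_of_notMem y fun h' => hz.2 (Or.inr h')]
  -- On `K` three errors of size at most `1 / 4` add up to less than `1`: the canonical phases,
  -- `v_y` against `v_x` at the deformed point, and `v_x` at the deformed point against `v_x` at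
  -- `z`. Off `K` the deformation is the identity and the boundary estimate applies. Hence the
  -- principal argument is a global phase.
  have hslit : ∀ z ∈ Ω, ψ z ∈ slitPlane := by
    intro z hz
    by_cases hzK : z ∈ K
    · apply mem_slitPlane_of_norm_sub_one_lt
      have hFK : deformation r x y z ∈ K := hr.deformation_mem hyr.le subset_union_right hzK
      have n1 := hvx.norm_eq_one z hz
      have n2 := hvx.norm_eq_one _ (hKΩ hFK)
      have n3 := hvy.norm_eq_one _ (hKΩ hFK)
      have e1 := hclose _ hFK
      rw [norm_mul_conj_sub_one n2] at e1
      have e2 : ‖v x (deformation r x y z) - v x z‖ < 1 / 4 := by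
        rw [← dist_eq_norm]
        refine huc _ hFK _ hzK ?_
        rw [dist_eq_norm]
        exact (norm_deformation_sub_le r x y z).trans_lt hyδ
      have e3 := hphase z hzK
      rw [deformedPhase_self] at e3
      have e4 := norm_mul_conj_sub_one (a := v y (deformation r x y z)) n1
      have e5 : ψ z - 1 = (deformedPhase d r x y z - 1) *
          (v y (deformation r x y z) * conj (v x z)) +
          (v y (deformation r x y z) * conj (v x z) - 1) := by simp only [ψ]; ring
      have e6 := norm_sub_le_norm_sub_add_norm_sub (v y (deformation r x y z))
        (v x (deformation r x y z)) (v x z)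
      rw [e5]
      refine (norm_add_le _ _).trans_lt ?_
      rw [norm_mul, norm_mul, norm_conj, n1, n3, mul_one, mul_one, e4]
      linarith
    · rw [hout z ⟨hz, hzK⟩]
      exact Or.inl (hre z ⟨hz, fun h' => hzK (Or.inl h')⟩)
  refine ⟨fun z => (ψ z).arg, fun z hz => ?_, ?_, fun z hz => ?_⟩
  · exact ((contDiffAt_arg (hslit z hz)).comp z
      (hψC.contDiffAt (hO.mem_nhds hz))).contDiffWithinAt
  · intro ε' hε'
    obtain ⟨δ', hδ', harg⟩ := exists_arg_lt hε'
    have hS : singularPoints x ∪ singularPoints y ⊆ Ω := by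
      rintro _ (⟨j, rfl⟩ | ⟨j, rfl⟩)
      exacts [(h.subset hx).1 j, (h.subset hy).1 j]
    have hf : ContinuousOn (fun z => u y z * conj (u x z))
        (closure Ω \ (singularPoints x ∪ singularPoints y)) :=
      ((h.boundaryValues y hy).1.mono (sdiff_subset_sdiff_right subset_union_right)).mul
        (continuous_conj.comp_continuousOn
          ((h.boundaryValues x hx).1.mono (sdiff_subset_sdiff_right subset_union_left)))
    have hfc : ∀ z ∈ frontier Ω, u y z * conj (u x z) = 1 := fun z hz => by
      rw [(h.boundaryValues y hy).2 hz, (h.boundaryValues x hx).2 hz]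
      exact mul_conj_of_norm_eq_one (h.datum.norm_eq_one z hz)
    obtain ⟨K₁, h1, h2, -, h3⟩ := exists_isCompact_of_eq_frontier hO h.domain.isBounded
      ((finite_singularPoints x).union (finite_singularPoints y)) hS hf hfc hδ'
    refine ⟨K₁ ∪ K, union_subset h1 hKΩ, h2.union hK, fun z hz => ?_⟩
    beta_reduce
    rw [hout z ⟨hz.1, fun h' => hz.2 (Or.inr h')⟩]
    exact harg _ (h3 z ⟨hz.1, fun h' => hz.2 (Or.inl h')⟩)
  · have c1 := (h.hasCurrent hy (hFs z hz)).comp (p := 1 + deformationDel r x y z)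
      (q := deformationDelBar r x y z) (hasFDerivAt_deformation r x y z) (by intro w; simp)
    have c2 := c1.mul (h.hasCurrent hx hz).star
    rw [← sub_eq_add_neg] at c2
    have c3 := c2.congr_of_eventuallyEq (b := ψ) (by
      filter_upwards [(isOpen_diff_singularPoints hO x).mem_nhds hz] with w hw using hψ w hw)
    exact c3.hasGradientAt_arg (hslit z hz.1)

end IsVortexFamily

end DeformedPhase

/-! ### Uniform bounds on the annuli where the deformation is not a translation -/

section InnerVariation

open Complex Metric Filter
open scoped ComplexConjugate ENNReal

variable {n : ℕ} {x y : Config n} {Ω : Set ℂ} {r : ℝ} {z : ℂ}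

/-- The annuli in which the deformation is not a translation. -/
def annuli (x : Config n) (r : ℝ) : Set ℂ := ⋃ j, closedBall (x j) (2 * r) \ ball (x j) r

theorem deformationDel_eq_zero_of_notMem (hr : 0 < r) (y : Config n) (hz : z ∉ annuli x r) :
    deformationDel r x y z = 0 ∧ deformationDelBar r x y z = 0 := by
  refine deformationDel_eq_zero hr y fun j => ?_
  by_contra! hlt
  refine hz (mem_iUnion.2 ⟨j, ?_, ?_⟩)
  · rw [mem_closedBall, dist_eq_norm]; exact hlt.2.le
  · rw [mem_ball, dist_eq_norm, not_lt]; exact hlt.1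

/-- The relative phase `φ` of the map with singularities `y`, deformed by `e`, with respect to the
map with singularities `x`. -/
structure IsRelativePhase (Ω : Set ℂ) (d : Fin n → ℤ) (r : ℝ) (x y : Config n) (vx vy : ℂ → ℂ)
    (e : ℂ ≃ₜ ℂ) (φ : ℂ → ℝ) (M : ℝ) : Prop where
  apply_eq : ∀ z, e z = deformation r x y z
  contDiff_symm : ContDiff ℝ 1 e.symm
  preimage : e ⁻¹' Ω = Ω
  preimage_perforated : ∀ ρ ≤ r, e ⁻¹' perforated Ω y ρ = perforated Ω x ρ
  det_pos : ∀ z, ‖deformationDelBar r x y z‖ ^ 2 < ‖1 + deformationDel r x y z‖ ^ 2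
  norm_sub_le : ‖y - x‖ ≤ r
  contDiffOn : ContDiffOn ℝ 1 φ Ω
  vanishes : VanishesAtBoundary Ω φ
  hasGradientAt : ∀ z ∈ Ω \ singularPoints x,
    HasGradientAt φ (deformedCurrent d r x y vy z - vortexCurrent d x vx z) z
  bound : ∀ z ∈ annuli x r, ‖vortexCurrent d y vy (e z)‖ ≤ M ∧ ‖vortexCurrent d x vx z‖ ≤ M

theorem IsClearRadius.perforated_of_mem_annulus (h : IsClearRadius Ω x r) {ρ : ℝ} (hρ : ρ ≤ 4 * r)
    {j : Fin n} (hz : z ∈ closedBall (x j) (4 * r) \ ball (x j) ρ) : z ∈ perforated Ω x ρ := by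
  refine ⟨h.subset j hz.1, fun hz' => ?_⟩
  obtain ⟨l, hl⟩ := mem_iUnion.1 hz'
  by_cases hlj : l = j
  · exact hz.2 (hlj ▸ hl)
  · have h1 := h.far_of_near hlj (z := z) (by rw [← dist_eq_norm]; exact hz.1)
    rw [mem_ball, dist_eq_norm] at hl
    linarith

namespace IsVortexFamily

variable {g : ℂ → ℂ} {d : Fin n → ℤ} {p : ℝ≥0∞} {U : Set (Config n)} {u v : Config n → ℂ → ℂ}

/-- For `y` near `x`, the annuli and their images under the deformation lie in slightly larger
annuli without singularities of `x`, on which the current of `y` is uniformly close to that of `x`.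
-/
theorem exists_eventually_bound (h : IsVortexFamily Ω g d p U u v) (hx : x ∈ U)
    (hr : IsClearRadius Ω x r) :
    ∃ M, 0 ≤ M ∧ ∀ᶠ y in 𝓝 x, ∀ z ∈ annuli x r,
      ‖vortexCurrent d y (v y) (deformation r x y z)‖ ≤ M ∧ ‖vortexCurrent d x (v x) z‖ ≤ M := by
  have hO := h.domain.isOpen
  have hr0 := hr.pos
  let N : Set ℂ := ⋃ j, closedBall (x j) (4 * r) \ ball (x j) (r / 2)
  have hN : IsCompact N := isCompact_iUnion fun _ => (isCompact_closedBall _ _).diff isOpen_ball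
  have hNP : N ⊆ perforated Ω x (r / 2) := iUnion_subset fun j z hz =>
    hr.perforated_of_mem_annulus (by linarith) hz
  have hNΩ : N ⊆ Ω := hNP.trans sdiff_subset
  have hNx : ∀ z ∈ N, z ∉ singularPoints x := fun z hz =>
    notMem_singularPoints_of_mem_perforated (by positivity) (hNP hz)
  obtain ⟨M, hM⟩ := hN.exists_bound_of_continuousOn
    ((contDiffOn_vortexCurrent (d := d) (x := x) hO (h.harmonic x hx)).continuousOn.mono
      fun z hz => ⟨hNΩ hz, hNx z hz⟩)
  have hlim : Tendsto (fun y => n * ‖y - x‖) (𝓝 x) (𝓝 0) := by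
    have : Continuous fun y : Config n => n * ‖y - x‖ := by fun_prop
    simpa using this.tendsto x
  refine ⟨max M 0 + 2, by positivity, ?_⟩
  filter_upwards [hlim.eventually (gt_mem_nhds (show 0 < r / 2 by positivity)),
    h.eventually_forall_current_close hx hN hNΩ zero_lt_one,
    eventually_forall_norm_sub_lt hN (fun z hz => continuousAt_sum_angularField d (hNx z hz))
      zero_lt_one] with y h1 h2 h3 z hz
  obtain ⟨j, hj⟩ := mem_iUnion.1 hz
  have hzj : ‖z - x j‖ ≤ 2 * r := by rw [← dist_eq_norm]; exact hj.1
  have hzj' : r ≤ ‖z - x j‖ := by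
    have := hj.2
    rwa [mem_ball, not_lt, dist_eq_norm] at this
  have hzN : z ∈ N := by
    refine mem_iUnion.2 ⟨j, ?_, ?_⟩
    · rw [mem_closedBall, dist_eq_norm]; linarith
    · rw [mem_ball, dist_eq_norm, not_lt]; linarith
  have hFN : deformation r x y z ∈ N := by
    have e1 := (norm_deformation_sub_le r x y z).trans h1.le
    have e2 := norm_sub_le_norm_sub_add_norm_sub (deformation r x y z) z (x j)
    have e3 := norm_sub_le_norm_sub_add_norm_sub z (deformation r x y z) (x j)
    rw [norm_sub_rev z (deformation r x y z)] at e3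
    refine mem_iUnion.2 ⟨j, ?_, ?_⟩
    · rw [mem_closedBall, dist_eq_norm]; linarith
    · rw [mem_ball, dist_eq_norm, not_lt]; linarith
  have hm := le_max_left M 0
  refine ⟨?_, (hM z hzN).trans (by linarith)⟩
  have e1 := h2 _ hFN
  have e2 := h3 _ hFN
  have e3 := hM _ hFN
  generalize deformation r x y z = w at *
  have e4 : vortexCurrent d y (v y) w = vortexCurrent d x (v x) w +
      ((∑ j, (d j : ℂ) * angularField (y j) w - ∑ j, (d j : ℂ) * angularField (x j) w) +
        (current (v y) w - current (v x) w)) := by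
    rw [vortexCurrent, vortexCurrent]; ring
  rw [e4]
  refine (norm_add_le _ _).trans ?_
  have e5 := norm_add_le
    (∑ j, (d j : ℂ) * angularField (y j) w - ∑ j, (d j : ℂ) * angularField (x j) w)
    (current (v y) w - current (v x) w)
  linarith

theorem exists_eventually_isRelativePhase (h : IsVortexFamily Ω g d p U u v) (hx : x ∈ U)
    (hr : IsClearRadius Ω x r) :
    ∃ M, 0 ≤ M ∧ ∀ᶠ y in 𝓝 x, ∃ e φ, IsRelativePhase Ω d r x y (v x) (v y) e φ M := by
  obtain ⟨M, hM0, hM⟩ := h.exists_eventually_bound hx hr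
  obtain ⟨ε, hε, hhom⟩ := hr.exists_homeomorph
  have hlim : Tendsto (fun y => ‖y - x‖) (𝓝 x) (𝓝 0) := by
    have : Continuous fun y : Config n => ‖y - x‖ := by fun_prop
    simpa using this.tendsto x
  refine ⟨M, hM0, ?_⟩
  filter_upwards [hM, h.eventually_exists_phase hx hr, hlim.eventually (gt_mem_nhds hε),
    hlim.eventually (gt_mem_nhds hr.pos)] with y h1 h2 h3 h4
  obtain ⟨e, he, h5, h6, h7, h8⟩ := hhom y h3
  obtain ⟨φ, h9, h10, h11⟩ := h2
  exact ⟨e, φ, he, h5, h6, h7, h8, h4.le, h9, h10, h11, fun z hz => by rw [he]; exact h1 z hz⟩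

end IsVortexFamily

theorem aestronglyMeasurable_of_continuousOn_diff {E : Type*} [NormedAddCommGroup E]
    (hΩ : IsOpen Ω) {f : ℂ → E} (hf : ContinuousOn f (Ω \ singularPoints x)) :
    AEStronglyMeasurable f (volume.restrict Ω) := by
  have h1 : AEStronglyMeasurable f (volume.restrict (Ω \ singularPoints x)) :=
    hf.aestronglyMeasurable_of_isSeparable (isOpen_diff_singularPoints hΩ x).measurableSet
      (TopologicalSpace.IsSeparable.of_separableSpace _)
  rwa [Measure.restrict_congr_set] at h1
  exact sdiff_null_ae_eq_self ((finite_singularPoints x).measure_zero volume)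

theorem integrableOn_norm_vortexCurrent {d : Fin n → ℤ} {v : ℂ → ℂ} (hΩ : IsOpen Ω)
    (hv : IsHarmonicCircleMap Ω v) {K : Set ℂ} (hK : IsCompact K) (hKΩ : K ⊆ Ω) :
    IntegrableOn (fun z => ‖vortexCurrent d x v z‖) K := by
  have h1 : IntegrableOn (current v) K :=
    ((contDiffOn_current hΩ hv (m := 1)).continuousOn.mono hKΩ).integrableOn_compact hK
  have h2 : ∀ j, IntegrableOn (fun z => (d j : ℂ) * angularField (x j) z) K := by
    intro j
    refine Integrable.const_mul ?_ _
    refine (integrableOn_inv_norm_sub (x j) hK.isBounded).mono'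
      (measurable_angularField _).aestronglyMeasurable (Eventually.of_forall fun z => ?_)
    rw [norm_angularField]
  have h3 : IntegrableOn (vortexCurrent d x v) K := by
    have : vortexCurrent d x v =
        fun z => ∑ j, (d j : ℂ) * angularField (x j) z + current v z := rfl
    rw [this]
    exact (integrable_finsetSum _ fun j _ => h2 j).add h1
  exact h3.norm

end InnerVariation

/-! ### Integrability and change of variables for the relative phase -/

section EnergyExpansion

open Complex Metric Filter
open scoped ComplexConjugate ENNReal

variable {n : ℕ} {x y : Config n} {Ω : Set ℂ} {r : ℝ} {z : ℂ}

theorem annuli_subset (hr : 0 ≤ r) (x : Config n) : annuli x r ⊆ ⋃ j, closedBall (x j) (4 * r) :=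
  iUnion_mono fun _ => sdiff_subset.trans (closedBall_subset_closedBall (by linarith))

theorem singularPoints_subset_iUnion_closedBall (hr : 0 ≤ r) (x : Config n) :
    singularPoints x ⊆ ⋃ j, closedBall (x j) (4 * r) := by
  rintro _ ⟨j, rfl⟩
  exact mem_iUnion.2 ⟨j, mem_closedBall_self (by linarith)⟩

theorem diff_iUnion_closedBall_subset (Ω : Set ℂ) (h : ‖y - x‖ ≤ r) :
    Ω \ ⋃ j, closedBall (x j) (4 * r) ⊆ perforated Ω y (3 * r) := by
  refine fun z hz => ⟨hz.1, fun hz' => hz.2 ?_⟩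
  obtain ⟨j, hj⟩ := mem_iUnion.1 hz'
  refine mem_iUnion.2 ⟨j, ?_⟩
  rw [mem_ball, dist_eq_norm] at hj
  rw [mem_closedBall, dist_eq_norm]
  have h1 := norm_coord_sub_le x y j
  have h2 := norm_sub_le_norm_sub_add_norm_sub z (y j) (x j)
  linarith

/-- A function on `Ω` with bounded support in the annuli that is continuous off the singularities
is integrable. -/
theorem integrableOn_of_annuli (hb : Bornology.IsBounded Ω) (hO : IsOpen Ω) {f : ℂ → ℝ}
    (hf : ContinuousOn f (Ω \ singularPoints x)) {C : ℝ} (hC : 0 ≤ C)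
    (h1 : ∀ z ∈ annuli x r, |f z| ≤ C) (h2 : ∀ z ∉ annuli x r, f z = 0) : IntegrableOn f Ω := by
  refine Integrable.mono' (g := fun _ => C) (integrableOn_const hb.measure_lt_top.ne)
    (aestronglyMeasurable_of_continuousOn_diff hO hf) (Eventually.of_forall fun z => ?_)
  by_cases hz : z ∈ annuli x r
  · exact h1 z hz
  · rw [h2 z hz, norm_zero]; exact hC

theorem ae_restrict_mem_diff_singularPoints (hO : IsOpen Ω) (x : Config n) :
    ∀ᵐ z ∂volume.restrict Ω, z ∈ Ω \ singularPoints x := by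
  have h0 : ∀ᵐ z ∂volume.restrict Ω, z ∉ singularPoints x :=
    ae_restrict_of_ae (compl_mem_ae_iff.2 ((finite_singularPoints x).measure_zero volume))
  filter_upwards [ae_restrict_mem hO.measurableSet, h0] with z h1 h2 using ⟨h1, h2⟩

namespace IsRelativePhase

variable {d : Fin n → ℤ} {vx vy : ℂ → ℂ} {e : ℂ ≃ₜ ℂ} {φ : ℂ → ℝ} {M : ℝ}

theorem fderiv_apply (h : IsRelativePhase Ω d r x y vx vy e φ M) (hz : z ∈ Ω \ singularPoints x)
    (w : ℂ) : fderiv ℝ φ z w =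
      inner ℝ (deformedCurrent d r x y vy z - vortexCurrent d x vx z) w := by
  rw [(h.hasGradientAt z hz).hasFDerivAt.fderiv, InnerProductSpace.toDual_apply_apply]

theorem norm_fderiv (h : IsRelativePhase Ω d r x y vx vy e φ M) (hz : z ∈ Ω \ singularPoints x) :
    ‖fderiv ℝ φ z‖ = ‖deformedCurrent d r x y vy z - vortexCurrent d x vx z‖ := by
  rw [(h.hasGradientAt z hz).hasFDerivAt.fderiv, LinearIsometryEquiv.norm_map]

theorem continuousOn_fderiv (h : IsRelativePhase Ω d r x y vx vy e φ M) (hO : IsOpen Ω) :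
    ContinuousOn (fderiv ℝ φ) Ω :=
  h.contDiffOn.continuousOn_fderiv_of_isOpen hO (by simp)

theorem deformedCurrent_eq (h : IsRelativePhase Ω d r x y vx vy e φ M) (z : ℂ) :
    deformedCurrent d r x y vy z = conj (1 + deformationDel r x y z) * vortexCurrent d y vy (e z) +
      deformationDelBar r x y z * conj (vortexCurrent d y vy (e z)) := by
  rw [deformedCurrent, h.apply_eq]

theorem hasFDerivAt (h : IsRelativePhase Ω d r x y vx vy e φ M) (z : ℂ) :
    HasFDerivAt e ((1 + deformationDel r x y z) • ContinuousLinearMap.id ℝ ℂ +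
        deformationDelBar r x y z • conjCLE.toContinuousLinearMap) z := by
  have : (e : ℂ → ℂ) = deformation r x y := funext h.apply_eq
  rw [this]
  exact hasFDerivAt_deformation r x y z

theorem image_eq (h : IsRelativePhase Ω d r x y vx vy e φ M) : e '' Ω = Ω := by
  conv_lhs => rw [← h.preimage]
  exact image_preimage_eq _ e.surjective

theorem image_perforated (h : IsRelativePhase Ω d r x y vx vy e φ M) {ρ : ℝ} (hρ : ρ ≤ r) :
    e '' perforated Ω x ρ = perforated Ω y ρ := by
  rw [← h.preimage_perforated ρ hρ]
  exact image_preimage_eq _ e.surjective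

theorem apply_mem (h : IsRelativePhase Ω d r x y vx vy e φ M) (hr : IsClearRadius Ω x r)
    (hz : z ∈ Ω \ singularPoints x) : e z ∈ Ω \ singularPoints y := by
  refine ⟨by rw [← mem_preimage, h.preimage]; exact hz.1, ?_⟩
  rintro ⟨j, hj⟩
  change y j = e z at hj
  rw [← hr.deformation_apply y j, ← h.apply_eq] at hj
  exact hz.2 ⟨j, e.injective hj⟩

theorem continuousOn_comp (h : IsRelativePhase Ω d r x y vx vy e φ M) (hr : IsClearRadius Ω x r)
    (hO : IsOpen Ω) (hvy : IsHarmonicCircleMap Ω vy) :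
    ContinuousOn (fun z => vortexCurrent d y vy (e z)) (Ω \ singularPoints x) :=
  (contDiffOn_vortexCurrent (d := d) (x := y) hO hvy).continuousOn.comp e.continuous.continuousOn
    fun _ hz => h.apply_mem hr hz

/-- On the discs of radius `4 r` the gradient is continuous on a compact set, `φ` being `C¹` across
the singularities. Outside them the deformation is the identity and the gradient is a difference of
two square-integrable currents. -/
theorem integrableOn_norm_fderiv_sq (h : IsRelativePhase Ω d r x y vx vy e φ M)
    (hr : IsClearRadius Ω x r) (hO : IsOpen Ω)
    (hLx : ∀ ρ > 0, IntegrableOn (fun z => ‖vortexCurrent d x vx z‖ ^ 2) (perforated Ω x ρ))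
    (hLy : ∀ ρ > 0, IntegrableOn (fun z => ‖vortexCurrent d y vy z‖ ^ 2) (perforated Ω y ρ)) :
    IntegrableOn (fun z => ‖fderiv ℝ φ z‖ ^ 2) Ω := by
  obtain ⟨hBc, hBΩ⟩ := hr.isCompact_iUnion_closedBall
  have hr0 := hr.pos
  have hS := singularPoints_subset_iUnion_closedBall hr0.le x
  have hA := annuli_subset hr0.le x
  have hself := fun z => hr.deformation_eq_self_of_notMem y (z := z)
  have hsubx : Ω \ ⋃ j, closedBall (x j) (4 * r) ⊆ perforated Ω x (3 * r) :=
    diff_iUnion_closedBall_subset Ω (by simpa using hr0.le)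
  have hsuby := diff_iUnion_closedBall_subset Ω h.norm_sub_le
  set B := ⋃ j, closedBall (x j) (4 * r)
  have hc : ContinuousOn (fun z => ‖fderiv ℝ φ z‖ ^ 2) Ω := (h.continuousOn_fderiv hO).norm.pow 2
  rw [← union_sdiff_cancel hBΩ]
  refine ((hc.mono hBΩ).integrableOn_compact hBc).union ?_
  have hm : MeasurableSet (Ω \ B) := hO.measurableSet.diff hBc.measurableSet
  have hi := (((hLy (3 * r) (by positivity)).mono_set hsuby).const_mul 2).add
    (((hLx (3 * r) (by positivity)).mono_set hsubx).const_mul 2)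
  refine hi.mono' ((hc.mono sdiff_subset).aestronglyMeasurable hm) ?_
  filter_upwards [ae_restrict_mem hm] with z hz
  have hz' : z ∈ Ω \ singularPoints x := ⟨hz.1, fun hz' => hz.2 (hS hz')⟩
  obtain ⟨e1, e2⟩ := deformationDel_eq_zero_of_notMem hr0 y (fun hz' => hz.2 (hA hz'))
  rw [h.norm_fderiv hz', deformedCurrent, e1, e2, hself z hz.2]
  simp only [add_zero, map_one, one_mul, zero_mul, Pi.add_apply]
  rw [Real.norm_of_nonneg (by positivity)]
  have := _root_.norm_sub_le (vortexCurrent d y vy z) (vortexCurrent d x vx z)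
  nlinarith [norm_nonneg (vortexCurrent d y vy z - vortexCurrent d x vx z),
    sq_nonneg (‖vortexCurrent d y vy z‖ - ‖vortexCurrent d x vx z‖)]

/-- Near the singularities a bounded gradient meets a current of size `O(1 / |z - x_j|)`, which is
integrable; away from them both factors are square integrable. -/
theorem integrableOn_fderiv_apply (h : IsRelativePhase Ω d r x y vx vy e φ M)
    (hr : IsClearRadius Ω x r) (hO : IsOpen Ω) (hvx : IsHarmonicCircleMap Ω vx)
    (hLx : ∀ ρ > 0, IntegrableOn (fun z => ‖vortexCurrent d x vx z‖ ^ 2) (perforated Ω x ρ))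
    (hLy : ∀ ρ > 0, IntegrableOn (fun z => ‖vortexCurrent d y vy z‖ ^ 2) (perforated Ω y ρ)) :
    IntegrableOn (fun z => fderiv ℝ φ z (vortexCurrent d x vx z)) Ω := by
  obtain ⟨hBc, hBΩ⟩ := hr.isCompact_iUnion_closedBall
  have hr0 := hr.pos
  have hsubx : Ω \ ⋃ j, closedBall (x j) (4 * r) ⊆ perforated Ω x (3 * r) :=
    diff_iUnion_closedBall_subset Ω (by simpa using hr0.le)
  have hf := h.continuousOn_fderiv hO
  have hmeas : AEStronglyMeasurable (fun z => fderiv ℝ φ z (vortexCurrent d x vx z))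
      (volume.restrict Ω) :=
    aestronglyMeasurable_of_continuousOn_diff (x := x) hO ((hf.mono sdiff_subset).clm_apply
      (contDiffOn_vortexCurrent hO hvx).continuousOn)
  have hint := h.integrableOn_norm_fderiv_sq hr hO hLx hLy
  set B := ⋃ j, closedBall (x j) (4 * r)
  obtain ⟨C, hC⟩ := hBc.exists_bound_of_continuousOn (hf.mono hBΩ)
  have hm : MeasurableSet (Ω \ B) := hO.measurableSet.diff hBc.measurableSet
  rw [← union_sdiff_cancel hBΩ]
  refine IntegrableOn.union ?_ ?_
  · refine ((integrableOn_norm_vortexCurrent (x := x) (d := d) hO hvx hBc hBΩ).const_mul C).mono'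
      (hmeas.mono_measure (Measure.restrict_mono_set _ hBΩ)) ?_
    filter_upwards [ae_restrict_mem hBc.measurableSet] with z hz
    exact (ContinuousLinearMap.le_opNorm _ _).trans (by gcongr; exact hC z hz)
  · refine ((hint.mono_set sdiff_subset).add
      ((hLx (3 * r) (by positivity)).mono_set hsubx)).mono'
      (hmeas.mono_measure (Measure.restrict_mono_set _ sdiff_subset)) ?_
    refine Eventually.of_forall fun z => (ContinuousLinearMap.le_opNorm _ _).trans ?_
    simp only [Pi.add_apply]
    nlinarith [sq_nonneg (‖fderiv ℝ φ z‖ - ‖vortexCurrent d x vx z‖),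
      sq_nonneg (‖fderiv ℝ φ z‖ + ‖vortexCurrent d x vx z‖)]

theorem vanishes_comp_symm (h : IsRelativePhase Ω d r x y vx vy e φ M) :
    VanishesAtBoundary Ω (φ ∘ e.symm) := by
  intro ε hε
  obtain ⟨K, hKΩ, hK, hlt⟩ := h.vanishes ε hε
  refine ⟨e '' K, (image_mono hKΩ).trans h.image_eq.subset, hK.image e.continuous, fun z hz => ?_⟩
  refine hlt _ ⟨?_, fun hz' => hz.2 ⟨_, hz', e.apply_symm_apply z⟩⟩
  rw [← h.preimage, mem_preimage, e.apply_symm_apply]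
  exact hz.1

theorem contDiffOn_comp_symm (h : IsRelativePhase Ω d r x y vx vy e φ M) :
    ContDiffOn ℝ 1 (φ ∘ e.symm) Ω := by
  refine h.contDiffOn.comp h.contDiff_symm.contDiffOn fun z hz => ?_
  rw [← h.preimage, mem_preimage, e.apply_symm_apply]
  exact hz

/-- The adjugate of `w ↦ P w + q conj w` is `b ↦ conj P b - q conj b`, and the inverse differential
multiplied by the determinant is the adjugate. -/
theorem det_smul_fderiv_comp_symm (h : IsRelativePhase Ω d r x y vx vy e φ M) (hO : IsOpen Ω)
    (hz : z ∈ Ω) (b : ℂ) :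
    (‖1 + deformationDel r x y z‖ ^ 2 - ‖deformationDelBar r x y z‖ ^ 2) *
      fderiv ℝ (φ ∘ e.symm) (e z) b =
    fderiv ℝ φ z (conj (1 + deformationDel r x y z) * b - deformationDelBar r x y z * conj b) := by
  have hez : e z ∈ Ω := by rw [← mem_preimage, h.preimage]; exact hz
  have h1 := ((h.contDiffOn_comp_symm.contDiffAt (hO.mem_nhds hez)).differentiableAt
    (by simp)).hasFDerivAt.comp z (h.hasFDerivAt z)
  have h2 : (φ ∘ e.symm) ∘ e = φ := by ext w; simp
  rw [h2] at h1
  rw [h1.fderiv, ContinuousLinearMap.comp_apply, ← smul_eq_mul, ← map_smul]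
  congr 1
  simp only [add_apply, smul_apply, ContinuousLinearMap.id_apply, smul_eq_mul,
    ContinuousLinearEquiv.coe_coe, conjCLE_apply, map_sub, map_mul, conj_conj, real_smul]
  push_cast
  rw [← conj_mul', ← conj_mul']
  ring

end IsRelativePhase

end EnergyExpansion

/-! ### Quadratic estimate of the relative phase and first-order expansion of the energy -/

section EnergyEstimate

open Complex Metric Filter
open scoped ComplexConjugate ENNReal

variable {n : ℕ} {x y : Config n} {Ω : Set ℂ} {r : ℝ} {z : ℂ}

theorem norm_sq_mul_add_mul_conj (P q b : ℂ) :
    ‖conj P * b + q * conj b‖ ^ 2 =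
      (‖P‖ ^ 2 - ‖q‖ ^ 2) * ‖b‖ ^ 2 + (2 * ‖q‖ ^ 2 * ‖b‖ ^ 2 + 2 * (P * q * conj b ^ 2).re) := by
  simp only [← normSq_eq_norm_sq, normSq_apply]
  simp only [pow_two, mul_re, mul_im, add_re, add_im, conj_re, conj_im]
  ring

namespace IsRelativePhase

variable {d : Fin n → ℤ} {vx vy : ℂ → ℂ} {e : ℂ ≃ₜ ℂ} {φ : ℂ → ℝ} {M κ : ℝ}

theorem norm_fderiv_apply_le (h : IsRelativePhase Ω d r x y vx vy e φ M) (hr : 0 < r)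
    (hκ : ∀ z, ‖deformationDel r x y z‖ ≤ κ ∧ ‖deformationDelBar r x y z‖ ≤ κ) (hM : 0 ≤ M) (z : ℂ) :
    ‖deformationDelBar r x y z * conj (vortexCurrent d y vy (e z))‖ ≤ κ * M := by
  have hκ0 : 0 ≤ κ := (norm_nonneg _).trans (hκ z).1
  by_cases hz : z ∈ annuli x r
  · rw [norm_mul, norm_conj]
    exact mul_le_mul (hκ z).2 (h.bound z hz).1 (norm_nonneg _) hκ0
  · rw [(deformationDel_eq_zero_of_notMem hr y hz).2, zero_mul, norm_zero]
    positivity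

theorem integrableOn_fderiv_delBar (h : IsRelativePhase Ω d r x y vx vy e φ M)
    (hr : IsClearRadius Ω x r) (hO : IsOpen Ω) (hb : Bornology.IsBounded Ω)
    (hvy : IsHarmonicCircleMap Ω vy)
    (hi : IntegrableOn (fun z => ‖fderiv ℝ φ z‖ ^ 2) Ω)
    (hκ : ∀ z, ‖deformationDel r x y z‖ ≤ κ ∧ ‖deformationDelBar r x y z‖ ≤ κ) (hM : 0 ≤ M) :
    IntegrableOn (fun z => fderiv ℝ φ z
      (deformationDelBar r x y z * conj (vortexCurrent d y vy (e z)))) Ω := by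
  refine (hi.add (integrableOn_const (C := (κ * M) ^ 2) hb.measure_lt_top.ne)).mono'
    (aestronglyMeasurable_of_continuousOn_diff (x := x) hO
      (((h.continuousOn_fderiv hO).mono sdiff_subset).clm_apply
      ((continuous_deformationDelBar r x y).continuousOn.mul
        (continuous_conj.comp_continuousOn (h.continuousOn_comp hr hO hvy)))))
    (Eventually.of_forall fun z => ?_)
  have h1 := h.norm_fderiv_apply_le hr.pos hκ hM z
  refine (ContinuousLinearMap.le_opNorm _ _).trans ?_
  simp only [Pi.add_apply]
  refine (mul_le_mul_of_nonneg_left h1 (norm_nonneg _)).trans ?_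
  nlinarith [sq_nonneg (‖fderiv ℝ φ z‖ - κ * M), sq_nonneg (‖fderiv ℝ φ z‖ + κ * M)]

/-- Write `b` for the current of `y` at the deformed point. Testing `div J_y = 0` with `φ ∘ e⁻¹` and
changing variables gives `∫ dφ(conj P b - q conj b) = 0`. The argument of `dφ` is `J_x + ∇φ - 2 q
conj b`, and `∫ dφ(J_x) = 0` because `φ` tends to zero at `∂Ω`. -/
theorem integral_norm_fderiv_sq (h : IsRelativePhase Ω d r x y vx vy e φ M)
    (hr : IsClearRadius Ω x r) (hO : IsOpen Ω) (hb : Bornology.IsBounded Ω)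
    (hvx : IsHarmonicCircleMap Ω vx) (hvy : IsHarmonicCircleMap Ω vy)
    (hi : IntegrableOn (fun z => ‖fderiv ℝ φ z‖ ^ 2) Ω)
    (hJ : IntegrableOn (fun z => fderiv ℝ φ z (vortexCurrent d x vx z)) Ω)
    (hκ : ∀ z, ‖deformationDel r x y z‖ ≤ κ ∧ ‖deformationDelBar r x y z‖ ≤ κ) (hM : 0 ≤ M) :
    ∫ z in Ω, ‖fderiv ℝ φ z‖ ^ 2 = 2 * ∫ z in Ω, fderiv ℝ φ z
      (deformationDelBar r x y z * conj (vortexCurrent d y vy (e z))) := by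
  have hq := h.integrableOn_fderiv_delBar hr hO hb hvy hi hκ hM
  have hJ0 := (weakDivFree_vortexCurrent (d := d) (x := x) hO hvx).integral_eq_zero hO h.contDiffOn
    h.vanishes hJ
  have hdet : ∀ z, |(((1 + deformationDel r x y z) • ContinuousLinearMap.id ℝ ℂ +
      deformationDelBar r x y z • conjCLE.toContinuousLinearMap : ℂ →L[ℝ] ℂ)).det| =
      ‖1 + deformationDel r x y z‖ ^ 2 - ‖deformationDelBar r x y z‖ ^ 2 := fun z => by
    rw [det_smul_id_add_smul_conj, abs_of_pos (sub_pos.2 (h.det_pos z))]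
  have hpt : ∀ᵐ z ∂volume.restrict Ω,
      |(((1 + deformationDel r x y z) • ContinuousLinearMap.id ℝ ℂ +
        deformationDelBar r x y z • conjCLE.toContinuousLinearMap : ℂ →L[ℝ] ℂ)).det| •
        fderiv ℝ (φ ∘ e.symm) (e z) (vortexCurrent d y vy (e z)) =
      fderiv ℝ φ z (vortexCurrent d x vx z) + ‖fderiv ℝ φ z‖ ^ 2 - 2 * fderiv ℝ φ z
        (deformationDelBar r x y z * conj (vortexCurrent d y vy (e z))) := by
    filter_upwards [ae_restrict_mem_diff_singularPoints hO x] with z hz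
    rw [hdet, smul_eq_mul, h.det_smul_fderiv_comp_symm hO hz.1]
    have h1 : conj (1 + deformationDel r x y z) * vortexCurrent d y vy (e z) -
        deformationDelBar r x y z * conj (vortexCurrent d y vy (e z)) =
        vortexCurrent d x vx z + (deformedCurrent d r x y vy z - vortexCurrent d x vx z) -
          (2 : ℝ) • (deformationDelBar r x y z * conj (vortexCurrent d y vy (e z))) := by
      rw [h.deformedCurrent_eq, real_smul]; push_cast; ring
    rw [h1, map_sub, map_add, map_smul, smul_eq_mul, h.norm_fderiv hz]
    congr 2
    rw [h.fderiv_apply hz, real_inner_self_eq_norm_sq]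
  have hint := (hJ.add hi).sub (hq.const_mul 2)
  have hcv := integrableOn_image_iff_integrableOn_abs_det_fderiv_smul volume hO.measurableSet
    (fun z _ => (h.hasFDerivAt z).hasFDerivWithinAt) e.injective.injOn
    (fun z => fderiv ℝ (φ ∘ e.symm) z (vortexCurrent d y vy z))
  have hcv2 := integral_image_eq_integral_abs_det_fderiv_smul volume hO.measurableSet
    (fun z _ => (h.hasFDerivAt z).hasFDerivWithinAt) e.injective.injOn
    (fun z => fderiv ℝ (φ ∘ e.symm) z (vortexCurrent d y vy z))
  rw [h.image_eq] at hcv hcv2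
  have hw := (weakDivFree_vortexCurrent (d := d) (x := y) hO hvy).integral_eq_zero hO
    h.contDiffOn_comp_symm h.vanishes_comp_symm (hcv.2 (hint.congr (hpt.mono fun z hz => hz.symm)))
  have hsum := integral_sub' (hJ.add hi) (hq.const_mul 2)
  rw [integral_add' hJ hi, hJ0, integral_const_mul] at hsum
  rw [hcv2, integral_congr_ae hpt] at hw
  have h0 := hw.symm.trans hsum
  linarith

/-- The right-hand side of the previous identity is linear in `∇φ` with coefficient at most `κ M`,
so Young's inequality absorbs half of the energy of `φ`. -/
theorem integral_norm_fderiv_sq_le (h : IsRelativePhase Ω d r x y vx vy e φ M)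
    (hr : IsClearRadius Ω x r) (hO : IsOpen Ω) (hb : Bornology.IsBounded Ω)
    (hvx : IsHarmonicCircleMap Ω vx) (hvy : IsHarmonicCircleMap Ω vy)
    (hi : IntegrableOn (fun z => ‖fderiv ℝ φ z‖ ^ 2) Ω)
    (hJ : IntegrableOn (fun z => fderiv ℝ φ z (vortexCurrent d x vx z)) Ω)
    (hκ : ∀ z, ‖deformationDel r x y z‖ ≤ κ ∧ ‖deformationDelBar r x y z‖ ≤ κ) (hM : 0 ≤ M) :
    ∫ z in Ω, ‖fderiv ℝ φ z‖ ^ 2 ≤ 4 * (κ * M) ^ 2 * volume.real Ω := by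
  have h1 := h.integral_norm_fderiv_sq hr hO hb hvx hvy hi hJ hκ hM
  have hq := h.integrableOn_fderiv_delBar hr hO hb hvy hi hκ hM
  have hc := integrableOn_const (C := (κ * M) ^ 2) hb.measure_lt_top.ne (μ := volume)
  have h2 : ∫ z in Ω, fderiv ℝ φ z
      (deformationDelBar r x y z * conj (vortexCurrent d y vy (e z))) ≤
      ∫ z in Ω, (1 / 4 * ‖fderiv ℝ φ z‖ ^ 2 + (κ * M) ^ 2) := by
    refine integral_mono hq ((hi.const_mul _).add hc) fun z => ?_
    have h3 := h.norm_fderiv_apply_le hr.pos hκ hM z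
    refine (le_abs_self _).trans ?_
    rw [← Real.norm_eq_abs]
    refine (ContinuousLinearMap.le_opNorm _ _).trans ?_
    refine (mul_le_mul_of_nonneg_left h3 (norm_nonneg _)).trans ?_
    nlinarith [sq_nonneg (‖fderiv ℝ φ z‖ / 2 - κ * M)]
  rw [integral_add (hi.const_mul _) hc, integral_const_mul, setIntegral_const, smul_eq_mul] at h2
  linarith

/-- The energy density transported by the deformation. -/
theorem det_mul_norm_sq_sub (h : IsRelativePhase Ω d r x y vx vy e φ M)
    (hz : z ∈ Ω \ singularPoints x) :
    (‖1 + deformationDel r x y z‖ ^ 2 - ‖deformationDelBar r x y z‖ ^ 2) *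
      ‖vortexCurrent d y vy (e z)‖ ^ 2 - ‖vortexCurrent d x vx z‖ ^ 2 =
    2 * fderiv ℝ φ z (vortexCurrent d x vx z) + ‖fderiv ℝ φ z‖ ^ 2 -
      (2 * ‖deformationDelBar r x y z‖ ^ 2 * ‖vortexCurrent d y vy (e z)‖ ^ 2 +
        2 * ((1 + deformationDel r x y z) * deformationDelBar r x y z *
          conj (vortexCurrent d y vy (e z)) ^ 2).re) := by
  have h1 := norm_sq_mul_add_mul_conj (1 + deformationDel r x y z) (deformationDelBar r x y z)
    (vortexCurrent d y vy (e z))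
  rw [← h.deformedCurrent_eq] at h1
  have h2 := norm_add_sq_real (vortexCurrent d x vx z)
    (deformedCurrent d r x y vy z - vortexCurrent d x vx z)
  rw [add_sub_cancel, real_inner_comm, ← h.fderiv_apply hz, ← h.norm_fderiv hz] at h2
  linarith

theorem setIntegral_perforated (h : IsRelativePhase Ω d r x y vx vy e φ M) (hO : IsOpen Ω)
    {ρ : ℝ} (hρ : ρ ≤ r) :
    (∫ z in perforated Ω y ρ, ‖vortexCurrent d y vy z‖ ^ 2 = ∫ z in perforated Ω x ρ,
      (‖1 + deformationDel r x y z‖ ^ 2 - ‖deformationDelBar r x y z‖ ^ 2) *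
        ‖vortexCurrent d y vy (e z)‖ ^ 2) ∧
    (IntegrableOn (fun z => ‖vortexCurrent d y vy z‖ ^ 2) (perforated Ω y ρ) →
      IntegrableOn (fun z => (‖1 + deformationDel r x y z‖ ^ 2 - ‖deformationDelBar r x y z‖ ^ 2) *
        ‖vortexCurrent d y vy (e z)‖ ^ 2) (perforated Ω x ρ)) := by
  have hdet : ∀ z, |(((1 + deformationDel r x y z) • ContinuousLinearMap.id ℝ ℂ +
      deformationDelBar r x y z • conjCLE.toContinuousLinearMap : ℂ →L[ℝ] ℂ)).det| =
      ‖1 + deformationDel r x y z‖ ^ 2 - ‖deformationDelBar r x y z‖ ^ 2 := fun z => by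
    rw [det_smul_id_add_smul_conj, abs_of_pos (sub_pos.2 (h.det_pos z))]
  have hm := measurableSet_perforated hO x ρ
  have hcv := integrableOn_image_iff_integrableOn_abs_det_fderiv_smul volume hm
    (fun z _ => (h.hasFDerivAt z).hasFDerivWithinAt) e.injective.injOn
    (fun z => ‖vortexCurrent d y vy z‖ ^ 2)
  have hcv2 := integral_image_eq_integral_abs_det_fderiv_smul volume hm
    (fun z _ => (h.hasFDerivAt z).hasFDerivWithinAt) e.injective.injOn
    (fun z => ‖vortexCurrent d y vy z‖ ^ 2)
  rw [h.image_perforated hρ] at hcv hcv2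
  simp only [hdet, smul_eq_mul] at hcv hcv2
  exact ⟨hcv2, hcv.1⟩

/-- After transport by the deformation both truncated energies are integrals over the same set and
the divergent terms `c ρ` cancel. The limit is `Wy - Wx = ∫ |∇φ|² - ∫ R`, where `R` is supported on
the annuli and agrees with `2 Re (q conj J_x²)` up to quadratic errors. In the application `κ` is of
order `‖y - x‖`. -/
theorem abs_energy_sub_le (h : IsRelativePhase Ω d r x y vx vy e φ M)
    (hr : IsClearRadius Ω x r) (hO : IsOpen Ω) (hb : Bornology.IsBounded Ω)
    (hvx : IsHarmonicCircleMap Ω vx) (hvy : IsHarmonicCircleMap Ω vy)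
    (hLx : ∀ ρ > 0, IntegrableOn (fun z => ‖vortexCurrent d x vx z‖ ^ 2) (perforated Ω x ρ))
    (hLy : ∀ ρ > 0, IntegrableOn (fun z => ‖vortexCurrent d y vy z‖ ^ 2) (perforated Ω y ρ))
    {c : ℝ → ℝ} {Wx Wy : ℝ}
    (hWx : Tendsto (fun ρ => (∫ z in perforated Ω x ρ, ‖vortexCurrent d x vx z‖ ^ 2) - c ρ)
      (𝓝[>] 0) (𝓝 Wx))
    (hWy : Tendsto (fun ρ => (∫ z in perforated Ω y ρ, ‖vortexCurrent d y vy z‖ ^ 2) - c ρ)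
      (𝓝[>] 0) (𝓝 Wy))
    (hκ : ∀ z, ‖deformationDel r x y z‖ ≤ κ ∧ ‖deformationDelBar r x y z‖ ≤ κ) (hM : 0 ≤ M) :
    |Wy - Wx + ∫ z in Ω, 2 * (deformationDelBar r x y z * conj (vortexCurrent d x vx z) ^ 2).re| ≤
      26 * (κ * M) ^ 2 * volume.real Ω := by
  have hi := h.integrableOn_norm_fderiv_sq hr hO hLx hLy
  have hJ := h.integrableOn_fderiv_apply hr hO hvx hLx hLy
  have hle := h.integral_norm_fderiv_sq_le hr hO hb hvx hvy hi hJ hκ hM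
  have hJ0 := (weakDivFree_vortexCurrent (d := d) (x := x) hO hvx).integral_eq_zero hO h.contDiffOn
    h.vanishes hJ
  have hκ0 : 0 ≤ κ := (norm_nonneg _).trans (hκ 0).1
  have hbc := h.continuousOn_comp hr hO hvy
  have hxc := (contDiffOn_vortexCurrent (d := d) (x := x) hO hvx).continuousOn
  have hqc := continuous_deformationDelBar r x y
  have hpc := continuous_deformationDel r x y
  let R : ℂ → ℝ := fun z => 2 * ‖deformationDelBar r x y z‖ ^ 2 *
    ‖vortexCurrent d y vy (e z)‖ ^ 2 + 2 * ((1 + deformationDel r x y z) *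
      deformationDelBar r x y z * conj (vortexCurrent d y vy (e z)) ^ 2).re
  let Q : ℂ → ℝ := fun z => 2 * (deformationDelBar r x y z * conj (vortexCurrent d x vx z) ^ 2).re
  have hz0 := fun z (hz : z ∉ annuli x r) => (deformationDel_eq_zero_of_notMem hr.pos y hz).2
  have hRi : IntegrableOn R Ω := by
    have hbc' := continuous_conj.comp_continuousOn hbc
    refine integrableOn_of_annuli (x := x) (r := r) (C := 2 * κ ^ 2 * M ^ 2 + 2 * ((1 + κ) * κ * M ^ 2))
      hb hO ?_ (by positivity) (fun z hz => ?_) fun z hz => ?_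
    · exact ((hqc.norm.pow 2).continuousOn.const_mul 2 |>.mul (hbc.norm.pow 2)).add
        (continuousOn_const.mul (continuous_re.comp_continuousOn
          (((continuous_const.add hpc).mul hqc).continuousOn.mul (hbc'.pow 2))))
    · have hb1 := (h.bound z hz).1
      refine (abs_add_le _ _).trans (add_le_add ?_ ?_)
      · rw [abs_of_nonneg (by positivity)]
        gcongr
        exact (hκ z).2
      · rw [abs_mul, abs_two]
        refine mul_le_mul_of_nonneg_left ((abs_re_le_norm _).trans ?_) zero_le_two
        rw [norm_mul, norm_mul, norm_pow, norm_conj]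
        gcongr
        · exact (norm_add_le _ _).trans (by rw [norm_one]; linarith [(hκ z).1])
        · exact (hκ z).2
    · simp [R, hz0 z hz]
  have hQi : IntegrableOn Q Ω := by
    have hxc' := continuous_conj.comp_continuousOn hxc
    refine integrableOn_of_annuli (x := x) (r := r) (C := 2 * (κ * M ^ 2))
      hb hO ?_ (by positivity) (fun z hz => ?_) fun z hz => ?_
    · exact continuousOn_const.mul (continuous_re.comp_continuousOn
          (hqc.continuousOn.mul (hxc'.pow 2)))
    · have hb1 := (h.bound z hz).2
      rw [abs_mul, abs_two]
      refine mul_le_mul_of_nonneg_left ((abs_re_le_norm _).trans ?_) zero_le_two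
      rw [norm_mul, norm_pow, norm_conj]
      gcongr
      exact (hκ z).2
    · simp [Q, hz0 z hz]
  -- The difference of densities is `2 dφ(J_x) + |∇φ|² - R`, integrable on all of `Ω`; its first
  -- term integrates to zero.
  have hW : Wy - Wx = (∫ z in Ω, ‖fderiv ℝ φ z‖ ^ 2) - ∫ z in Ω, R z := by
    have hTi := ((hJ.const_mul 2).add hi).sub hRi
    have h1 := tendsto_setIntegral_perforated hO x hTi
    have h2 := hWy.sub hWx
    have h3 : ∫ z in Ω, (((fun z => 2 * fderiv ℝ φ z (vortexCurrent d x vx z)) +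
        (fun z => ‖fderiv ℝ φ z‖ ^ 2)) - R) z =
        (∫ z in Ω, ‖fderiv ℝ φ z‖ ^ 2) - ∫ z in Ω, R z := by
      rw [integral_sub' ((hJ.const_mul 2).add hi) hRi, integral_add' (hJ.const_mul 2) hi,
        integral_const_mul, hJ0, mul_zero, zero_add]
    rw [← h3]
    refine tendsto_nhds_unique h2 (h1.congr' ?_)
    filter_upwards [self_mem_nhdsWithin, nhdsWithin_le_nhds (Iic_mem_nhds hr.pos)] with ρ hρ0 hρ
    obtain ⟨e1, e2⟩ := h.setIntegral_perforated hO hρ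
    rw [sub_sub_sub_cancel_right, e1, ← integral_sub (e2 (hLy ρ hρ0)) (hLx ρ hρ0)]
    refine setIntegral_congr_fun (measurableSet_perforated hO x ρ) fun z hz => ?_
    exact (h.det_mul_norm_sq_sub ⟨hz.1, notMem_singularPoints_of_mem_perforated hρ0 hz⟩).symm
  -- Pointwise the difference is at most `12 (κ M)² + 4 κ M |∇φ|`, and Young's inequality gives `2
  -- |∇φ|² + 14 (κ M)²`. With the further `∫ |∇φ|²` in `hW` and the bound `4 (κ M)²` per unit area,
  -- the final constant is `3 · 4 + 14 = 26`.
  have hdiff : |∫ z in Ω, (Q z - R z)| ≤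
      ∫ z in Ω, (2 * ‖fderiv ℝ φ z‖ ^ 2 + 14 * (κ * M) ^ 2) := by
    have hc := integrableOn_const (C := 14 * (κ * M) ^ 2) hb.measure_lt_top.ne (μ := volume)
    rw [← Real.norm_eq_abs]
    refine norm_integral_le_of_norm_le ((hi.const_mul 2).add hc) ?_
    filter_upwards [ae_restrict_mem_diff_singularPoints hO x] with z hz
    by_cases hza : z ∈ annuli x r
    · obtain ⟨hb1, hb2⟩ := h.bound z hza
      obtain ⟨hp, hq⟩ := hκ z
      have e1 := h.norm_fderiv hz
      rw [h.deformedCurrent_eq] at e1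
      simp only [Q, R]
      generalize deformationDel r x y z = p at *
      generalize deformationDelBar r x y z = q at *
      generalize vortexCurrent d y vy (e z) = b at *
      generalize vortexCurrent d x vx z = J at *
      set f := ‖fderiv ℝ φ z‖
      -- The relation between `∇φ` and the currents says that `b - J` equals the gradient of `φ` up
      -- to terms of order `κ M`.
      have hbJ : ‖b - J‖ ≤ f + 2 * (κ * M) := by
        have e2 : b - J = (conj (1 + p) * b + q * conj b - J) - (conj p * b + q * conj b) := by
          rw [map_add, map_one]; ring
        rw [e2, e1]
        refine (_root_.norm_sub_le _ _).trans (add_le_add_right ((norm_add_le _ _).trans ?_) _)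
        rw [norm_mul, norm_mul, norm_conj, norm_conj]
        have e3 : ‖p‖ * ‖b‖ ≤ κ * M := by gcongr
        have e4 : ‖q‖ * ‖b‖ ≤ κ * M := by gcongr
        linarith
      have e5 : 2 * (q * conj J ^ 2).re - (2 * ‖q‖ ^ 2 * ‖b‖ ^ 2 + 2 * ((1 + p) * q * conj b ^ 2).re) =
          -(2 * ‖q‖ ^ 2 * ‖b‖ ^ 2) - 2 * (p * q * conj b ^ 2 + q * (conj (b - J) * conj (b + J))).re := by
        have : q * conj J ^ 2 = (1 + p) * q * conj b ^ 2 -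
            (p * q * conj b ^ 2 + q * (conj (b - J) * conj (b + J))) := by
          rw [map_sub, map_add]; ring
        rw [this, sub_re]; ring
      have hf0 : 0 ≤ f := norm_nonneg _
      have hn : ‖p * q * conj b ^ 2 + q * (conj (b - J) * conj (b + J))‖ ≤
          κ * κ * M ^ 2 + κ * ((f + 2 * (κ * M)) * (M + M)) := by
        refine (norm_add_le _ _).trans (add_le_add ?_ ?_)
        · rw [norm_mul, norm_mul, norm_pow, norm_conj]; gcongr
        · rw [norm_mul, norm_mul, norm_conj, norm_conj]
          gcongr
          exact (norm_add_le _ _).trans (add_le_add hb1 hb2)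
      have e6 : 2 * ‖q‖ ^ 2 * ‖b‖ ^ 2 ≤ 2 * κ ^ 2 * M ^ 2 := by gcongr
      have e7 : 0 ≤ 2 * ‖q‖ ^ 2 * ‖b‖ ^ 2 := by positivity
      rw [e5, Real.norm_eq_abs]
      have e8 := (abs_re_le_norm _).trans hn
      refine (abs_sub _ _).trans ?_
      rw [abs_neg, abs_of_nonneg e7, abs_mul, abs_two]
      nlinarith [sq_nonneg (f - κ * M)]
    · have e1 : Q z - R z = 0 := by simp [Q, R, hz0 z hza]
      rw [e1, norm_zero]
      positivity
  have hc := integrableOn_const (C := 14 * (κ * M) ^ 2) hb.measure_lt_top.ne (μ := volume)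
  rw [integral_add (hi.const_mul 2) hc, integral_const_mul, setIntegral_const, smul_eq_mul,
    integral_sub hQi hRi] at hdiff
  have hnn : 0 ≤ ∫ z in Ω, ‖fderiv ℝ φ z‖ ^ 2 := integral_nonneg fun z => by positivity
  have e9 : Wy - Wx + ∫ z in Ω, Q z =
      (∫ z in Ω, ‖fderiv ℝ φ z‖ ^ 2) + ((∫ z in Ω, Q z) - ∫ z in Ω, R z) := by rw [hW]; ring
  change |Wy - Wx + ∫ z in Ω, Q z| ≤ _
  rw [e9]
  refine (abs_add_le _ _).trans ?_
  rw [abs_of_nonneg hnn]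
  linarith

end IsRelativePhase

end EnergyEstimate

/-! ### The first-order term as a residue at one singularity -/

section Residue

open Complex Metric Filter
open scoped ComplexConjugate

variable {r : ℝ} {a : ℂ}

theorem circleAverage_inv_sub {s : ℝ} (hs : s ≠ 0) (a : ℂ) :
    Real.circleAverage (fun z => (z - a)⁻¹) a s = 0 := by
  rw [Real.circleAverage_eq_circleIntegral hs]
  have h1 : ∀ z : ℂ, (z - a)⁻¹ • (z - a)⁻¹ = (z - a) ^ (-2 : ℤ) := fun z => by
    rw [smul_eq_mul, ← pow_two, inv_pow, zpow_neg]; rfl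
  simp_rw [h1]
  rw [circleIntegral.integral_sub_zpow_of_ne (by norm_num), smul_zero]

/-- Expanding the square gives `d² / (z - a) + 2 d k + (z - a) k²`: the first term has average zero,
and the others are holomorphic and contribute their value at `a`. -/
theorem circleAverage_sub_mul_sq {s : ℝ} (hs : 0 < s) (d : ℂ) {k : ℂ → ℂ}
    (hk : DifferentiableOn ℂ k (closedBall a s)) :
    Real.circleAverage (fun z => (z - a) * (d / (z - a) + k z) ^ 2) a s = 2 * d * k a := by
  have hsph : sphere a |s| ⊆ closedBall a s := by
    rw [abs_of_pos hs]; exact sphere_subset_closedBall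
  have hne : ∀ z ∈ sphere a |s|, z - a ≠ 0 := fun z hz => by
    rw [abs_of_pos hs] at hz
    exact sub_ne_zero.2 (ne_of_mem_sphere hz hs.ne')
  have hG : DifferentiableOn ℂ (fun z => 2 * d * k z + (z - a) * k z ^ 2) (closedBall a s) := by
    fun_prop
  have h1 : Real.circleAverage (fun z => (z - a) * (d / (z - a) + k z) ^ 2) a s =
      Real.circleAverage (fun z => d ^ 2 • (z - a)⁻¹ + (2 * d * k z + (z - a) * k z ^ 2)) a s := by
    refine Real.circleAverage_congr_sphere fun z hz => ?_
    have := hne z hz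
    simp only [smul_eq_mul]
    field_simp
    ring
  have hinv : ContinuousOn (fun z => d ^ 2 • (z - a)⁻¹) (sphere a |s|) := by
    have : ContinuousOn (fun z => (z - a)⁻¹) (sphere a |s|) :=
      ContinuousOn.inv₀ (f := fun z => z - a) (by fun_prop) hne
    fun_prop
  rw [h1, Real.circleAverage_fun_add hinv.circleIntegrable'
    (hG.continuousOn.mono hsph).circleIntegrable', Real.circleAverage_fun_smul,
    circleAverage_inv_sub hs.ne', smul_zero, zero_add,
    circleAverage_of_differentiable_on_off_countable countable_empty
      (by rw [abs_of_pos hs]; exact hG.continuousOn) (fun z hz => hG.differentiableAt ?_)]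
  · simp
  · rw [sdiff_empty, abs_of_pos hs] at hz
    exact closedBall_mem_nhds_of_mem hz

theorem radialCutoffDeriv_of_mem_sphere {z : ℂ} {s : ℝ} (hz : z ∈ sphere a |s|) :
    radialCutoffDeriv r a z = radialCutoffDeriv r 0 s := by
  rw [mem_sphere, dist_eq_norm] at hz
  rw [radialCutoffDeriv, radialCutoffDeriv, hz, sub_zero, norm_real, Real.norm_eq_abs]

/-- The integrand is the derivative of the radial profile of the cutoff, which falls from `1` to
`0`; this is why the final formula does not depend on the cutoff radius. -/
theorem integral_radialCutoffDeriv (hr : 0 < r) :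
    ∫ s in (0 : ℝ)..(4 * r), 2 * s * radialCutoffDeriv r 0 s = -1 := by
  have hd : ∀ s : ℝ, HasDerivAt (fun s : ℝ => radialCutoff r 0 s)
      (2 * s * radialCutoffDeriv r 0 s) s := fun s => by
    refine ((hasFDerivAt_radialCutoff r 0 (s : ℂ)).comp_hasDerivAt s
      (ofRealCLM.hasDerivAt (x := s))).congr_deriv ?_
    simp
    ring
  have hc := continuous_radialCutoffDeriv r 0
  rw [intervalIntegral.integral_eq_sub_of_hasDerivAt (fun s _ => hd s)
    (Continuous.intervalIntegrable (by fun_prop) _ _), radialCutoff_eq_zero hr,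
    radialCutoff_eq_one hr (by simp [hr.le]), zero_sub]
  rw [sub_zero, norm_real, Real.norm_of_nonneg (by positivity)]
  linarith

/-- The derivative of the cutoff vanishes identically near `a`, which hides the pole. -/
theorem continuousOn_radialCutoffDeriv_mul (hr : 0 < r) (d : ℂ) {k : ℂ → ℂ} {s : Set ℂ}
    (hk : ContinuousOn k s) :
    ContinuousOn (fun z => radialCutoffDeriv r a z * ((z - a) * (d / (z - a) + k z) ^ 2)) s := by
  intro z hz
  by_cases h : z = a
  · subst h
    have h0 : (fun w => (radialCutoffDeriv r z w : ℂ) * ((w - z) * (d / (w - z) + k w) ^ 2))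
        =ᶠ[𝓝 z] fun _ => 0 := by
      filter_upwards [ball_mem_nhds z hr] with w hw
      rw [mem_ball, dist_eq_norm] at hw
      rw [radialCutoffDeriv_eq_zero hr (Or.inl hw), ofReal_zero, zero_mul]
    exact (continuousAt_const.congr h0.symm).continuousWithinAt
  · have h1 : ContinuousWithinAt (fun w => d / (w - a)) s z :=
      (ContinuousAt.div (f := fun _ => d) (g := fun w => w - a) continuousAt_const (by fun_prop)
        (sub_ne_zero.2 h)).continuousWithinAt
    have h2 := (continuous_radialCutoffDeriv r a).continuousWithinAt (s := s) (x := z)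
    exact (continuous_ofReal.continuousAt.comp_continuousWithinAt h2).mul
      (((continuousWithinAt_id).sub continuousWithinAt_const).mul ((h1.add (hk z hz)).pow 2))

/-- In polar coordinates the radial factor leaves the circle average, which is `2 d k(a)` for every
radius, and then integrates by itself. -/
theorem integral_radialCutoffDeriv_mul (hr : 0 < r) (d : ℂ) {k : ℂ → ℂ}
    (hk : DifferentiableOn ℂ k (closedBall a (4 * r))) :
    ∫ z in ball a (4 * r), radialCutoffDeriv r a z * ((z - a) * (d / (z - a) + k z) ^ 2) =
      -(2 * Real.pi * d * k a) := by
  rw [integral_ball_eq_polar (by positivity)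
    (continuousOn_radialCutoffDeriv_mul hr d hk.continuousOn)]
  have h1 : ∀ s ∈ uIcc 0 (4 * r), (2 * Real.pi * s) • Real.circleAverage (fun z =>
      (radialCutoffDeriv r a z : ℂ) * ((z - a) * (d / (z - a) + k z) ^ 2)) a s =
      (2 * s * radialCutoffDeriv r 0 s) • (2 * Real.pi * d * k a) := by
    intro s hs
    rw [uIcc_of_le (by positivity)] at hs
    rcases hs.1.eq_or_lt with h0 | h0
    · rw [← h0]; simp
    have h2 : Real.circleAverage (fun z =>
        (radialCutoffDeriv r a z : ℂ) * ((z - a) * (d / (z - a) + k z) ^ 2)) a s =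
        Real.circleAverage (fun z => (radialCutoffDeriv r 0 s) •
          ((z - a) * (d / (z - a) + k z) ^ 2)) a s := by
      refine Real.circleAverage_congr_sphere fun z hz => ?_
      rw [radialCutoffDeriv_of_mem_sphere hz, real_smul]
    rw [h2, Real.circleAverage_fun_smul,
      circleAverage_sub_mul_sq h0 d (hk.mono (closedBall_subset_closedBall hs.2))]
    simp only [real_smul]
    push_cast
    ring
  rw [intervalIntegral.integral_congr h1, intervalIntegral.integral_smul_const,
    integral_radialCutoffDeriv hr, neg_one_smul]

end Residue

/-! ### Sum of the residues over all singularities -/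

section ResidueSum

open Complex Metric Filter
open scoped ComplexConjugate

variable {n : ℕ} {x : Config n} {Ω : Set ℂ} {r : ℝ} {d : Fin n → ℤ} {v : ℂ → ℂ}

/-- In the disc at `x j` the conjugate current is `-i d_j / (z - x_j)` plus the holomorphic
conjugate of the regular current, and the weight vanishes outside that disc. -/
theorem IsClearRadius.integral_residue (hr : IsClearRadius Ω x r) (hO : IsOpen Ω)
    (hv : IsHarmonicCircleMap Ω v) (j : Fin n) :
    IntegrableOn (fun z => radialCutoffDeriv r (x j) z * ((z - x j) *
      conj (vortexCurrent d x v z) ^ 2)) Ω ∧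
    ∫ z in Ω, radialCutoffDeriv r (x j) z * ((z - x j) * conj (vortexCurrent d x v z) ^ 2) =
      2 * Real.pi * I * d j * conj (regularCurrent d x v j (x j)) := by
  have hr0 := hr.pos
  have hk : DifferentiableOn ℂ (fun z => conj (regularCurrent d x v j z))
      (closedBall (x j) (4 * r)) :=
    differentiableOn_conj_regularCurrent hO hv j (hr.subset j) fun l hl hmem => by
      have h1 := hr.separated j l hl
      rw [mem_closedBall] at hmem
      linarith
  have e1 : (fun z => (radialCutoffDeriv r (x j) z : ℂ) * ((z - x j) *
      conj (vortexCurrent d x v z) ^ 2)) = fun z => (radialCutoffDeriv r (x j) z : ℂ) * ((z - x j) *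
      (-(I * d j) / (z - x j) + conj (regularCurrent d x v j z)) ^ 2) := by
    funext z
    rw [vortexCurrent_eq_add_regularCurrent j, map_add, map_mul, conj_angularField, map_intCast]
    congr 4
    ring
  have hsub : ball (x j) (4 * r) ⊆ Ω := ball_subset_closedBall.trans (hr.subset j)
  have hz : ∀ z ∈ Ω \ ball (x j) (4 * r), (radialCutoffDeriv r (x j) z : ℂ) * ((z - x j) *
      (-(I * d j) / (z - x j) + conj (regularCurrent d x v j z)) ^ 2) = 0 := by
    intro z hz
    have h1 := hz.2
    rw [mem_ball, dist_eq_norm, not_lt] at h1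
    rw [radialCutoffDeriv_eq_zero hr0 (Or.inr (by linarith)), ofReal_zero, zero_mul]
  have hi := ((continuousOn_radialCutoffDeriv_mul (a := x j) hr0 (-(I * d j))
    hk.continuousOn).integrableOn_compact (isCompact_closedBall _ _) (μ := volume)).mono_set
      ball_subset_closedBall
  rw [e1]
  refine ⟨hi.of_forall_sdiff_eq_zero hO.measurableSet hz, ?_⟩
  have := setIntegral_eq_of_subset_of_forall_sdiff_eq_zero hO.measurableSet hsub hz (μ := volume)
  rw [this, integral_radialCutoffDeriv_mul hr0 _ hk]
  ring

/-- The `∂̄`-derivative of the displacement is linear in `y - x`, so the integral is a sum of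
residues, each multiplied by `y_j - x_j`; its real part is an inner product with `i` times the
regular current. -/
theorem IsClearRadius.integral_deformationDelBar (hr : IsClearRadius Ω x r) (hO : IsOpen Ω)
    (hv : IsHarmonicCircleMap Ω v) (y : Config n) :
    ∫ z in Ω, 2 * (deformationDelBar r x y z * conj (vortexCurrent d x v z) ^ 2).re =
      -∑ j, 4 * Real.pi * d j * inner ℝ (I * regularCurrent d x v j (x j)) (y j - x j) := by
  have h1 : ∀ z, 2 * (deformationDelBar r x y z * conj (vortexCurrent d x v z) ^ 2).re =
      ∑ j, (2 * (y j - x j) * (radialCutoffDeriv r (x j) z * ((z - x j) *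
        conj (vortexCurrent d x v z) ^ 2)) : ℂ).re := by
    intro z
    rw [← re_sum, deformationDelBar, Finset.sum_mul, ← re_ofReal_mul, Finset.mul_sum]
    congr 1
    refine Finset.sum_congr rfl fun j _ => ?_
    push_cast
    ring
  simp_rw [h1]
  have hi := fun j => (hr.integral_residue (d := d) hO hv j).1.const_mul (2 * (y j - x j) : ℂ)
  have hi' := fun j => reCLM.integrable_comp (hi j)
  simp only [reCLM_apply] at hi'
  rw [integral_finsetSum _ fun j _ => hi' j, ← Finset.sum_neg_distrib]
  refine Finset.sum_congr rfl fun j _ => ?_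
  have h2 := reCLM.integral_comp_comm (hi j)
  simp only [reCLM_apply] at h2
  rw [h2, integral_const_mul, (hr.integral_residue hO hv j).2, real_inner_eq_re_mul]
  simp
  ring

end ResidueSum

/-! ### Differentiability of the renormalised energy -/

section GradientOfEnergy

open Complex Metric Filter
open scoped ComplexConjugate ENNReal

theorem HasGradientAt.of_abs_sub_le {E : Type*} [NormedAddCommGroup E] [InnerProductSpace ℝ E]
    [CompleteSpace E] {f : E → ℝ} {x g : E} {C : ℝ}
    (h : ∀ᶠ y in 𝓝 x, |f y - f x - inner ℝ g (y - x)| ≤ C * ‖y - x‖ ^ 2) : HasGradientAt f g x := by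
  rw [hasGradientAt_iff_hasFDerivAt, hasFDerivAt_iff_isLittleO]
  have h1 : (fun y => f y - f x - InnerProductSpace.toDual ℝ E g (y - x)) =O[𝓝 x]
      fun y => ‖y - x‖ ^ 2 := by
    refine Asymptotics.IsBigO.of_bound C ?_
    filter_upwards [h] with y hy
    rwa [InnerProductSpace.toDual_apply_apply, Real.norm_eq_abs,
      Real.norm_of_nonneg (by positivity)]
  refine h1.trans_isLittleO ?_
  have h2 : Tendsto (fun y => ‖y - x‖) (𝓝 x) (𝓝 0) := by
    have : Continuous fun y => ‖y - x‖ := by fun_prop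
    simpa using this.tendsto x
  have h3 := (Asymptotics.isLittleO_pow_id (𝕜 := ℝ) (n := 2) (by norm_num)).comp_tendsto h2
  exact (h3.trans_isBigO (Asymptotics.isBigO_refl _ _)).of_norm_right

variable {n : ℕ} {x : Config n} {Ω : Set ℂ}

namespace IsVortexFamily

variable {g : ℂ → ℂ} {d : Fin n → ℤ} {p : ℝ≥0∞} {U : Set (Config n)} {u v : Config n → ℂ → ℂ}

theorem integrableOn_norm_vortexCurrent_sq (h : IsVortexFamily Ω g d p U u v) (hx : x ∈ U)
    {ρ : ℝ} (hρ : 0 < ρ) :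
    IntegrableOn (fun z => ‖vortexCurrent d x (v x) z‖ ^ 2) (perforated Ω x ρ) :=
  _root_.integrableOn_norm_vortexCurrent_sq h.domain h.datum (h.subset hx) (h.harmonic x hx)
    (h.eq_mul x hx) (h.boundaryValues x hx) hρ

theorem tendsto_integral_norm_vortexCurrent_sq (h : IsVortexFamily Ω g d p U u v) (hx : x ∈ U) :
    Tendsto (fun ρ => (∫ z in perforated Ω x ρ, ‖vortexCurrent d x (v x) z‖ ^ 2) -
      2 * Real.pi * ∑ j, (d j : ℝ) ^ 2 * Real.log (1 / ρ)) (𝓝[>] 0)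
      (𝓝 (renormalisedEnergy Ω d u x)) := by
  refine (tendsto_renormalisedEnergy h.domain h.datum (h.subset hx) (h.harmonic x hx)
    (h.eq_mul x hx) (h.boundaryValues x hx)).congr' ?_
  filter_upwards [self_mem_nhdsWithin] with ρ hρ
  rw [truncatedEnergy]
  congr 1
  refine setIntegral_congr_fun (measurableSet_perforated h.domain.isOpen x ρ) fun z hz => ?_
  exact dirichletDensity_eq_norm_vortexCurrent_sq h.domain.isOpen (h.harmonic x hx)
    (h.eq_mul x hx) ⟨hz.1, notMem_singularPoints_of_mem_perforated hρ hz⟩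

/-- The gradient of the renormalised energy in terms of the regular parts of the current. -/
theorem hasGradientAt_renormalisedEnergy (h : IsVortexFamily Ω g d p U u v) (hx : x ∈ U) :
    HasGradientAt (renormalisedEnergy Ω d u)
      (WithLp.toLp 2 fun j => (4 * Real.pi * (d j : ℝ)) • (I * regularCurrent d x (v x) j (x j)))
      x := by
  have hO := h.domain.isOpen
  obtain ⟨r, hr⟩ := exists_isClearRadius hO (h.subset hx)
  obtain ⟨M, hM, hev⟩ := h.exists_eventually_isRelativePhase hx hr
  obtain ⟨C, hC, hκ⟩ := exists_deformationDel_le hr.pos x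
  -- The energy estimate is applied with `κ = C ‖y - x‖`, so the remainder is quadratic in `‖y -
  -- x‖`.
  refine HasGradientAt.of_abs_sub_le (C := 26 * (C * M) ^ 2 * volume.real Ω) ?_
  filter_upwards [hev, h.mem_nhds hx] with y ⟨e, φ, hφ⟩ hy
  have h1 := hφ.abs_energy_sub_le hr hO h.domain.isBounded (h.harmonic x hx) (h.harmonic y hy)
    (fun ρ hρ => h.integrableOn_norm_vortexCurrent_sq hx hρ)
    (fun ρ hρ => h.integrableOn_norm_vortexCurrent_sq hy hρ)
    (h.tendsto_integral_norm_vortexCurrent_sq hx) (h.tendsto_integral_norm_vortexCurrent_sq hy)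
    (hκ y) hM
  rw [hr.integral_deformationDelBar hO (h.harmonic x hx)] at h1
  rw [PiLp.inner_apply]
  simp only [real_inner_smul_left, PiLp.sub_apply]
  rw [sub_eq_add_neg]
  refine h1.trans (le_of_eq ?_)
  ring

end IsVortexFamily

theorem IsSingularHarmonicFamily.exists_isVortexFamily {g : ℂ → ℂ} {d : Fin n → ℤ} {p : ℝ≥0∞}
    {U : Set (Config n)} {u : Config n → ℂ → ℂ} (hu : IsSingularHarmonicFamily Ω g d p U u)
    (hΩ : IsSmoothBoundedDomain Ω) (hg : IsSmoothBoundaryDatum Ω g) (hU : IsOpen U)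
    (hUΩ : U ⊆ configSpace Ω n) (hp₁ : 1 ≤ p) : ∃ v, IsVortexFamily Ω g d p U u v := by
  choose! v hv using hu.singularHarmonic
  exact ⟨v, hΩ, hg, hU, hUΩ, hp₁, fun y hy => (hv y hy).1, fun y hy => (hv y hy).2,
    hu.boundaryValues, hu.continuous⟩

end GradientOfEnergy

/-! ### The regular parts of `Φ` and their gradients -/

section RegularPart

open Complex Metric Filter
open scoped ComplexConjugate

/-- The punctured disc is the translated image of a half-plane under the exponential. -/
theorem isPreconnected_ball_diff_center (a : ℂ) (R : ℝ) : IsPreconnected (ball a R \ {a}) := by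
  rcases le_or_gt R 0 with hR | hR
  · rw [ball_eq_empty.2 hR, empty_sdiff]; exact isPreconnected_empty
  have h1 : ball a R \ {a} = (fun w => a + exp w) '' {w | w.re < Real.log R} := by
    ext z
    constructor
    · rintro ⟨h1, h2⟩
      have h3 : z - a ≠ 0 := sub_ne_zero.2 h2
      refine ⟨log (z - a), ?_, by simp [exp_log h3]⟩
      rw [mem_ball, dist_eq_norm] at h1
      rw [mem_ofPred_eq, log_re]
      exact Real.log_lt_log (norm_pos_iff.2 h3) h1
    · rintro ⟨w, hw, rfl⟩
      refine ⟨?_, by simp⟩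
      rw [mem_ball, dist_eq_norm, add_sub_cancel_left, norm_exp]
      exact (Real.lt_log_iff_exp_lt hR).1 hw
  rw [h1]
  exact (convex_halfSpace_re_lt _).isPreconnected.image _ (by fun_prop)

theorem hasGradientAt_log_norm_sub {a z : ℂ} (h : z ≠ a) :
    HasGradientAt (fun z => Real.log ‖z - a‖) (-I * angularField a z) z := by
  have h0 : z - a ≠ 0 := sub_ne_zero.2 h
  have h1 : HasFDerivAt (fun w : ℂ => ‖w - a‖ ^ 2)
      (2 • (innerSL ℝ (z - a)).comp (ContinuousLinearMap.id ℝ ℂ)) z :=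
    ((hasFDerivAt_id z).sub_const a).norm_sq
  have hn : ‖z - a‖ ≠ 0 := norm_ne_zero_iff.2 h0
  have h2 := (h1.log (pow_ne_zero 2 hn)).const_mul (1 / 2)
  rw [hasGradientAt_iff_hasFDerivAt]
  refine (h2.congr_of_eventuallyEq (Eventually.of_forall fun w => ?_)).congr_fderiv ?_
  · simp only [Real.log_pow]; push_cast; ring
  · ext w
    simp only [InnerProductSpace.toDual_apply_apply, smul_apply, ContinuousLinearMap.comp_apply,
      ContinuousLinearMap.id_apply, innerSL_apply_apply, smul_eq_mul, nsmul_eq_mul]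
    have e : -I * angularField a z = (‖z - a‖ ^ 2)⁻¹ • (z - a) := by
      rw [angularField_eq_conj, map_div₀, map_neg, conj_I, neg_neg, real_smul]
      have hc : conj (z - a) ≠ 0 := (map_ne_zero _).2 h0
      push_cast
      rw [← conj_mul']
      field_simp
      simp
    rw [e, real_inner_smul_left]
    push_cast
    ring

theorem gradient_eq_partials (f : ℂ → ℝ) (z : ℂ) :
    conj (gradient f z) = fderiv ℝ f z 1 - I * fderiv ℝ f z I := by
  have h1 : ∀ w, inner ℝ (gradient f z) w = fderiv ℝ f z w := fun w => by
    rw [gradient, InnerProductSpace.toDual_symm_apply]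
  rw [← h1, ← h1, real_inner_eq_re_mul, real_inner_eq_re_mul]
  apply Complex.ext <;> simp

theorem hasGradientAt_of_contDiffAt {f : ℂ → ℝ} {z : ℂ} (h : ContDiffAt ℝ 2 f z) :
    HasGradientAt f (gradient f z) z :=
  (h.differentiableAt (by simp)).hasGradientAt

variable {n : ℕ} {d : Fin n → ℤ} {x : Config n} {Ω : Set ℂ} {v : ℂ → ℂ} {Φ Θ : ℂ → ℝ}

theorem differentiableOn_conj_gradient (hO : IsOpen Ω) (hΘ : ContDiffOn ℝ 2 Θ Ω)
    (hΔ : ∀ z ∈ Ω, Laplacian.laplacian Θ z = 0) :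
    DifferentiableOn ℂ (fun z => conj (gradient Θ z)) Ω := by
  intro z hz
  have h1 : InnerProductSpace.HarmonicAt Θ z :=
    ⟨hΘ.contDiffAt (hO.mem_nhds hz), by filter_upwards [hO.mem_nhds hz] with w hw using hΔ w hw⟩
  simp_rw [gradient_eq_partials]
  exact (HarmonicAt.differentiableAt_complex_partial h1).differentiableWithinAt

/-- The regular part at `x j` of the conjugate `Φ` of the phase, and its gradient at `x j`. -/
theorem exists_isRegularPart (hO : IsOpen Ω) (hx : x ∈ configSpace Ω n)
    (hv : IsHarmonicCircleMap Ω v) (hΦ : ContDiffOn ℝ 2 Φ (Ω \ singularPoints x))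
    (hΘ : ContDiffOn ℝ 2 Θ Ω) (hΔ : ∀ z ∈ Ω, Laplacian.laplacian Θ z = 0)
    (hrep : ∀ z ∈ Ω \ singularPoints x,
      vortexCurrent d x v z = perp (gradient Φ z) + gradient Θ z) (j : Fin n) :
    ∃ H, IsRegularPart Ω d x Φ j H ∧
      HasGradientAt H (perp (gradient Θ (x j)) - I * regularCurrent d x v j (x j)) (x j) := by
  obtain ⟨r, hr⟩ := exists_isClearRadius hO hx
  have hr0 := hr.pos
  have hB : ball (x j) r ⊆ Ω :=
    (ball_subset_closedBall.trans (closedBall_subset_closedBall (by linarith))).trans (hr.subset j)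
  have hBx : ∀ l, l ≠ j → x l ∉ ball (x j) r := fun l hl hmem => by
    have h1 := hr.separated j l hl
    rw [mem_ball] at hmem
    linarith
  have hBS : ball (x j) r \ {x j} ⊆ Ω \ singularPoints x := by
    rintro z ⟨h1, h2⟩
    refine ⟨hB h1, ?_⟩
    rintro ⟨l, rfl⟩
    by_cases hl : l = j
    · exact h2 (by rw [hl]; rfl)
    · exact hBx l hl h1
  -- From `J = ∇^⊥Φ + ∇Θ` follows `∇Φ = -i (J - ∇Θ)`. The singular part of `-i J` at `x_j` is `d_j ∇
  -- log |z - x_j|`, so `c` is the gradient of the regular part off `x_j`, and it extends across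
  -- `x_j` with holomorphic conjugate.
  let c : ℂ → ℂ := fun z => I * gradient Θ z - I * regularCurrent d x v j z
  have hc : DifferentiableOn ℂ (fun z => conj (c z)) (ball (x j) r) := by
    have h1 := (differentiableOn_conj_gradient hO hΘ hΔ).mono hB
    have h2 := differentiableOn_conj_regularCurrent (d := d) (x := x) hO hv j hB hBx
    refine ((h1.const_mul (-I)).sub (h2.const_mul (-I))).congr fun z _ => ?_
    simp [c]
  obtain ⟨f, -, hf⟩ := exists_hasGradientAt_re hc
  let H₀ : ℂ → ℝ := fun z => Φ z - d j * Real.log ‖z - x j‖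
  have hH₀ : ∀ z ∈ ball (x j) r \ {x j}, HasGradientAt H₀ (c z) z := by
    intro z hz
    have hz' := hBS hz
    have h1 := hasGradientAt_of_contDiffAt
      (hΦ.contDiffAt ((isOpen_diff_singularPoints hO x).mem_nhds hz'))
    have h2 := hasGradientAt_log_norm_sub (a := x j) (z := z) hz.2
    have h3 : gradient Φ z = -I * (vortexCurrent d x v z - gradient Θ z) := by
      rw [hrep z hz', perp, add_sub_cancel_right, ← mul_assoc]; simp
    rw [hasGradientAt_iff_hasFDerivAt] at h1 h2 ⊢
    refine (h1.sub (h2.const_mul (d j : ℝ))).congr_fderiv ?_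
    rw [h3, vortexCurrent_eq_add_regularCurrent j]
    ext w
    simp only [sub_apply, smul_apply, InnerProductSpace.toDual_apply_apply, smul_eq_mul]
    rw [← real_inner_smul_left, ← inner_sub_left, real_smul]
    congr 1
    simp only [c]
    push_cast
    ring
  have hopen : IsOpen (ball (x j) r \ {x j}) := isOpen_ball.sdiff isClosed_singleton
  -- The punctured disc is connected, so `H₀` and `Re f` differ by a constant there; this prescribes
  -- the value at `x j` that makes the extension smooth.
  obtain ⟨C, hC⟩ := hopen.exists_is_const_of_fderiv_eq_zero (𝕜 := ℝ)
    (f := fun z => H₀ z - (f z).re) (isPreconnected_ball_diff_center (x j) r)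
    (fun z hz => ((hH₀ z hz).differentiableAt.sub
      (hf z hz.1).differentiableAt).differentiableWithinAt)
    (fun z hz => by
      rw [((hH₀ z hz).hasFDerivAt.fun_sub (hf z hz.1).hasFDerivAt).fderiv, sub_self]; rfl)
  classical
  let H : ℂ → ℝ := fun z => if z = x j then (f z).re + C else H₀ z
  have hHf : ∀ z ∈ ball (x j) r, H z = (f z).re + C := by
    intro z hz
    by_cases h : z = x j
    · exact if_pos h
    · simp only [H, if_neg h]
      linarith [hC z ⟨hz, h⟩]
  have hgrad : HasGradientAt H (c (x j)) (x j) := by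
    have h1 := hf (x j) (mem_ball_self hr0)
    rw [hasGradientAt_iff_hasFDerivAt] at h1 ⊢
    refine (h1.add_const C).congr_of_eventuallyEq ?_
    filter_upwards [ball_mem_nhds (x j) hr0] with z hz using hHf z hz
  refine ⟨H, ⟨fun z hz => ?_, fun z hz => if_neg (ne_of_notMem_singularPoints hz.2 j)⟩, hgrad⟩
  by_cases h : z = x j
  · rw [h]; exact hgrad.differentiableAt.continuousAt.continuousWithinAt
  · have hzS : z ∈ Ω \ singularPoints x := by
      refine ⟨hz.1, ?_⟩
      rintro ⟨l, rfl⟩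
      exact hz.2 ⟨l, fun hl => h (by rw [hl]), rfl⟩
    have h1 := (hΦ.contDiffAt ((isOpen_diff_singularPoints hO x).mem_nhds hzS)).continuousAt
    have h2 : ContinuousAt (fun w => Real.log ‖w - x j‖) z :=
      (hasGradientAt_log_norm_sub h).differentiableAt.continuousAt
    have h3 : H₀ =ᶠ[𝓝 z] H := by
      filter_upwards [isOpen_ne.mem_nhds h] with w hw using (if_neg hw).symm
    exact ((h1.sub (continuousAt_const.mul h2)).congr h3).continuousWithinAt

end RegularPart

/-! ### Gradient of the renormalised energy in terms of `Φ` and `Θ` -/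

theorem mainTheorem6 (Ω : Set ℂ) (hΩ : IsSmoothBoundedDomain Ω)
    (g : ℂ → ℂ) (hg : IsSmoothBoundaryDatum Ω g)
    (n : ℕ) (d : Fin n → ℤ)
    (U : Set (Config n)) (hU : IsOpen U) (hUΩ : U ⊆ configSpace Ω n)
    (p : ENNReal) (hp₁ : 1 ≤ p) (hp₂ : p < 2)
    (u : Config n → ℂ → ℂ) (hu : IsSingularHarmonicFamily Ω g d p U u) :
    (∀ y ∈ U,
      (∀ ρ : ℝ, 0 < ρ → IntegrableOn (dirichletDensity (u y)) (perforated Ω y ρ)) ∧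
      Filter.Tendsto (truncatedEnergy Ω d (u y) y) (𝓝[>] (0 : ℝ))
        (𝓝 (renormalisedEnergy Ω d u y))) ∧
    ∀ x ∈ U, ∀ Φ Θ : ℂ → ℝ, SolvesSingularLinearProblem Ω g d x Φ Θ →
      RepresentsCurrent Ω x Φ Θ (u x) →
      ∃ H : Fin n → ℂ → ℝ,
        (∀ j, IsRegularPart Ω d x Φ j (H j) ∧ DifferentiableAt ℝ (H j) (x j)) ∧
        HasGradientAt (renormalisedEnergy Ω d u)
          (WithLp.toLp 2 fun j =>
            (-(4 * Real.pi) * (d j : ℝ)) • (gradient (H j) (x j) - perp (gradient Θ (x j))))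
          x := by
  obtain ⟨v, h⟩ := hu.exists_isVortexFamily hΩ hg hU hUΩ hp₁
  refine ⟨fun y hy => ⟨fun ρ hρ => integrableOn_dirichletDensity hΩ hg (hUΩ hy) (h.harmonic y hy)
    (h.eq_mul y hy) (h.boundaryValues y hy) hρ, tendsto_renormalisedEnergy hΩ hg (hUΩ hy)
    (h.harmonic y hy) (h.eq_mul y hy) (h.boundaryValues y hy)⟩, fun x hx Φ Θ hs hrep => ?_⟩
  have hrep' : ∀ z ∈ Ω \ singularPoints x,
      vortexCurrent d x (v x) z = perp (gradient Φ z) + gradient Θ z := fun z hz => by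
    rw [← hrep z hz, (hasCurrent_of_eqOn hΩ.isOpen (h.harmonic x hx) (h.eq_mul x hx) hz).current_eq]
  choose H hH hgrad using exists_isRegularPart hΩ.isOpen (hUΩ hx) (h.harmonic x hx)
    hs.contDiffOn_Phi hs.contDiffOn_Theta hs.laplacian_Theta hrep'
  refine ⟨H, fun j => ⟨hH j, (hgrad j).differentiableAt⟩, ?_⟩
  refine (congrArg (fun w => HasGradientAt (renormalisedEnergy Ω d u) (WithLp.toLp 2 w) x)
    (funext fun j => ?_)).mp (h.hasGradientAt_renormalisedEnergy hx)
  -- Since `∇H_j = ∇^⊥Θ - i · (regular current)` at `x_j`, the two expressions of the gradient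
  -- agree, sign included.
  rw [(hgrad j).gradient, sub_sub_cancel_left, neg_mul, smul_neg, neg_smul, neg_neg]
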